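/- **Setting.** Let $a_0\ge 0$, $b_0\in\mathbb R$ and let $a,b\in L^1(0,\infty)$ be real valued. Put $\beta_0=\frac{4a_0+2b_0}{3}$, $\beta(t)=\frac{4a(t)+2b(t)}{3}$, and assume $\beta_0\ge 0$. Let $s\ge 0$ and $v_0\in L^1(\mathbb R^3,\mathbb R^3)\cap H^s(\mathbb R^3,\mathbb R^3)$. Let $v\in C([0,\infty),H^s(\mathbb R^3,\mathbb R^3))$ be the solution, in the sense of distributions on $\mathbb R^3\times[0,\infty)$, of the Boltzmann system of linear viscoelasticity $$v_t=a_0\Delta v+\tfrac{a_0+2b_0}{3}\nabla\nabla\cdot v+a*\Delta v+\tfrac{a+2b}{3}*\nabla\nabla\cdot v,\qquad v(\cdot,0)=v_0,$$ where $(f*g)(t)=\int_0^t f(t-r)g(r)\,dr$. **Assumptions on the kernels.** There is an $\alpha>0$ such that each of the pairs $(c,k)=(a_0,a)$ and $(c,k)=(\beta_0,\beta)$ satisfies the following. The Laplace transform $\tilde k(z)=\int_0^\infty e^{-zt}k(t)\,dt$ extends to a bounded continuous function on the closed half plane $\{\operatorname{Re}z\ge-\alpha\}$ that is analytic in its interior,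 and either 1. $c>0$ and $c+\operatorname{Re}\tilde k(i\omega)>0$ for all $\omega\in\mathbb R$, or 2. $k$ is not a.e. zero and $\operatorname{Re}\tilde k(-\alpha+i\omega)\ge 0$ for all $\omega\in\mathbb R$. **Theorem.** Let $V_0=\int_{\mathbb R^3}v_0(x)\,dx\in\mathbb R^3$ and $$A=a_0+\int_0^\infty a(r)\,dr,\qquad B=\tfrac43A+\tfrac23\Big(b_0+\int_0^\infty b(r)\,dr\Big).$$ For $t>0$ let $U(\cdot,t)$ and $V(\cdot,t)$ be the $3\times3$ matrix valued functions on $\mathbb R^3$ with Fourier transforms (in the convention $\hat f(\xi)=\int e^{-ix\cdot\xi}f(x)\,dx$) $$\hat U(\xi,t)=\frac{\xi\xi^T}{|\xi|^2}e^{-|\xi|^2t},\qquad \hat V(\xi,t)=\Big(E-\frac{\xi\xi^T}{|\xi|^2}\Big)e^{-|\xi|^2t},$$ where $E$ is the identity matrix, so that $U(x,Bt)+V(x,At)$ is the fundamental solution of the compressible Stokes system $w_t=A\Delta w+(B-A)\nabla\nabla\cdot w$. Then $v(\cdot,t)-V_0^TU(\cdot,Bt)-V_0^TV(\cdot,At)\in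 H^s$ for every $t>0$, and $$\big\|v(\cdot,t)-V_0^TU(\cdot,Bt)-V_0^TV(\cdot,At)\big\|_{H^s}=o\big(t^{-3/4}\big)\qquad(t\to\infty).$$ -/

import Mathlib

open MeasureTheory Set Filter Topology Asymptotics
open scoped ENNReal ContDiff FourierTransform Laplacian Gradient RealInnerProductSpace

namespace BoltzmannVisco

noncomputable section

/-- Physical (and frequency) space `ℝ³` with its Euclidean norm. -/
abbrev E3 : Type := EuclideanSpace ℝ (Fin 3)

/-- `ℂ³` with its Hermitian norm. -/
abbrev C3 : Type := EuclideanSpace ℂ (Fin 3)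

/-- A real vector field, regarded as a complex one. -/
def complexify (f : E3 → E3) : E3 → C3 :=
  fun x => WithLp.toLp 2 (fun i => ((f x i : ℝ) : ℂ))

/-! ### Sobolev spaces `H^s`, `s ≥ 0` -/

/-- The norm of `H^s(ℝ³)`, `s ≥ 0`, of a vector field, as an extended nonnegative number; the value
is `∞` outside `L²`. Mathlib's Fourier transform is `𝓕 f η = ∫ exp (-2πi ⟪x, η⟫) f x dx`, so the
angular frequency is `ξ = 2πη`, and this is `(∫ (1 + |ξ|²)^s |f̂(ξ)|² dξ)^(1/2)` up to the constant
factor `(2π)^(3/2)`. -/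
def sobolevNorm (s : ℝ) (f : E3 → C3) : ℝ≥0∞ :=
  open Classical in
  if hf : MemLp f 2 (volume : Measure E3) then
    (∫⁻ η : E3, ENNReal.ofReal ((1 + ‖(2 * Real.pi) • η‖ ^ 2) ^ s) *
      ‖(𝓕 (hf.toLp f) : Lp C3 2 (volume : Measure E3)) η‖ₑ ^ 2) ^ (1 / 2 : ℝ)
  else ⊤

/-- Membership in `H^s(ℝ³, ℝ³)`, `s ≥ 0`. -/
def MemSobolevSpace (s : ℝ) (f : E3 → E3) : Prop :=
  sobolevNorm s (complexify f) < ⊤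

/-! ### The Boltzmann system of linear viscoelasticity -/

/-- The divergence `∇ · ψ` of a vector field. -/
def divergence (ψ : E3 → E3) (x : E3) : ℝ :=
  ∑ i : Fin 3, fderiv ℝ ψ x (EuclideanSpace.single i (1 : ℝ)) i

/-- The elastic operator `p Δψ + ((p + 2q)/3) ∇(∇ · ψ)` with shear modulus `p` and compression
modulus `q`. It is formally self-adjoint. -/
def elasticOp (p q : ℝ) (ψ : E3 → E3) (x : E3) : E3 :=
  p • (Δ ψ) x + ((p + 2 * q) / 3) • ∇ (divergence ψ) x

/-- `v` belongs to `C([0, ∞), H^s(ℝ³, ℝ³))`. -/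
def ContinuousInSobolev (s : ℝ) (v : ℝ → E3 → E3) : Prop :=
  (∀ t, 0 ≤ t → MemSobolevSpace s (v t)) ∧
  ∀ t₀, 0 ≤ t₀ →
    Tendsto (fun t => sobolevNorm s (complexify (fun x => v t x - v t₀ x))) (𝓝[Ici 0] t₀) (𝓝 0)

/-- The equation
`v_t = a₀ Δv + ((a₀ + 2b₀)/3) ∇∇·v + a * Δv + ((a + 2b)/3) * ∇∇·v`, `v(·, 0) = v₀`,
in the sense of distributions on `ℝ³ × [0, ∞)`. The test functions are the restrictions to
`t ≥ 0` of smooth compactly supported vector fields `Φ` on `ℝ × ℝ³`; the star is convolution in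
time over `(0, t)`. -/
def SolvesWeakly (a₀ b₀ : ℝ) (a b : ℝ → ℝ) (v₀ : E3 → E3) (v : ℝ → E3 → E3) : Prop :=
  ∀ Φ : ℝ → E3 → E3,
    ContDiff ℝ ∞ (fun y : ℝ × E3 => Φ y.1 y.2) →
    HasCompactSupport (fun y : ℝ × E3 => Φ y.1 y.2) →
    (∫ τ in Ioi (0 : ℝ), ∫ x : E3,
        ⟪v τ x, deriv (fun r => Φ r x) τ + elasticOp a₀ b₀ (Φ τ) x
          + ∫ r in Ioi τ, elasticOp (a (r - τ)) (b (r - τ)) (Φ r) x⟫)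
      + ∫ x : E3, ⟪v₀ x, Φ 0 x⟫ = 0

/-- `v` is the solution in `C([0, ∞), H^s(ℝ³, ℝ³))` of the Boltzmann system with initial
velocity `v₀`. -/
structure IsSolution (s a₀ b₀ : ℝ) (a b : ℝ → ℝ) (v₀ : E3 → E3) (v : ℝ → E3 → E3) : Prop where
  continuous : ContinuousInSobolev s v
  initial : v 0 =ᵐ[volume] v₀
  weak : SolvesWeakly a₀ b₀ a b v₀ v

/-! ### Assumptions on the kernels -/

/-- `F` is a bounded extension of the Laplace transform of `k` to the closed half plane
`Re z ≥ -α`, continuous there and analytic in the interior. -/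
structure IsLaplaceExtension (α : ℝ) (k : ℝ → ℝ) (F : ℂ → ℂ) : Prop where
  analytic : DifferentiableOn ℂ F {z | -α < z.re}
  continuous : ContinuousOn F {z | -α ≤ z.re}
  bounded : ∃ M : ℝ, ∀ z : ℂ, -α ≤ z.re → ‖F z‖ ≤ M
  laplace : ∀ z : ℂ, 0 < z.re → F z = ∫ t in Ioi (0 : ℝ), Complex.exp (-(z * t)) * (k t : ℂ)

/-- The assumptions on an instantaneous modulus `c` and a kernel `k`: nonnegativity of `c`,
integrability of `k`, extendability of its Laplace transform `F` to `Re z ≥ -α`, and either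
`c > 0` and `c + Re F(iy) > 0` for all real `y`, or `k` is not a.e. zero and
`Re F(-α + iy) ≥ 0` for all
real `y`. -/
structure AdmissibleKernel (α c : ℝ) (k : ℝ → ℝ) : Prop where
  nonneg : 0 ≤ c
  integrable : IntegrableOn k (Ioi 0)
  positive : ∃ F : ℂ → ℂ, IsLaplaceExtension α k F ∧
    ((0 < c ∧ ∀ y : ℝ, 0 < c + (F (y * Complex.I)).re) ∨
      (¬ (k =ᵐ[volume.restrict (Ioi 0)] 0) ∧
        ∀ y : ℝ, 0 ≤ (F (-(α : ℂ) + y * Complex.I)).re))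

/-! ### The fundamental solution of the compressible Stokes system -/

/-- The symbol `(ξ ξᵀ / |ξ|²) exp (-|ξ|² t)` of the gradient part, as a function of the angular
frequency `ξ ≠ 0`. -/
def gradSymbol (t : ℝ) (ξ : E3) : Matrix (Fin 3) (Fin 3) ℂ :=
  fun i j => ((ξ i * ξ j / ‖ξ‖ ^ 2 * Real.exp (-(‖ξ‖ ^ 2 * t)) : ℝ) : ℂ)

/-- The symbol `(E - ξ ξᵀ / |ξ|²) exp (-|ξ|² t)` of the divergence free part, as a function of the
angular frequency `ξ ≠ 0`. -/
def solSymbol (t : ℝ) (ξ : E3) : Matrix (Fin 3) (Fin 3) ℂ :=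
  fun i j => ((((1 : Matrix (Fin 3) (Fin 3) ℝ) i j - ξ i * ξ j / ‖ξ‖ ^ 2)
    * Real.exp (-(‖ξ‖ ^ 2 * t)) : ℝ) : ℂ)

/-- The gradient part `U(x, t) = (2π)⁻³ ∫ exp (i ⟪x, ξ⟫) Û(ξ, t) dξ`, `t > 0`, entry by entry; the
substitution `ξ = 2πη` turns this into Mathlib's inverse Fourier integral. -/
def stokesU (x : E3) (t : ℝ) : Matrix (Fin 3) (Fin 3) ℂ :=
  fun i j => 𝓕⁻ (fun η : E3 => gradSymbol t ((2 * Real.pi) • η) i j) x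

/-- The divergence free part `V(x, t) = (2π)⁻³ ∫ exp (i ⟪x, ξ⟫) V̂(ξ, t) dξ`, `t > 0`. -/
def stokesV (x : E3) (t : ℝ) : Matrix (Fin 3) (Fin 3) ℂ :=
  fun i j => 𝓕⁻ (fun η : E3 => solSymbol t ((2 * Real.pi) • η) i j) x

/-- The row vector `wᵀ M`. -/
def rowMul (w : E3) (M : Matrix (Fin 3) (Fin 3) ℂ) : C3 :=
  WithLp.toLp 2 (Matrix.vecMul (fun i => ((w i : ℝ) : ℂ)) M)

/-- The difference `v(x, t) - wᵀ U(x, B t) - wᵀ V(x, A t)`. -/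
def remainder (A B : ℝ) (w : E3) (v : ℝ → E3 → E3) (t : ℝ) : E3 → C3 :=
  fun x => complexify (v t) x - rowMul w (stokesU x (B * t)) - rowMul w (stokesV x (A * t))

end

end BoltzmannVisco

namespace BoltzmannVisco

noncomputable section

open scoped SchwartzMap LineDeriv

/-! ### The resolvent of a scalar Volterra equation -/

/-! The Fourier transform in space decouples the system. At angular frequency ξ the operators Δ and
∇∇· act as -|ξ|² and -ξξᵀ, so the component of v̂ along ξ and the component orthogonal to ξ are each
multiplied by a scalar function S(t, μ), μ = |ξ|². This function solves the Volterra equation S = 1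
- μ N * S with N(t) = c + ∫₀ᵗ k, where (c, k) is (β₀, β) for the gradient part and (a₀, a) for the
divergence free part. The limit κ of N at infinity is B or A respectively, and the claim reduces to
comparing S(t, μ) with the heat multiplier exp(-κμt) in a weighted L² norm.

Three facts about S suffice. It has the crude bound |S(t, μ)| ≤ exp(Mμt) (`abs_resolvent_le`). Under
parabolic scaling S(t, μ/t) → exp(-κμ), read off termwise from the Neumann series
(`tendsto_resolvent`). Finally |S(t, μ)| ≤ K (1 + 1/μ)/t (`exists_resolvent_decay`), which is the
analytic core.

For the last bound, tS has Laplace transform (1 + μG')/(z + μG)² with G = c + k̃, and is recovered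
from it by integration over a vertical line, which is then moved to Re z = 0. The integrand is
dominated by a multiple of Re 1/(z + μG), whose integral over every vertical line in the right half
plane is exactly π, plus a multiple of 1/(1 + y²). This domination requires |G'| and |Im G|/(1 + |Im
z|) to be bounded by multiples of Re G, and Re G to be bounded below near 0 (`PassiveSymbol`). Under
the first alternative on the kernel Re G is bounded below and Cauchy's estimate is enough; under the
second, k̃ maps a strictly larger half plane into Re > 0, and the Schwarz–Pick inequality gives both
bounds (`AdmissibleKernel.exists_symbol`).

The asymptotics then come from splitting frequencies at |ξ| = 1. For |ξ| > 1 the square of the decay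
bound is O(t⁻²), against the weighted norm of v₀. For |ξ| ≤ 1 the substitution ξ → ξ/√t produces the
factor t^(-3/2), and dominated convergence applies because v̂₀ is continuous with v̂₀(0) = V₀
(`tendsto_lintegral_heatDefect`).

It remains to see that a distributional solution has this Fourier transform
(`SolvesWeakly.fourier_ae`). Testing in time gives an integral equation for the pairing with each
Schwartz field. Fields with compact frequency support, multiplied by powers of |ξ|², give a closed
chain of Volterra equations whose moments grow only geometrically, and this forces uniqueness
(`eq_integral_resolvent_smul`). -/

/-- The normalised iterated convolutions `t⁻ⁿ N^{*n} * 1` of a kernel `N`. -/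
def iterKernel (N : ℝ → ℝ) : ℕ → ℝ → ℝ
  | 0 => fun _ => 1
  | n + 1 => fun t => ∫ θ in (0 : ℝ)..1, N (t * (1 - θ)) * (θ ^ n * iterKernel N n (t * θ))

/-- The solution of `u t = 1 - μ ∫₀ᵗ N (t - r) u r dr`. -/
def resolvent (N : ℝ → ℝ) (t μ : ℝ) : ℝ := ∑' n : ℕ, (-(μ * t)) ^ n * iterKernel N n t

variable {N : ℝ → ℝ}

lemma continuous_iterKernel (hN : Continuous N) (n : ℕ) : Continuous (iterKernel N n) := by
  induction n with
  | zero => exact continuous_const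
  | succ n ih =>
    change Continuous fun t => ∫ θ in (0 : ℝ)..1, N (t * (1 - θ)) * (θ ^ n * iterKernel N n (t * θ))
    apply intervalIntegral.continuous_parametric_intervalIntegral_of_continuous'
    simp only [Function.uncurry_def]
    fun_prop

/-- Each step contributes M ∫₀¹ θⁿ dθ = M/(n + 1), which builds up the factorial. -/
lemma abs_iterKernel_le {M : ℝ} (hM : ∀ t, |N t| ≤ M) (n : ℕ) (t : ℝ) :
    |iterKernel N n t| ≤ M ^ n / n.factorial := by
  have hM0 : 0 ≤ M := (abs_nonneg _).trans (hM 0)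
  induction n generalizing t with
  | zero => simp [iterKernel]
  | succ n ih =>
    have h : ∀ θ ∈ Ioc (0 : ℝ) 1, ‖N (t * (1 - θ)) * (θ ^ n * iterKernel N n (t * θ))‖
        ≤ M * (θ ^ n * (M ^ n / n.factorial)) := by
      intro θ hθ
      rw [Real.norm_eq_abs, abs_mul, abs_mul, abs_of_nonneg (pow_nonneg hθ.1.le n)]
      have := hM (t * (1 - θ))
      have := ih (t * θ)
      have := pow_nonneg hθ.1.le n
      gcongr
    have h2 := intervalIntegral.norm_integral_le_of_norm_le (μ := volume) zero_le_one
      (Eventually.of_forall h)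
      ((by fun_prop : Continuous fun θ : ℝ => M * (θ ^ n * (M ^ n / n.factorial))).intervalIntegrable
        0 1)
    refine h2.trans (le_of_eq ?_)
    rw [intervalIntegral.integral_const_mul, intervalIntegral.integral_mul_const, integral_pow]
    rw [Nat.factorial_succ]
    push_cast
    field_simp
    simp [pow_succ']

/-- The normalisation by t⁻ⁿ puts all the integrals on the fixed interval [0, 1]. For 0 < θ < 1 both
t(1 - θ) and tθ tend to infinity, so dominated convergence replaces N by its limit. -/
lemma tendsto_iterKernel (hN : Continuous N) {M : ℝ} (hM : ∀ t, |N t| ≤ M) {κ : ℝ}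
    (hκ : Tendsto N atTop (𝓝 κ)) (n : ℕ) :
    Tendsto (iterKernel N n) atTop (𝓝 (κ ^ n / n.factorial)) := by
  have hM0 : 0 ≤ M := (abs_nonneg _).trans (hM 0)
  induction n with
  | zero => simp [iterKernel]
  | succ n ih =>
    have hval : κ ^ (n + 1) / ((n + 1).factorial : ℝ)
        = ∫ θ in (0 : ℝ)..1, κ * (θ ^ n * (κ ^ n / n.factorial)) := by
      rw [intervalIntegral.integral_const_mul, intervalIntegral.integral_mul_const, integral_pow]
      rw [Nat.factorial_succ]
      push_cast
      field_simp
      simp [pow_succ']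
    rw [hval]
    refine intervalIntegral.tendsto_integral_filter_of_dominated_convergence
      (fun _ => M * (M ^ n / n.factorial)) ?_ ?_ ?_ ?_
    · refine Eventually.of_forall fun t => Continuous.aestronglyMeasurable ?_
      have := continuous_iterKernel hN n
      fun_prop
    · refine Eventually.of_forall fun t => Eventually.of_forall fun θ hθ => ?_
      rw [uIoc_of_le zero_le_one] at hθ
      rw [Real.norm_eq_abs, abs_mul, abs_mul, abs_of_nonneg (pow_nonneg hθ.1.le n)]
      have h1 := abs_iterKernel_le hM n (t * θ)
      have h2 : θ ^ n ≤ 1 := pow_le_one₀ hθ.1.le hθ.2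
      calc |N (t * (1 - θ))| * (θ ^ n * |iterKernel N n (t * θ)|)
          ≤ M * (1 * (M ^ n / n.factorial)) := by
            have := hM (t * (1 - θ))
            have := pow_nonneg hθ.1.le n
            gcongr
        _ = _ := by ring
    · exact intervalIntegrable_const
    -- At θ = 1 the argument t(1 - θ) stays at 0 and N does not approach κ there.
    · have : ∀ᵐ θ : ℝ ∂volume, θ ≠ 1 := by simp [ae_iff]
      filter_upwards [this] with θ hθ1 hθ
      rw [uIoc_of_le zero_le_one] at hθ
      have hθ' : 0 < 1 - θ := sub_pos.2 (lt_of_le_of_ne hθ.2 hθ1)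
      exact (hκ.comp (tendsto_id.atTop_mul_const hθ')).mul
        (tendsto_const_nhds.mul (ih.comp (tendsto_id.atTop_mul_const hθ.1)))

lemma norm_resolvent_term_le {M : ℝ} (hM : ∀ t, |N t| ≤ M) (t μ : ℝ) (n : ℕ) :
    ‖(-(μ * t)) ^ n * iterKernel N n t‖ ≤ (|μ * t| * M) ^ n / n.factorial := by
  rw [norm_mul, norm_pow, norm_neg, Real.norm_eq_abs, Real.norm_eq_abs, mul_pow, mul_div_assoc]
  gcongr
  exact abs_iterKernel_le hM n t

lemma summable_resolvent {M : ℝ} (hM : ∀ t, |N t| ≤ M) (t μ : ℝ) :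
    Summable fun n : ℕ => (-(μ * t)) ^ n * iterKernel N n t :=
  Summable.of_norm_bounded (Real.summable_pow_div_factorial _) (norm_resolvent_term_le hM t μ)

lemma hasSum_real_exp (x : ℝ) : HasSum (fun n : ℕ => x ^ n / n.factorial) (Real.exp x) := by
  rw [Real.exp_eq_exp_ℝ]
  exact NormedSpace.expSeries_div_hasSum_exp x

lemma abs_resolvent_le {M : ℝ} (hM : ∀ t, |N t| ≤ M) (t μ : ℝ) :
    |resolvent N t μ| ≤ Real.exp (|μ * t| * M) := by
  have h := tsum_of_norm_bounded (f := fun n : ℕ => (-(μ * t)) ^ n * iterKernel N n t)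
    (hasSum_real_exp (|μ * t| * M)) (norm_resolvent_term_le hM t μ)
  exact h

lemma continuous_resolvent (hN : Continuous N) {M : ℝ} (hM : ∀ t, |N t| ≤ M) :
    Continuous fun p : ℝ × ℝ => resolvent N p.1 p.2 := by
  have hM0 : 0 ≤ M := (abs_nonneg _).trans (hM 0)
  rw [continuous_iff_continuousAt]
  intro p
  obtain ⟨R, hR⟩ : ∃ R, |p.2 * p.1| < R := exists_gt _
  have hopen : IsOpen {q : ℝ × ℝ | |q.2 * q.1| < R} :=
    isOpen_lt (by fun_prop) continuous_const
  have hterm : ∀ n : ℕ, ContinuousOn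
      (fun q : ℝ × ℝ => (-(q.2 * q.1)) ^ n * iterKernel N n q.1) {q : ℝ × ℝ | |q.2 * q.1| < R} := by
    intro n
    have := continuous_iterKernel hN n
    exact Continuous.continuousOn (by fun_prop)
  have hbound : ∀ (n : ℕ) (q : ℝ × ℝ), q ∈ {q : ℝ × ℝ | |q.2 * q.1| < R} →
      ‖(-(q.2 * q.1)) ^ n * iterKernel N n q.1‖ ≤ (R * M) ^ n / n.factorial := by
    intro n q hq
    have hq' : |q.2 * q.1| ≤ R := le_of_lt hq
    refine (norm_resolvent_term_le hM q.1 q.2 n).trans ?_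
    gcongr
  exact (continuousOn_tsum hterm (Real.summable_pow_div_factorial (R * M)) hbound).continuousAt
    (hopen.mem_nhds hR)

/-- Substituting r = tθ shows that convolution with N carries the n-th term of the series to the (n
+ 1)-st, up to the factor -μ; the series may be integrated termwise. -/
lemma resolvent_eq (hN : Continuous N) {M : ℝ} (hM : ∀ t, |N t| ≤ M) (t μ : ℝ) :
    resolvent N t μ = 1 - μ * ∫ r in (0 : ℝ)..t, N (t - r) * resolvent N r μ := by
  have hM0 : 0 ≤ M := (abs_nonneg _).trans (hM 0)
  have hstep : ∀ n : ℕ, ∫ r in (0 : ℝ)..t, N (t - r) * ((-(μ * r)) ^ n * iterKernel N n r)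
      = (-μ) ^ n * t ^ (n + 1) * iterKernel N (n + 1) t := by
    intro n
    have h := intervalIntegral.smul_integral_comp_mul_left (a := 0) (b := 1)
      (fun r => N (t - r) * ((-(μ * r)) ^ n * iterKernel N n r)) t
    rw [mul_zero, mul_one] at h
    rw [← h, smul_eq_mul]
    change _ = (-μ) ^ n * t ^ (n + 1) *
      ∫ θ in (0 : ℝ)..1, N (t * (1 - θ)) * (θ ^ n * iterKernel N n (t * θ))
    rw [← intervalIntegral.integral_const_mul, ← intervalIntegral.integral_const_mul]
    congr 1
    ext θ
    rw [show t * (1 - θ) = t - t * θ by ring]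
    rw [show -(μ * (t * θ)) = (-μ) * t * θ by ring, mul_pow, mul_pow]
    ring
  have hsum : HasSum (fun n : ℕ => ∫ r in (0 : ℝ)..t, N (t - r) * ((-(μ * r)) ^ n * iterKernel N n r))
      (∫ r in (0 : ℝ)..t, N (t - r) * resolvent N r μ) := by
    refine intervalIntegral.hasSum_integral_of_dominated_convergence
      (fun n _ => M * ((|μ| * |t| * M) ^ n / n.factorial)) (fun n => ?_) (fun n => ?_) ?_ ?_ ?_
    · have := continuous_iterKernel hN n
      exact Continuous.aestronglyMeasurable (by fun_prop)
    · refine Eventually.of_forall fun r hr => ?_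
      have hr' : |r| ≤ |t| := by
        rcases le_total 0 t with h | h
        · rw [uIoc_of_le h] at hr
          rw [abs_of_pos hr.1, abs_of_nonneg h]; exact hr.2
        · rw [uIoc_of_ge h] at hr
          rw [abs_of_nonpos hr.2, abs_of_nonpos h]; linarith [hr.1]
      rw [norm_mul]
      refine mul_le_mul (hM _) ((norm_resolvent_term_le hM r μ n).trans ?_) (norm_nonneg _) hM0
      rw [abs_mul]
      gcongr
    · exact Eventually.of_forall fun r hr => (Real.summable_pow_div_factorial _).mul_left _
    · exact intervalIntegrable_const
    · exact Eventually.of_forall fun r hr => (summable_resolvent hM r μ).hasSum.mul_left _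
  have h1 : resolvent N t μ = 1 + ∑' n : ℕ, (-(μ * t)) ^ (n + 1) * iterKernel N (n + 1) t := by
    rw [resolvent, (summable_resolvent hM t μ).tsum_eq_zero_add]
    simp [iterKernel]
  rw [h1, ← hsum.tsum_eq, sub_eq_add_neg, ← tsum_mul_left, ← tsum_neg]
  refine congrArg (1 + ·) (tsum_congr fun n => ?_)
  rw [hstep]
  rw [show -(μ * t) = (-μ) * t by ring, mul_pow]
  ring

/-- With μ/t in place of μ the n-th term is (-μ)ⁿ times the normalised convolution, so only the
latter depends on t; the factorial bound permits passing to the limit under the sum. -/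
lemma tendsto_resolvent (hN : Continuous N) {M : ℝ} (hM : ∀ t, |N t| ≤ M) {κ : ℝ}
    (hκ : Tendsto N atTop (𝓝 κ)) (μ : ℝ) :
    Tendsto (fun t => resolvent N t (μ / t)) atTop (𝓝 (Real.exp (-(κ * μ)))) := by
  have hM0 : 0 ≤ M := (abs_nonneg _).trans (hM 0)
  have hval : Real.exp (-(κ * μ)) = ∑' n : ℕ, (-μ) ^ n * (κ ^ n / n.factorial) := by
    rw [← (hasSum_real_exp _).tsum_eq]
    refine tsum_congr fun n => ?_
    rw [← mul_div_assoc, ← mul_pow]; congr 2; ring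
  rw [hval]
  refine tendsto_tsum_of_dominated_convergence (bound := fun n => (|μ| * M) ^ n / n.factorial)
    (Real.summable_pow_div_factorial _) (fun n => ?_) ?_
  · refine Tendsto.congr' ?_ ((tendsto_iterKernel hN hM hκ n).const_mul ((-μ) ^ n))
    filter_upwards [eventually_ne_atTop 0] with t ht
    rw [div_mul_cancel₀ _ ht]
  · filter_upwards [eventually_ne_atTop 0] with t ht n
    have := norm_resolvent_term_le hM t (μ / t) n
    rwa [div_mul_cancel₀ _ ht] at this ⊢

/-! ### Holomorphic functions with nonnegative real part on a half plane -/

lemma isOpen_lt_re (σ : ℝ) : IsOpen {z : ℂ | σ < z.re} :=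
  isOpen_lt continuous_const Complex.continuous_re

/-- Minimum principle for the real part of a bounded holomorphic function on a half plane. -/
lemma le_re_of_le_re_boundary {σ e M : ℝ} {F : ℂ → ℂ}
    (hd : DifferentiableOn ℂ F {z | σ < z.re}) (hc : ContinuousOn F {z | σ ≤ z.re})
    (hM : ∀ z : ℂ, σ ≤ z.re → ‖F z‖ ≤ M) (hb : ∀ y : ℝ, e ≤ (F (σ + y * Complex.I)).re)
    {z : ℂ} (hz : σ ≤ z.re) : e ≤ (F z).re := by
  -- Since |exp(-F)| = exp(-Re F), a lower bound for Re F is an upper bound for a bounded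
  -- holomorphic function, to which Phragmén–Lindelöf applies.
  set g : ℂ → ℂ := fun w => Complex.exp (-F (σ + w)) with hg
  have hre : ∀ w : ℂ, ((σ : ℂ) + w).re = σ + w.re := by simp
  have hle : ∀ w : ℂ, 0 ≤ w.re → ‖g w‖ ≤ Real.exp M := by
    intro w hw
    rw [hg, Complex.norm_exp]
    refine Real.exp_le_exp.2 ?_
    refine ((Complex.abs_re_le_norm _).trans' (le_abs_self _)).trans ?_
    rw [norm_neg]
    exact hM _ (by rw [hre]; linarith)
  have hdiff : DiffContOnCl ℂ g {w | 0 < w.re} := by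
    refine ⟨?_, ?_⟩
    · refine (DifferentiableOn.neg (hd.comp (by fun_prop) ?_)).cexp
      intro w hw
      simp only [mem_ofPred_eq] at hw ⊢
      rw [hre]; linarith
    · rw [Complex.closure_setOfPred_lt_re]
      refine (ContinuousOn.neg (hc.comp (by fun_prop) ?_)).cexp
      intro w hw
      simp only [mem_ofPred_eq] at hw ⊢
      rw [hre]; linarith
  have key := PhragmenLindelof.right_half_plane_of_bounded_on_real (C := Real.exp (-e))
    (z := z - σ) hdiff ?_ ?_ ?_ (by simpa using hz)
  · rw [hg, Complex.norm_exp] at key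
    simp only [add_sub_cancel, Complex.neg_re, Real.exp_le_exp] at key
    linarith
  · refine ⟨0, by norm_num, 0, ?_⟩
    refine IsBigO.of_bound (Real.exp M) ?_
    rw [eventually_inf_principal]
    refine Eventually.of_forall fun w hw => ?_
    simpa using hle w (le_of_lt hw)
  · refine isBoundedUnder_of_eventually_le (a := Real.exp M) ?_
    filter_upwards [eventually_ge_atTop 0] with x hx
    exact hle x (by simpa using hx)
  · intro y
    rw [hg, Complex.norm_exp, Real.exp_le_exp, Complex.neg_re]
    linarith [hb y]

/-- Strong minimum principle for the real part. -/
lemma eqOn_const_of_re_eq_zero {σ : ℝ} {F : ℂ → ℂ}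
    (hd : DifferentiableOn ℂ F {z | σ < z.re}) (h0 : ∀ z : ℂ, σ < z.re → 0 ≤ (F z).re)
    {z₀ : ℂ} (hz₀ : σ < z₀.re) (hF : (F z₀).re = 0) {z : ℂ} (hz : σ < z.re) : F z = F z₀ := by
  have hpre : IsPreconnected {z : ℂ | σ < z.re} := (convex_halfSpace_re_gt σ).isPreconnected
  -- The modulus of exp(-F) is at most 1 and equals 1 at z₀, so the maximum modulus principle makes
  -- it constant.
  have hexp : EqOn (fun z => Complex.exp (-F z)) (Function.const ℂ (Complex.exp (-F z₀)))
      {z | σ < z.re} := by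
    refine Complex.eqOn_of_isPreconnected_of_isMaxOn_norm (c := z₀) hpre (isOpen_lt_re σ) hd.neg.cexp
      hz₀ ?_
    intro w hw
    simp only [mem_ofPred_eq, Function.comp, Complex.norm_exp, Complex.neg_re, hF]
    exact Real.exp_le_exp.2 (by linarith [h0 w hw])
  -- Constancy of exp(-F) fixes F only modulo 2πi; constancy of F follows from the vanishing of its
  -- derivative.
  refine (isOpen_lt_re σ).is_const_of_deriv_eq_zero (𝕜 := ℂ) hpre hd ?_ hz hz₀
  intro w hw
  have h1 : HasDerivAt (fun z => Complex.exp (-F z)) (Complex.exp (-F w) * (-deriv F w)) w :=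
    ((hd.differentiableAt ((isOpen_lt_re σ).mem_nhds hw)).hasDerivAt.neg).cexp
  have h2 : HasDerivAt (fun z => Complex.exp (-F z)) 0 w := by
    refine (hasDerivAt_const w (Complex.exp (-F z₀))).congr_of_eventuallyEq ?_
    filter_upwards [(isOpen_lt_re σ).mem_nhds hw] with u hu
    exact hexp hu
  have h3 := h1.unique h2
  simpa [Complex.exp_ne_zero] using h3

/-- The Schwarz–Pick inequality for a half plane. -/
lemma schwarzPick_halfPlane {σ : ℝ} {F : ℂ → ℂ} (hd : DifferentiableOn ℂ F {z | σ < z.re})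
    (h0 : ∀ z : ℂ, σ < z.re → 0 < (F z).re) {z w : ℂ} (hz : σ < z.re) (hw : σ < w.re) :
    ‖F z - F w‖ * ‖z + (starRingEnd ℂ) w - 2 * σ‖ ≤ ‖z - w‖ * ‖F z + (starRingEnd ℂ) (F w)‖ := by
  -- -w' is the mirror image of w in the line Re z = σ. Hence ζ ↦ (w + w'ζ)/(1 - ζ) is the Cayley
  -- map of the unit disc onto the half plane that sends 0 to w, with inverse z ↦ (z - w)/(z + w').
  set w' : ℂ := (starRingEnd ℂ) w - 2 * σ with hw'
  have hww : (w + w').re = 2 * (w.re - σ) := by simp [hw']; ring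
  have hpos : ∀ u : ℂ, 0 < u.re → u ≠ 0 := by rintro u hu rfl; simp at hu
  have hden : ∀ ζ ∈ Metric.ball (0 : ℂ) 1, (1 : ℂ) - ζ ≠ 0 := by
    intro ζ hζ h
    rw [sub_eq_zero] at h
    rw [← h] at hζ
    simp at hζ
  have hmaps : ∀ ζ ∈ Metric.ball (0 : ℂ) 1, σ < ((w + w' * ζ) / (1 - ζ)).re := by
    intro ζ hζ
    have hn : 0 < Complex.normSq (1 - ζ) := Complex.normSq_pos.2 (hden ζ hζ)
    have h1 : ((w + w' * ζ) / (1 - ζ)).re - σ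
        = (w.re - σ) * (1 - ‖ζ‖ ^ 2) / Complex.normSq (1 - ζ) := by
      rw [Complex.div_re, ← add_div, ← sub_eq_zero, ← Complex.normSq_eq_norm_sq]
      field_simp
      simp only [hw', Complex.add_re, Complex.mul_re, Complex.sub_re, Complex.one_re, Complex.conj_re,
        Complex.conj_im, Complex.add_im, Complex.mul_im, Complex.sub_im, Complex.one_im,
        Complex.ofReal_re, Complex.ofReal_im, Complex.normSq_apply, Complex.re_ofNat,
        Complex.im_ofNat]
      ring
    have h2 : 0 < 1 - ‖ζ‖ ^ 2 := by
      have : ‖ζ‖ < 1 := by simpa using hζ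
      nlinarith [norm_nonneg ζ]
    have : 0 < ((w + w' * ζ) / (1 - ζ)).re - σ := by
      rw [h1]; have := sub_pos.2 hw; positivity
    linarith
  -- The Cayley transform of the target half plane sends F w to 0, so g is a self-map of the disc
  -- fixing 0 and Schwarz's lemma applies.
  set g : ℂ → ℂ := fun ζ => (F ((w + w' * ζ) / (1 - ζ)) - F w)
    / (F ((w + w' * ζ) / (1 - ζ)) + (starRingEnd ℂ) (F w)) with hg
  have hden2 : ∀ u : ℂ, σ < u.re → F u + (starRingEnd ℂ) (F w) ≠ 0 := by
    intro u hu
    refine hpos _ ?_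
    simpa using add_pos (h0 u hu) (h0 w hw)
  have hgd : DifferentiableOn ℂ g (Metric.ball 0 1) := by
    have h1 : DifferentiableOn ℂ (fun ζ : ℂ => F ((w + w' * ζ) / (1 - ζ))) (Metric.ball 0 1) := by
      refine hd.comp (DifferentiableOn.div (by fun_prop) (by fun_prop) hden) ?_
      intro ζ hζ; exact hmaps ζ hζ
    exact (h1.sub_const _).div (h1.add_const _) fun ζ hζ => hden2 _ (hmaps ζ hζ)
  have hgm : MapsTo g (Metric.ball 0 1) (Metric.closedBall 0 1) := by
    intro ζ hζ
    have hp := h0 _ (hmaps ζ hζ)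
    have hq := h0 w hw
    simp only [mem_closedBall_zero_iff, hg, norm_div]
    rw [div_le_one (norm_pos_iff.2 (hden2 _ (hmaps ζ hζ)))]
    generalize F ((w + w' * ζ) / (1 - ζ)) = A at *
    generalize F w = B at *
    rw [← sq_le_sq₀ (norm_nonneg _) (norm_nonneg _), ← Complex.normSq_eq_norm_sq,
      ← Complex.normSq_eq_norm_sq, Complex.normSq_apply, Complex.normSq_apply]
    simp only [Complex.sub_re, Complex.sub_im, Complex.add_re, Complex.add_im, Complex.conj_re,
      Complex.conj_im]
    nlinarith [mul_pos hp hq]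
  have hg0 : g 0 = 0 := by simp [hg]
  have hzw : z + w' ≠ 0 := by
    refine hpos _ ?_
    simp only [hw', Complex.add_re, Complex.sub_re, Complex.conj_re, Complex.mul_re,
      Complex.ofReal_re, Complex.re_ofNat, Complex.im_ofNat, Complex.ofReal_im]
    linarith
  set ζ := (z - w) / (z + w') with hζ
  have h1ζ : 1 - ζ = (w + w') / (z + w') := by
    rw [hζ]; field_simp; ring
  have hww0 : w + w' ≠ 0 := hpos _ (by rw [hww]; linarith)
  have hζz : (w + w' * ζ) / (1 - ζ) = z := by
    rw [h1ζ, hζ]; field_simp; ring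
  have hζ1 : ‖ζ‖ < 1 := by
    rw [hζ, norm_div, div_lt_one (norm_pos_iff.2 hzw),
      ← sq_lt_sq₀ (norm_nonneg _) (norm_nonneg _), ← Complex.normSq_eq_norm_sq,
      ← Complex.normSq_eq_norm_sq, Complex.normSq_apply, Complex.normSq_apply]
    simp only [hw', Complex.sub_re, Complex.sub_im, Complex.add_re, Complex.add_im,
      Complex.conj_re, Complex.conj_im, Complex.mul_re, Complex.mul_im,
      Complex.ofReal_re, Complex.re_ofNat, Complex.im_ofNat, Complex.ofReal_im]
    nlinarith [mul_pos (sub_pos.2 hz) (sub_pos.2 hw)]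
  have key := Complex.norm_le_norm_of_mapsTo_ball hgd hgm hg0 hζ1
  simp only [hg, hζz] at key
  rw [hζ, norm_div, norm_div, div_le_div_iff₀ (norm_pos_iff.2 (hden2 z hz)) (norm_pos_iff.2 hzw)]
    at key
  rwa [hw', ← add_sub_assoc] at key

/-- The infinitesimal form of Schwarz–Pick: divide by |z - w| and let z → w. -/
lemma norm_deriv_le_of_re_pos {σ : ℝ} {F : ℂ → ℂ} (hd : DifferentiableOn ℂ F {z | σ < z.re})
    (h0 : ∀ z : ℂ, σ < z.re → 0 < (F z).re) {w : ℂ} (hw : σ < w.re) :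
    ‖deriv F w‖ * (w.re - σ) ≤ (F w).re := by
  have hder := (hd.differentiableAt ((isOpen_lt_re σ).mem_nhds hw)).hasDerivAt
  have h1 := (hasDerivAt_iff_tendsto_slope.1 hder).norm
  have hF : Tendsto F (𝓝[≠] w) (𝓝 (F w)) := hder.continuousAt.tendsto.mono_left nhdsWithin_le_nhds
  have hid : Tendsto (fun z : ℂ => z) (𝓝[≠] w) (𝓝 w) := nhdsWithin_le_nhds
  have h2 : Tendsto (fun z => ‖slope F w z‖ * ‖z + (starRingEnd ℂ) w - 2 * σ‖) (𝓝[≠] w)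
      (𝓝 (‖deriv F w‖ * ‖w + (starRingEnd ℂ) w - 2 * σ‖)) :=
    h1.mul ((hid.add_const _).sub_const _).norm
  have h3 : Tendsto (fun z => ‖F z + (starRingEnd ℂ) (F w)‖) (𝓝[≠] w)
      (𝓝 (‖F w + (starRingEnd ℂ) (F w)‖)) := (hF.add_const _).norm
  have h4 : ‖deriv F w‖ * ‖w + (starRingEnd ℂ) w - 2 * σ‖ ≤ ‖F w + (starRingEnd ℂ) (F w)‖ := by
    refine le_of_tendsto_of_tendsto h2 h3 ?_
    have hev : ∀ᶠ z in 𝓝[≠] w, σ < z.re :=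
      nhdsWithin_le_nhds ((isOpen_lt_re σ).mem_nhds hw)
    filter_upwards [hev, self_mem_nhdsWithin] with z hz hne
    have hne' : 0 < ‖z - w‖ := norm_pos_iff.2 (sub_ne_zero.2 hne)
    have := schwarzPick_halfPlane hd h0 hz hw
    rw [slope_def_field, norm_div, div_mul_eq_mul_div, div_le_iff₀ hne']
    linarith
  rw [Complex.add_conj, Complex.add_conj] at h4
  have e1 : ‖((2 * w.re : ℝ) : ℂ) - 2 * σ‖ = 2 * (w.re - σ) := by
    rw [show ((2 * w.re : ℝ) : ℂ) - 2 * σ = ((2 * (w.re - σ) : ℝ) : ℂ) by push_cast; ring,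
      Complex.norm_of_nonneg (by linarith)]
  have e2 : ‖((2 * (F w).re : ℝ) : ℂ)‖ = 2 * (F w).re :=
    Complex.norm_of_nonneg (by linarith [h0 w hw])
  rw [e1, e2] at h4
  linarith

/-- Schwarz–Pick for the pair z, z̄ reads |Im F| |z - σ| ≤ |Im z| |F|, because F(z̄) is the
conjugate of F(z). After squaring, the terms (Im z)² (Im F)² cancel. -/
lemma abs_im_le_of_re_pos {σ : ℝ} {F : ℂ → ℂ} (hd : DifferentiableOn ℂ F {z | σ < z.re})
    (h0 : ∀ z : ℂ, σ < z.re → 0 < (F z).re) {z : ℂ} (hz : σ < z.re)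
    (hsymm : F ((starRingEnd ℂ) z) = (starRingEnd ℂ) (F z)) :
    |(F z).im| * (z.re - σ) ≤ |z.im| * (F z).re := by
  have h := schwarzPick_halfPlane hd h0 hz (w := (starRingEnd ℂ) z) (by simpa using hz)
  rw [hsymm, Complex.conj_conj, Complex.conj_conj, Complex.sub_conj, Complex.sub_conj,
    ← two_mul, ← mul_sub, ← two_mul] at h
  simp only [norm_mul, Complex.norm_I, mul_one, Complex.norm_real, Complex.norm_ofNat,
    Real.norm_eq_abs, abs_two] at h
  have h' : |(F z).im| * ‖z - σ‖ ≤ |z.im| * ‖F z‖ := by linarith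
  have h2 := pow_le_pow_left₀ (by positivity) h' 2
  rw [mul_pow, mul_pow, sq_abs, sq_abs, ← Complex.normSq_eq_norm_sq, ← Complex.normSq_eq_norm_sq,
    Complex.normSq_apply, Complex.normSq_apply] at h2
  simp only [Complex.sub_re, Complex.sub_im, Complex.ofReal_re, Complex.ofReal_im, sub_zero] at h2
  refine abs_le_of_sq_le_sq' (a := |(F z).im| * (z.re - σ)) ?_
    (mul_nonneg (abs_nonneg _) (h0 z hz).le) |>.2
  rw [mul_pow, mul_pow, sq_abs, sq_abs]
  nlinarith

/-! ### Laplace transforms of integrable kernels -/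

/-- The Laplace transform `∫₀^∞ exp (-z t) f t dt`. -/
def laplaceTransform (f : ℝ → ℝ) (z : ℂ) : ℂ := ∫ t in Ioi (0 : ℝ), Complex.exp (-(z * t)) * (f t : ℂ)

lemma norm_cexp_neg_mul (z : ℂ) (t : ℝ) : ‖Complex.exp (-(z * t))‖ = Real.exp (-(z.re * t)) := by
  rw [Complex.norm_exp]; simp

lemma laplace_conj (f : ℝ → ℝ) (z : ℂ) :
    laplaceTransform f ((starRingEnd ℂ) z) = (starRingEnd ℂ) (laplaceTransform f z) := by
  rw [laplaceTransform, laplaceTransform, ← integral_conj]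
  congr 1; ext t
  rw [map_mul, Complex.conj_ofReal, ← Complex.exp_conj, map_neg, map_mul, Complex.conj_ofReal]

lemma norm_laplace_integrand_le (f : ℝ → ℝ) {z : ℂ} (hz : 0 ≤ z.re) {t : ℝ} (ht : 0 < t) :
    ‖Complex.exp (-(z * t)) * (f t : ℂ)‖ ≤ ‖f t‖ := by
  rw [norm_mul, norm_cexp_neg_mul, Complex.norm_real]
  refine mul_le_of_le_one_left (norm_nonneg _) (Real.exp_le_one_iff.2 ?_)
  simpa using mul_nonneg hz ht.le

lemma aestronglyMeasurable_laplace_integrand {f : ℝ → ℝ} (hf : IntegrableOn f (Ioi 0)) (z : ℂ) :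
    AEStronglyMeasurable (fun t : ℝ => Complex.exp (-(z * t)) * (f t : ℂ))
      (volume.restrict (Ioi 0)) := by
  refine AEStronglyMeasurable.mul (Continuous.aestronglyMeasurable (by fun_prop)) ?_
  exact Complex.continuous_ofReal.comp_aestronglyMeasurable hf.aestronglyMeasurable

lemma integrableOn_laplace_integrand {f : ℝ → ℝ} (hf : IntegrableOn f (Ioi 0)) {z : ℂ}
    (hz : 0 ≤ z.re) :
    IntegrableOn (fun t : ℝ => Complex.exp (-(z * t)) * (f t : ℂ)) (Ioi 0) := by
  refine Integrable.mono hf (aestronglyMeasurable_laplace_integrand hf z) ?_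
  rw [ae_restrict_iff' measurableSet_Ioi]
  exact Eventually.of_forall fun t ht => norm_laplace_integrand_le f hz ht

lemma continuousOn_laplace {f : ℝ → ℝ} (hf : IntegrableOn f (Ioi 0)) :
    ContinuousOn (laplaceTransform f) {z | 0 ≤ z.re} := by
  intro z hz
  refine tendsto_integral_filter_of_dominated_convergence (fun t => ‖f t‖)
    (Eventually.of_forall fun w => aestronglyMeasurable_laplace_integrand hf w) ?_ hf.norm ?_
  · filter_upwards [self_mem_nhdsWithin] with w hw
    rw [ae_restrict_iff' measurableSet_Ioi]
    exact Eventually.of_forall fun t ht => norm_laplace_integrand_le f hw ht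
  · refine Eventually.of_forall fun t => ?_
    have : Continuous fun w : ℂ => Complex.exp (-(w * t)) * (f t : ℂ) := by fun_prop
    exact this.continuousAt.mono_left nhdsWithin_le_nhds

lemma tendsto_laplace_atTop {f : ℝ → ℝ} (hf : IntegrableOn f (Ioi 0)) :
    Tendsto (fun x : ℝ => laplaceTransform f x) atTop (𝓝 0) := by
  have h : Tendsto (fun x : ℝ => laplaceTransform f x) atTop (𝓝 (∫ t in Ioi (0 : ℝ), (0 : ℂ))) := by
    refine tendsto_integral_filter_of_dominated_convergence (fun t => ‖f t‖)
      (Eventually.of_forall fun w => aestronglyMeasurable_laplace_integrand hf w) ?_ hf.norm ?_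
    · filter_upwards [eventually_ge_atTop 0] with w hw
      rw [ae_restrict_iff' measurableSet_Ioi]
      exact Eventually.of_forall fun t ht => norm_laplace_integrand_le f (by simpa using hw) ht
    · rw [ae_restrict_iff' measurableSet_Ioi]
      refine Eventually.of_forall fun t (ht : 0 < t) => ?_
      rw [tendsto_zero_iff_norm_tendsto_zero]
      simp only [norm_mul, norm_cexp_neg_mul, Complex.ofReal_re]
      have : Tendsto (fun x : ℝ => Real.exp (-(x * t))) atTop (𝓝 0) :=
        Real.tendsto_exp_neg_atTop_nhds_zero.comp (tendsto_id.atTop_mul_const ht)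
      simpa using this.mul_const _
  simpa using h

/-- On a vertical line the Laplace transform is the Fourier transform of the exponentially damped
function. This is the bridge to injectivity, Riemann–Lebesgue and inversion. -/
lemma laplace_add_two_pi_mul_I (f : ℝ → ℝ) (x y : ℝ) :
    laplaceTransform f (x + 2 * Real.pi * y * Complex.I)
      = 𝓕 ((Ioi (0 : ℝ)).indicator fun t => ((Real.exp (-(x * t)) * f t : ℝ) : ℂ)) y := by
  rw [Real.fourier_eq', laplaceTransform, ← integral_indicator measurableSet_Ioi]
  congr 1; ext t
  by_cases ht : t ∈ Ioi (0 : ℝ)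
  · rw [indicator_of_mem ht, indicator_of_mem ht]
    push_cast
    rw [smul_eq_mul, ← mul_assoc, ← Complex.exp_add]
    congr 2
    simp
    ring
  · rw [indicator_of_notMem ht, indicator_of_notMem ht, smul_zero]

/-- Injectivity of the Fourier transform on `L¹`. -/
lemma ae_eq_zero_of_fourier_eq_zero {f : ℝ → ℂ} (hf : Integrable f) (h : 𝓕 f = 0) :
    f =ᵐ[volume] 0 := by
  refine ae_eq_zero_of_integral_contDiff_smul_eq_zero hf.locallyIntegrable ?_
  intro g hg hgc
  have h1 : HasCompactSupport (Complex.ofRealCLM ∘ g) := hgc.comp_left rfl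
  have h2 : ContDiff ℝ ∞ (Complex.ofRealCLM ∘ g) := by fun_prop
  set G : SchwartzMap ℝ ℂ := h1.toSchwartzMap h2
  -- A test function is the Fourier transform of a Schwartz function, and Fubini moves that
  -- transform onto f.
  have h3 := VectorFourier.integral_fourierIntegral_smul_eq_flip (μ := volume) (ν := volume)
    (L := innerₗ ℝ) (f := ⇑(𝓕⁻ G : SchwartzMap ℝ ℂ)) (g := f) Real.continuous_fourierChar continuous_inner
    (𝓕⁻ G : SchwartzMap ℝ ℂ).integrable hf
  rw [flip_innerₗ] at h3
  change ∫ ξ, 𝓕 (⇑(𝓕⁻ G : SchwartzMap ℝ ℂ)) ξ • f ξ = ∫ x, (𝓕⁻ G : SchwartzMap ℝ ℂ) x • 𝓕 f x at h3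
  rw [h, ← SchwartzMap.fourier_coe, FourierTransform.fourier_fourierInv_eq] at h3
  have h4 : ∫ ξ, G ξ • f ξ = 0 := by simpa using h3
  rw [← h4]
  congr 1

lemma ae_eq_zero_of_laplace_eq_zero {f : ℝ → ℝ} (hf : IntegrableOn f (Ioi 0))
    (h : ∀ z : ℂ, 0 < z.re → laplaceTransform f z = 0) : f =ᵐ[volume.restrict (Ioi 0)] 0 := by
  have hint : Integrable ((Ioi (0 : ℝ)).indicator fun t => ((Real.exp (-(1 * t)) * f t : ℝ) : ℂ)) := by
    rw [integrable_indicator_iff measurableSet_Ioi]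
    have := integrableOn_laplace_integrand hf (z := 1) (by simp)
    refine this.congr (Eventually.of_forall fun t => ?_)
    push_cast; rfl
  have h0 := ae_eq_zero_of_fourier_eq_zero hint (by
    ext y
    rw [← laplace_add_two_pi_mul_I, h]
    · rfl
    · simp)
  rw [EventuallyEq, ae_restrict_iff' measurableSet_Ioi]
  filter_upwards [h0] with t ht hpos
  rw [indicator_of_mem hpos] at ht
  simpa using ht

/-! ### The symbol of an admissible kernel -/

/-- The quantitative positivity of the symbol `G = c + k̃` of an admissible kernel used for the decay
estimates. -/
structure PassiveSymbol (G : ℂ → ℂ) (M C m : ℝ) : Prop where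
  M_nonneg : 0 ≤ M
  C_nonneg : 0 ≤ C
  m_pos : 0 < m
  diff : DifferentiableOn ℂ G {z | 0 < z.re}
  bound : ∀ z : ℂ, 0 < z.re → ‖G z‖ ≤ M
  re_pos : ∀ z : ℂ, 0 < z.re → 0 < (G z).re
  deriv_le : ∀ z : ℂ, 0 < z.re → ‖deriv G z‖ ≤ C * (G z).re
  im_le : ∀ z : ℂ, 0 < z.re → |(G z).im| ≤ C * (1 + |z.im|) * (G z).re
  le_re : ∀ z : ℂ, 0 < z.re → z.re ≤ 1 → |z.im| ≤ 1 → m ≤ (G z).re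

/-- The extension is prescribed only for Re z > 0; both sides are continuous up to the imaginary
axis. The boundary is needed for F(0) = ∫ k and for the values on the imaginary axis. -/
lemma IsLaplaceExtension.eqOn {α : ℝ} (hα : 0 < α) {k : ℝ → ℝ} {F : ℂ → ℂ}
    (hF : IsLaplaceExtension α k F) (hk : IntegrableOn k (Ioi 0)) {z : ℂ} (hz : 0 ≤ z.re) :
    F z = laplaceTransform k z := by
  have hsub : {z : ℂ | 0 ≤ z.re} ⊆ closure {z : ℂ | 0 < z.re} := by
    rw [Complex.closure_setOfPred_lt_re]
  have hEq : EqOn F (laplaceTransform k) {z : ℂ | 0 < z.re} := fun z hz => hF.laplace z hz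
  refine hEq.of_subset_closure (t := {z : ℂ | 0 ≤ z.re}) ?_ (continuousOn_laplace hk) ?_ hsub hz
  · exact hF.continuous.mono fun z (hz : 0 ≤ z.re) => by
      simp only [mem_ofPred_eq]; linarith
  · exact fun z (hz : 0 < z.re) => hz.le

/-- Riemann–Lebesgue on the imaginary axis. It makes c + Re k̃(iy) tend to c, so that pointwise
positivity becomes uniform when c > 0. -/
lemma tendsto_laplace_mul_I_cocompact {k : ℝ → ℝ} :
    Tendsto (fun y : ℝ => laplaceTransform k (y * Complex.I)) (cocompact ℝ) (𝓝 0) := by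
  have h := Real.zero_at_infty_fourier ((Ioi (0 : ℝ)).indicator fun t => ((k t : ℝ) : ℂ))
  have h2 : Tendsto (fun y : ℝ => (2 * Real.pi)⁻¹ * y) (cocompact ℝ) (cocompact ℝ) :=
    (Homeomorph.mulLeft₀ ((2 * Real.pi)⁻¹) (by positivity)).isClosedEmbedding.tendsto_cocompact
  refine (h.comp h2).congr fun y => ?_
  have := laplace_add_two_pi_mul_I k 0 ((2 * Real.pi)⁻¹ * y)
  simp only [zero_mul, neg_zero, Real.exp_zero, one_mul] at this
  rw [Function.comp, ← this]
  congr 1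
  push_cast
  field_simp
  simp

lemma exists_pos_le_of_tendsto_cocompact {f : ℝ → ℝ} (hf : Continuous f) (hpos : ∀ y, 0 < f y)
    {c : ℝ} (hc : 0 < c) (hlim : Tendsto f (cocompact ℝ) (𝓝 c)) : ∃ ε > 0, ∀ y, ε ≤ f y := by
  have h1 : ∀ᶠ y in cocompact ℝ, c / 2 < f y := hlim.eventually_const_lt (by linarith)
  obtain ⟨K, hK, hKs⟩ := mem_cocompact.1 h1
  rcases K.eq_empty_or_nonempty with rfl | hne
  · exact ⟨c / 2, by linarith, fun y => le_of_lt (hKs (by simp))⟩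
  · obtain ⟨y₀, -, hy₀⟩ := hK.exists_isMinOn hne hf.continuousOn
    refine ⟨min (c / 2) (f y₀), lt_min (by linarith) (hpos _), fun y => ?_⟩
    by_cases hy : y ∈ K
    · exact (min_le_right _ _).trans (hy₀ hy)
    · exact (min_le_left _ _).trans (le_of_lt (hKs hy))

/-- Under the first alternative Re G ≥ ε > 0 on the half plane, so any bounded quantity is a
multiple of Re G; G' is bounded by Cauchy's estimate on discs of radius α. Under the second
alternative Re G may tend to 0 at infinity, but F has positive real part on Re z > -α, and every
point with Re z > 0 has distance at least α from that boundary, so Schwarz–Pick bounds G' and Im G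
relative to Re G. In both cases positivity at 0 gives the positive limit of the integrated kernel.
-/
theorem AdmissibleKernel.exists_symbol {α c : ℝ} (hα : 0 < α) {k : ℝ → ℝ}
    (h : AdmissibleKernel α c k) :
    (∃ M C m : ℝ, PassiveSymbol (fun z => c + laplaceTransform k z) M C m) ∧
      0 < c + ∫ t in Ioi (0 : ℝ), k t := by
  obtain ⟨F, hF, hcase⟩ := h.positive
  obtain ⟨M, hM⟩ := hF.bounded
  have hk := h.integrable
  have hM0 : 0 ≤ M := (norm_nonneg _).trans (hM 0 (by simpa using hα.le))
  have hnhd : ∀ z : ℂ, 0 < z.re → {z : ℂ | 0 < z.re} ∈ 𝓝 z := fun z hz => (isOpen_lt_re 0).mem_nhds hz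
  have hsub : ∀ z : ℂ, 0 < z.re → -α < z.re := fun z hz => by linarith
  have hEq : ∀ z : ℂ, 0 ≤ z.re → laplaceTransform k z = F z := fun z hz => (hF.eqOn hα hk hz).symm
  have hdF : ∀ z : ℂ, -α < z.re → DifferentiableAt ℂ F z := fun z hz =>
    hF.analytic.differentiableAt ((isOpen_lt_re (-α)).mem_nhds hz)
  have hevEq : ∀ z : ℂ, 0 < z.re → (fun z => (c : ℂ) + laplaceTransform k z) =ᶠ[𝓝 z] fun z => c + F z := by
    intro z hz
    filter_upwards [hnhd z hz] with w hw
    rw [hEq w (le_of_lt hw)]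
  have hderiv : ∀ z : ℂ, 0 < z.re → deriv (fun z => (c : ℂ) + laplaceTransform k z) z = deriv F z := by
    intro z hz
    rw [(hevEq z hz).deriv_eq]
    simp
  have hdiff : DifferentiableOn ℂ (fun z => (c : ℂ) + laplaceTransform k z) {z | 0 < z.re} := by
    intro z hz
    refine DifferentiableAt.differentiableWithinAt ?_
    exact (((hdF z (hsub z hz)).const_add (c : ℂ)).congr_of_eventuallyEq (hevEq z hz))
  have hbound : ∀ z : ℂ, 0 < z.re → ‖(c : ℂ) + laplaceTransform k z‖ ≤ |c| + M := by
    intro z hz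
    rw [hEq z hz.le]
    refine (norm_add_le _ _).trans (add_le_add (by simp) (hM z (hsub z hz).le))
  have hF0 : (F 0).re = ∫ t in Ioi (0 : ℝ), k t := by
    rw [← hEq 0 (by simp), laplaceTransform]
    simp only [zero_mul, neg_zero, Complex.exp_zero, one_mul]
    rw [integral_complex_ofReal, Complex.ofReal_re]
  rcases hcase with ⟨hc, hpos⟩ | ⟨hne, hpos⟩
  · have hcont : Continuous fun y : ℝ => c + (F (y * Complex.I)).re := by
      refine continuous_const.add (Complex.continuous_re.comp ?_)
      refine hF.continuous.comp_continuous (by fun_prop) fun y => ?_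
      simpa using hα.le
    obtain ⟨ε, hε, hle⟩ := exists_pos_le_of_tendsto_cocompact hcont hpos hc (by
      have h1 := (Complex.continuous_re.tendsto 0).comp (tendsto_laplace_mul_I_cocompact (k := k))
      have h2 := h1.const_add c
      simp only [Complex.zero_re, add_zero] at h2
      refine h2.congr fun y => ?_
      rw [Function.comp, hEq _ (by simp)])
    have hre : ∀ z : ℂ, 0 ≤ z.re → ε ≤ ((c : ℂ) + F z).re := by
      intro z hz
      have := le_re_of_le_re_boundary (σ := 0) (e := ε - c) (F := F) (M := M)
        (hF.analytic.mono fun z hz => hsub z hz)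
        (hF.continuous.mono fun z (hz : 0 ≤ z.re) => by
          simp only [mem_ofPred_eq]; linarith)
        (fun z hz => hM z (by linarith)) (fun y => by
          have := hle y
          simp only [Complex.ofReal_zero, zero_add]; linarith) hz
      simp only [Complex.add_re, Complex.ofReal_re]; linarith
    have hre' : ∀ z : ℂ, 0 < z.re → ε ≤ ((c : ℂ) + laplaceTransform k z).re := fun z hz => by
      rw [hEq z hz.le]; exact hre z hz.le
    refine ⟨⟨|c| + M, (|c| + M) / ε + M / α / ε, ε, by positivity, by positivity, hε, hdiff, hbound,
      fun z hz => hε.trans_le (hre' z hz), fun z hz => ?_, fun z hz => ?_,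
      fun z hz _ _ => hre' z hz⟩, ?_⟩
    · rw [hderiv z hz]
      -- The closed disc of radius α about z stays in Re > -α, because Re z > 0.
      have h1 : ‖deriv F z‖ ≤ M / α := by
        refine Complex.norm_deriv_le_of_forall_mem_sphere_norm_le hα ?_ ?_
        · refine DifferentiableOn.diffContOnCl ?_
          intro w hw
          refine (hdF w ?_).differentiableWithinAt
          rw [closure_ball _ hα.ne', mem_closedBall_iff_norm] at hw
          have := (abs_le.1 ((Complex.abs_re_le_norm (w - z)).trans hw)).1
          simp only [Complex.sub_re] at this; linarith
        · intro w hw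
          refine hM w ?_
          rw [mem_sphere_iff_norm] at hw
          have := (abs_le.1 ((Complex.abs_re_le_norm (w - z)).trans hw.le)).1
          simp only [Complex.sub_re] at this; linarith
      calc ‖deriv F z‖ ≤ M / α := h1
        _ = M / α / ε * ε := by field_simp
        _ ≤ ((|c| + M) / ε + M / α / ε) * (c + laplaceTransform k z).re := by
          have := hre' z hz
          have h5 : 0 ≤ (|c| + M) / ε := by positivity
          gcongr
          linarith
    · calc |((c : ℂ) + laplaceTransform k z).im| ≤ |c| + M :=
            (Complex.abs_im_le_norm _).trans (hbound z hz)
        _ = (|c| + M) / ε * 1 * ε := by field_simp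
        _ ≤ ((|c| + M) / ε + M / α / ε) * (1 + |z.im|) * (c + laplaceTransform k z).re := by
          have := hre' z hz
          have h5 : 0 ≤ M / α / ε := by positivity
          have h6 := abs_nonneg z.im
          gcongr
          · linarith
          · linarith
    · have := hre 0 (by simp)
      rw [Complex.add_re, Complex.ofReal_re, hF0] at this
      linarith
  · have hnonneg : ∀ z : ℂ, -α < z.re → 0 ≤ (F z).re := fun z hz =>
      le_re_of_le_re_boundary (σ := -α) (e := 0) (F := F) (M := M) hF.analytic hF.continuous hM
        (fun y => by simpa using hpos y) hz.le
    have hFpos : ∀ z : ℂ, -α < z.re → 0 < (F z).re := by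
      intro z hz
      refine lt_of_le_of_ne (hnonneg z hz) fun h0 => hne ?_
      have hconst : ∀ w : ℂ, -α < w.re → F w = F z := fun w hw =>
        eqOn_const_of_re_eq_zero hF.analytic hnonneg hz h0.symm hw
      -- If Re F vanished somewhere, F would be constant. As k̃ tends to 0 along the positive axis,
      -- the constant is 0 and then k vanishes a.e., which is excluded.
      have hFz : F z = 0 := by
        refine tendsto_nhds_unique ?_ (tendsto_laplace_atTop hk)
        refine tendsto_const_nhds.congr' ?_
        filter_upwards [eventually_gt_atTop 0] with x hx
        rw [hEq x (by simpa using hx.le), hconst x (by simp; linarith)]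
      refine ae_eq_zero_of_laplace_eq_zero hk fun w hw => ?_
      rw [hEq w hw.le, hconst w (hsub w hw), hFz]
    have hcpos : 0 ≤ c := h.nonneg
    have hGre : ∀ z : ℂ, 0 < z.re → (F z).re ≤ ((c : ℂ) + laplaceTransform k z).re := fun z hz => by
      rw [hEq z hz.le]; simpa using hcpos
    -- The constant m is the minimum of Re F over the closed rectangle [0, 1] × [-1, 1]. Its edge Re
    -- z = 0 lies inside the domain of F, so the minimum is positive.
    obtain ⟨z₀, hz₀, hmin⟩ := ((isCompact_Icc (a := (0 : ℝ)) (b := 1)).reProdIm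
      (isCompact_Icc (a := (-1 : ℝ)) (b := 1))).exists_isMinOn (f := fun z => (F z).re)
      ⟨0, by simp [Complex.mem_reProdIm]⟩ (by
        refine Complex.continuous_re.comp_continuousOn (hF.continuous.mono ?_)
        intro z hz
        rw [Complex.mem_reProdIm] at hz
        simp only [mem_ofPred_eq]
        linarith [hz.1.1])
    rw [Complex.mem_reProdIm] at hz₀
    refine ⟨⟨|c| + M, 1 / α, (F z₀).re, by positivity, by positivity,
      hFpos _ (by linarith [hz₀.1.1]), hdiff, hbound,
      fun z hz => (hFpos z (hsub z hz)).trans_le (hGre z hz), fun z hz => ?_, fun z hz => ?_,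
      fun z hz hz1 hz2 => ?_⟩, ?_⟩
    · rw [hderiv z hz]
      have h1 := norm_deriv_le_of_re_pos hF.analytic hFpos (hsub z hz)
      have h2 := hGre z hz
      have h3 : ‖deriv F z‖ * α ≤ ((c : ℂ) + laplaceTransform k z).re := by
        nlinarith [norm_nonneg (deriv F z)]
      rw [one_div, inv_mul_eq_div, le_div_iff₀ hα]
      exact h3
    · have hsymm : F ((starRingEnd ℂ) z) = (starRingEnd ℂ) (F z) := by
        rw [← hEq z hz.le, ← laplace_conj, hEq _ (by simpa using hz.le)]
      have h1 := abs_im_le_of_re_pos hF.analytic hFpos (hsub z hz) hsymm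
      have h2 := hGre z hz
      have h4 : ((c : ℂ) + laplaceTransform k z).im = (F z).im := by rw [hEq z hz.le]; simp
      rw [h4]
      have h5 := abs_nonneg z.im
      have h6 := (hFpos z (hsub z hz)).le
      have h3 : |(F z).im| * α ≤ (1 + |z.im|) * ((c : ℂ) + laplaceTransform k z).re :=
        calc |(F z).im| * α ≤ |(F z).im| * (z.re - -α) := by
              gcongr; linarith
          _ ≤ |z.im| * (F z).re := h1
          _ ≤ (1 + |z.im|) * ((c : ℂ) + laplaceTransform k z).re := by
              gcongr; linarith
      rw [one_div, mul_assoc, inv_mul_eq_div, le_div_iff₀ hα]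
      exact h3
    · refine le_trans ?_ (hGre z hz)
      exact hmin (by rw [Complex.mem_reProdIm]; exact ⟨⟨hz.le, hz1⟩, abs_le.1 hz2⟩)
    · have := hFpos 0 (by simpa using hα)
      rw [hF0] at this
      linarith

/-! ### Integrals over vertical lines -/

lemma integrable_const_add_sq_inv {b : ℝ} (hb : 0 < b) : Integrable fun y : ℝ => (b ^ 2 + y ^ 2)⁻¹ := by
  have h := (integrable_inv_one_add_sq.comp_mul_left' (R := b⁻¹) (by positivity)).const_mul ((b ^ 2)⁻¹)
  refine h.congr (Eventually.of_forall fun y => ?_)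
  field_simp

lemma integral_const_add_sq_inv {b : ℝ} (hb : 0 < b) : ∫ y : ℝ, (b ^ 2 + y ^ 2)⁻¹ = Real.pi / b := by
  have h : ∀ y : ℝ, (b ^ 2 + y ^ 2)⁻¹ = (b ^ 2)⁻¹ * (1 + (b⁻¹ * y) ^ 2)⁻¹ := fun y => by
    field_simp
  simp_rw [h]
  rw [integral_const_mul, Measure.integral_comp_mul_left (fun y : ℝ => (1 + y ^ 2)⁻¹),
    integral_univ_inv_one_add_sq, inv_inv, abs_of_pos hb, smul_eq_mul]
  field_simp

lemma norm_add_mul_I_sq (x y : ℝ) : ‖(x : ℂ) + y * Complex.I‖ ^ 2 = x ^ 2 + y ^ 2 := by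
  rw [← Complex.normSq_eq_norm_sq, Complex.normSq_add_mul_I]

lemma continuous_vertical_of_differentiableOn {h : ℂ → ℂ} (hd : DifferentiableOn ℂ h {z | 0 < z.re})
    {x : ℝ} (hx : 0 < x) : Continuous fun y : ℝ => h (x + y * Complex.I) :=
  hd.continuousOn.comp_continuous (by fun_prop) fun y => by simpa using hx

lemma integrable_vertical {h : ℂ → ℂ} (hd : DifferentiableOn ℂ h {z | 0 < z.re})
    {x K : ℝ} (hx : 0 < x) (hK : ∀ y : ℝ, ‖h (x + y * Complex.I)‖ ≤ K / ‖(x : ℂ) + y * Complex.I‖ ^ 2) :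
    Integrable fun y : ℝ => h (x + y * Complex.I) := by
  refine ((integrable_const_add_sq_inv hx).const_mul K).mono'
    (continuous_vertical_of_differentiableOn hd hx).aestronglyMeasurable
    (Eventually.of_forall fun y => ?_)
  have := hK y
  rwa [norm_add_mul_I_sq, div_eq_mul_inv] at this

/-- Shift of a vertical line of integration. -/
lemma integral_vertical_eq {h : ℂ → ℂ} (hd : DifferentiableOn ℂ h {z | 0 < z.re})
    {a b K : ℝ} (ha : 0 < a) (hab : a ≤ b)
    (hK : ∀ z : ℂ, a ≤ z.re → z.re ≤ b → ‖h z‖ ≤ K / ‖z‖ ^ 2) :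
    ∫ y : ℝ, h (a + y * Complex.I) = ∫ y : ℝ, h (b + y * Complex.I) := by
  have hb : 0 < b := ha.trans_le hab
  have hinta := integrable_vertical hd ha fun y => hK _ (by simp) (by simpa using hab)
  have hintb := integrable_vertical hd hb fun y => hK _ (by simpa using hab) (by simp)
  have hK0 : 0 ≤ K := by
    have h1 := (norm_nonneg _).trans (hK a (by simp) (by simpa using hab))
    have h2 : 0 < ‖(a : ℂ)‖ ^ 2 := by
      have : (a : ℂ) ≠ 0 := by exact_mod_cast ha.ne'
      positivity
    by_contra hneg
    exact absurd h1 (not_le.2 (div_neg_of_neg_of_pos (not_le.1 hneg) h2))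
  have hrect : ∀ T : ℝ,
      (∫ x : ℝ in a..b, h (x + (-T : ℝ) * Complex.I)) - (∫ x : ℝ in a..b, h (x + T * Complex.I))
        + Complex.I • (∫ y : ℝ in (-T)..T, h (b + y * Complex.I))
        - Complex.I • (∫ y : ℝ in (-T)..T, h (a + y * Complex.I)) = 0 := by
    intro T
    have := Complex.integral_boundary_rect_eq_zero_of_differentiableOn h ⟨a, -T⟩ ⟨b, T⟩
      (hd.mono fun z hz => by
        rw [Complex.mem_reProdIm] at hz
        simp only at hz
        rw [uIcc_of_le hab] at hz
        exact ha.trans_le hz.1.1)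
    simpa using this
  have hhor : ∀ T : ℝ, T ≠ 0 → ‖∫ x : ℝ in a..b, h (x + T * Complex.I)‖ ≤ K / T ^ 2 * |b - a| := by
    intro T hT
    refine intervalIntegral.norm_integral_le_of_norm_le_const fun x hx => ?_
    rw [uIoc_of_le hab] at hx
    refine (hK _ (by simpa using hx.1.le) (by simpa using hx.2)).trans ?_
    rw [norm_add_mul_I_sq]
    have : 0 < T ^ 2 := by positivity
    gcongr
    nlinarith
  have hlim0 : Tendsto (fun T : ℝ => K / T ^ 2 * |b - a|) atTop (𝓝 0) := by
    have : Tendsto (fun T : ℝ => K / T ^ 2) atTop (𝓝 0) :=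
      tendsto_const_nhds.div_atTop (tendsto_pow_atTop two_ne_zero)
    simpa using this.mul_const |b - a|
  have htop : Tendsto (fun T : ℝ => ∫ x : ℝ in a..b, h (x + T * Complex.I)) atTop (𝓝 0) := by
    refine squeeze_zero_norm' ?_ hlim0
    filter_upwards [eventually_ne_atTop 0] with T hT using hhor T hT
  have hbot : Tendsto (fun T : ℝ => ∫ x : ℝ in a..b, h (x + (-T : ℝ) * Complex.I)) atTop (𝓝 0) := by
    refine squeeze_zero_norm' ?_ hlim0
    filter_upwards [eventually_ne_atTop 0] with T hT
    simpa using hhor (-T) (neg_ne_zero.2 hT)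
  have hla := intervalIntegral_tendsto_integral hinta tendsto_neg_atTop_atBot tendsto_id
  have hlb := intervalIntegral_tendsto_integral hintb tendsto_neg_atTop_atBot tendsto_id
  have hall := ((hbot.sub htop).add (hlb.const_smul Complex.I)).sub (hla.const_smul Complex.I)
  simp only [id, hrect] at hall
  have h0 := tendsto_nhds_unique tendsto_const_nhds hall
  rw [sub_zero, zero_add, ← smul_sub, eq_comm, smul_eq_zero] at h0
  rcases h0 with h0 | h0
  · exact absurd h0 Complex.I_ne_zero
  · exact (sub_eq_zero.1 h0).symm

/-! ### Bounds for the resolvent transform `1 / (z + μ G z)` -/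

namespace PassiveSymbol

variable {G : ℂ → ℂ} {M C m : ℝ}

lemma le_re_denom (hG : PassiveSymbol G M C m) {μ : ℝ} (hμ : 0 < μ) {z : ℂ} (hz : 0 < z.re) :
    z.re ≤ (z + μ * G z).re := by
  have := mul_pos hμ (hG.re_pos z hz)
  simp; linarith

lemma denom_ne_zero (hG : PassiveSymbol G M C m) {μ : ℝ} (hμ : 0 < μ) {z : ℂ} (hz : 0 < z.re) :
    z + μ * G z ≠ 0 := fun h => by
  have := hG.le_re_denom hμ hz
  rw [h] at this
  exact absurd this (not_le.2 (by simpa using hz))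

/-- Since |μG| ≤ μM and |z + μG| ≥ Re z ≥ a, the perturbation μG is itself a multiple of the
denominator. Hence 1/(z + μG)² decays like |z|⁻². -/
lemma norm_le_denom (hG : PassiveSymbol G M C m) {μ : ℝ} (hμ : 0 < μ) {a : ℝ} (ha : 0 < a) {z : ℂ}
    (hz : a ≤ z.re) : ‖z‖ ≤ (1 + μ * M / a) * ‖z + μ * G z‖ := by
  have hz0 : 0 < z.re := ha.trans_le hz
  have h1 : a ≤ ‖z + μ * G z‖ :=
    (hz.trans (hG.le_re_denom hμ hz0)).trans (Complex.re_le_norm _)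
  have h2 : ‖z‖ ≤ ‖z + μ * G z‖ + μ * M := by
    have h3 := norm_sub_le (z + μ * G z) (μ * G z)
    rw [add_sub_cancel_right, norm_mul, Complex.norm_of_nonneg hμ.le] at h3
    have := mul_le_mul_of_nonneg_left (hG.bound z hz0) hμ.le
    linarith
  have h4 : μ * M ≤ μ * M / a * ‖z + μ * G z‖ := by
    have h5 : 0 ≤ μ * M / a := by have := hG.M_nonneg; positivity
    calc μ * M = μ * M / a * a := by field_simp
      _ ≤ _ := by gcongr
  linarith

lemma differentiableOn_inv_denom (hG : PassiveSymbol G M C m) {μ : ℝ} (hμ : 0 < μ) :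
    DifferentiableOn ℂ (fun z => 1 / (z + μ * G z)) {z | 0 < z.re} :=
  DifferentiableOn.div (by fun_prop) (differentiableOn_id.add (hG.diff.const_mul _))
    fun z hz => hG.denom_ne_zero hμ hz

/-- The function 1/(z + μG) decays only like 1/|z| and need not be absolutely integrable on vertical
lines; subtracting 1/(z + 1) gains one more power. -/
lemma norm_inv_denom_sub_le (hG : PassiveSymbol G M C m) {μ : ℝ} (hμ : 0 < μ) {a : ℝ} (ha : 0 < a)
    {z : ℂ} (hz : a ≤ z.re) :
    ‖1 / (z + μ * G z) - 1 / (z + 1)‖ ≤ (1 + μ * M) * (1 + μ * M / a) / ‖z‖ ^ 2 := by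
  have hz0 : 0 < z.re := ha.trans_le hz
  have hD := hG.denom_ne_zero hμ hz0
  have hzn : 0 < ‖z‖ := hz0.trans_le (Complex.re_le_norm z)
  have h1 : z + 1 ≠ 0 := fun h => by
    have := congrArg Complex.re h
    simp at this; linarith
  rw [div_sub_div _ _ hD h1, norm_div, norm_mul]
  have hnum : ‖1 * (z + 1) - (z + μ * G z) * 1‖ ≤ 1 + μ * M := by
    rw [show 1 * (z + 1) - (z + μ * G z) * 1 = 1 - μ * G z by ring]
    refine (norm_sub_le _ _).trans ?_
    rw [norm_one, norm_mul, Complex.norm_of_nonneg hμ.le]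
    have := hG.bound z hz0
    gcongr
  have h2 : ‖z‖ ≤ ‖z + 1‖ := by
    rw [← sq_le_sq₀ (norm_nonneg _) (norm_nonneg _), ← Complex.normSq_eq_norm_sq,
      ← Complex.normSq_eq_norm_sq, Complex.normSq_apply, Complex.normSq_apply]
    simp; nlinarith
  have h3 := hG.norm_le_denom hμ ha hz
  have hDn := norm_pos_iff.2 hD
  have h1n := norm_pos_iff.2 h1
  rw [div_le_div_iff₀ (by positivity) (by positivity)]
  have hM := hG.M_nonneg
  calc _ ≤ (1 + μ * M) * (‖z‖ * ‖z‖) := by rw [sq]; gcongr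
    _ ≤ (1 + μ * M) * (((1 + μ * M / a) * ‖z + μ * G z‖) * ‖z + 1‖) := by gcongr
    _ = _ := by ring

/-- The line can be moved to any abscissa b ≥ x, where the integral is at most Kπ/b with K
independent of b; then b → ∞. -/
lemma integral_inv_denom_sub (hG : PassiveSymbol G M C m) {μ : ℝ} (hμ : 0 < μ) {x : ℝ} (hx : 0 < x) :
    ∫ y : ℝ, (1 / ((x + y * Complex.I) + μ * G (x + y * Complex.I))
      - 1 / ((x + y * Complex.I) + 1)) = 0 := by
  set h : ℂ → ℂ := fun z => 1 / (z + μ * G z) - 1 / (z + 1)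
  have hd : DifferentiableOn ℂ h {z | 0 < z.re} := by
    refine (hG.differentiableOn_inv_denom hμ).sub (DifferentiableOn.div (by fun_prop) (by fun_prop) ?_)
    intro z hz h
    have := congrArg Complex.re h
    simp only [Complex.add_re, Complex.one_re, Complex.zero_re] at this
    rw [mem_ofPred_eq] at hz; linarith
  set K := (1 + μ * M) * (1 + μ * M / x)
  have hbd : ∀ b, x ≤ b → ‖∫ y : ℝ, h (x + y * Complex.I)‖ ≤ K * (Real.pi / b) := by
    intro b hb
    rw [integral_vertical_eq hd hx hb fun z hz _ => hG.norm_inv_denom_sub_le hμ hx hz]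
    rw [← integral_const_add_sq_inv (hx.trans_le hb), ← integral_const_mul]
    refine norm_integral_le_of_norm_le
      ((integrable_const_add_sq_inv (hx.trans_le hb)).const_mul K) (Eventually.of_forall fun y => ?_)
    have := hG.norm_inv_denom_sub_le hμ hx (z := b + y * Complex.I) (by simpa using hb)
    rwa [norm_add_mul_I_sq, div_eq_mul_inv] at this
  have hlim : Tendsto (fun b : ℝ => K * (Real.pi / b)) atTop (𝓝 0) := by
    simpa using (tendsto_const_nhds.div_atTop tendsto_id : Tendsto (fun b : ℝ => Real.pi / b) atTop
      (𝓝 0)).const_mul K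
  have : ‖∫ y : ℝ, h (x + y * Complex.I)‖ ≤ 0 := by
    refine ge_of_tendsto hlim ?_
    filter_upwards [eventually_ge_atTop x] with b hb using hbd b hb
  exact norm_le_zero_iff.1 this

lemma re_inv_line (x y : ℝ) :
    (1 / (((x : ℂ) + y * Complex.I) + 1)).re = (x + 1) * ((x + 1) ^ 2 + y ^ 2)⁻¹ := by
  rw [one_div, Complex.inv_re, Complex.normSq_apply]
  simp [div_eq_mul_inv]
  left; ring

lemma integrable_inv_denom_sub (hG : PassiveSymbol G M C m) {μ : ℝ} (hμ : 0 < μ) {x : ℝ}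
    (hx : 0 < x) : Integrable fun y : ℝ => (1 / ((x + y * Complex.I) + μ * G (x + y * Complex.I))
      - 1 / ((x + y * Complex.I) + 1)) := by
  have hd : DifferentiableOn ℂ (fun z => 1 / (z + μ * G z) - 1 / (z + 1)) {z | 0 < z.re} := by
    refine (hG.differentiableOn_inv_denom hμ).sub (DifferentiableOn.div (by fun_prop) (by fun_prop) ?_)
    intro z hz h
    have := congrArg Complex.re h
    simp only [Complex.add_re, Complex.one_re, Complex.zero_re] at this
    rw [mem_ofPred_eq] at hz; linarith
  exact integrable_vertical hd hx fun y => hG.norm_inv_denom_sub_le hμ hx (by simp)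

lemma integrable_re_inv_denom (hG : PassiveSymbol G M C m) {μ : ℝ} (hμ : 0 < μ) {x : ℝ}
    (hx : 0 < x) :
    Integrable fun y : ℝ => (1 / ((x + y * Complex.I) + μ * G (x + y * Complex.I))).re := by
  have h1 := (hG.integrable_inv_denom_sub hμ hx).re
  have h2 := (integrable_const_add_sq_inv (b := x + 1) (by linarith)).const_mul (x + 1)
  refine (h1.add h2).congr (Eventually.of_forall fun y => ?_)
  simp only [Pi.add_apply, RCLike.re_to_complex, Complex.sub_re, re_inv_line, sub_add_cancel]

/-- The comparison function has Re 1/(z + 1) equal to a Poisson kernel of total mass π, and the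
difference integrates to zero. The value is independent of x, μ and G, which is what makes the decay
estimate uniform. -/
lemma integral_re_inv_denom (hG : PassiveSymbol G M C m) {μ : ℝ} (hμ : 0 < μ) {x : ℝ}
    (hx : 0 < x) :
    ∫ y : ℝ, (1 / ((x + y * Complex.I) + μ * G (x + y * Complex.I))).re = Real.pi := by
  have h1 := (hG.integrable_inv_denom_sub hμ hx)
  have h2 := (integrable_const_add_sq_inv (b := x + 1) (by linarith)).const_mul (x + 1)
  have h3 := integral_re h1
  rw [hG.integral_inv_denom_sub hμ hx] at h3
  have h4 := integral_add h1.re h2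
  rw [h3, integral_const_mul, integral_const_add_sq_inv (by linarith)] at h4
  have h5 : (x + 1) * (Real.pi / (x + 1)) = Real.pi := by field_simp
  rw [h5] at h4
  simp only [RCLike.re_to_complex, Complex.sub_re, re_inv_line, sub_add_cancel, Complex.zero_re,
    zero_add] at h4
  exact h4

/-- With D = z + μG the numerator is at most 1 + C Re D, and Re D/|D|² = Re(1/D). It remains to
absorb the 1. For |y| ≤ 1 it is at most Re D/(μm). For |y| > 1 either Re D is not small, or Im G is
so small compared with y that |D| ≥ |y|/2 and the term in 1/(1 + y²) suffices. -/
lemma norm_deriv_inv_denom_le (hG : PassiveSymbol G M C m) {μ : ℝ} (hμ : 0 < μ) {x y : ℝ}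
    (hx : 0 < x) (hx1 : x ≤ 1) {z : ℂ} (hz : z = x + y * Complex.I) :
    ‖(1 + μ * deriv G z) / (z + μ * G z) ^ 2‖
      ≤ (5 * (C + 1) + 1 / (μ * m)) * (1 / (z + μ * G z)).re + 8 * (1 ^ 2 + y ^ 2)⁻¹ := by
  have hzre : z.re = x := by simp [hz]
  have hzim : z.im = y := by simp [hz]
  have hz0 : 0 < z.re := by rw [hzre]; exact hx
  have hD := hG.denom_ne_zero hμ hz0
  have hC := hG.C_nonneg
  have hm := hG.m_pos
  have hGre := hG.re_pos z hz0
  set D := z + μ * G z with hDdef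
  have hDre : D.re = x + μ * (G z).re := by simp [hDdef, hzre]
  have hDim : D.im = y + μ * (G z).im := by simp [hDdef, hzim]
  have hn : 0 < ‖D‖ ^ 2 := by have := norm_pos_iff.2 hD; positivity
  have hre : (1 / D).re = D.re / ‖D‖ ^ 2 := by
    rw [one_div, Complex.inv_re, Complex.normSq_eq_norm_sq]
  have hDpos : 0 < D.re := by rw [hDre]; positivity
  have hnum : ‖1 + μ * deriv G z‖ ≤ 1 + C * D.re := by
    refine (norm_add_le _ _).trans ?_
    rw [norm_one, norm_mul, Complex.norm_of_nonneg hμ.le]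
    have h1 := mul_le_mul_of_nonneg_left (hG.deriv_le z hz0) hμ.le
    rw [hDre]
    nlinarith [mul_nonneg hC hx.le]
  have hone : 1 ≤ (4 * (C + 1) + 1 / (μ * m)) * D.re + 8 * (1 ^ 2 + y ^ 2)⁻¹ * ‖D‖ ^ 2 := by
    have hpos1 : 0 ≤ 8 * (1 ^ 2 + y ^ 2)⁻¹ * ‖D‖ ^ 2 := by positivity
    have hpos2 : 0 ≤ 4 * (C + 1) * D.re := by positivity
    have hpos3 : 0 ≤ 1 / (μ * m) * D.re := by positivity
    rcases le_or_gt |y| 1 with hy | hy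
    · have h1 := hG.le_re z hz0 (by rwa [hzre]) (by rwa [hzim])
      have h2 : μ * m ≤ D.re := by
        rw [hDre]; nlinarith
      have h3 : 1 ≤ 1 / (μ * m) * D.re := by
        rw [one_div, inv_mul_eq_div, one_le_div (by positivity)]; exact h2
      linarith
    · rcases le_or_gt 1 (4 * (C + 1) * D.re) with h | h
      · linarith
      · have h1 := hG.im_le z hz0
        rw [hzim] at h1
        have h2 : μ * |(G z).im| ≤ (1 + |y|) / 4 := by
          have h3 : μ * |(G z).im| ≤ (C * (1 + |y|)) * (μ * (G z).re) := by
            nlinarith [mul_le_mul_of_nonneg_left h1 hμ.le]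
          have h4 : C * (μ * (G z).re) ≤ 1 / 4 := by
            have : C * (μ * (G z).re) ≤ (C + 1) * D.re := by
              have : 0 < μ * (G z).re := by positivity
              rw [hDre]; nlinarith
            linarith
          nlinarith [abs_nonneg y]
        -- For |y| > 1 one has μ|Im G| ≤ (1 + |y|)/4 ≤ |y|/2, so Im D = y + μ Im G retains half of
        -- y.
        have h5 : |y| / 2 ≤ |D.im| := by
          have h6 : |y| ≤ |D.im| + μ * |(G z).im| := by
            have := abs_sub (D.im) (μ * (G z).im)
            rw [hDim, add_sub_cancel_right, abs_mul, abs_of_pos hμ] at this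
            rwa [hDim]
          linarith
        have h7 : |y| / 2 ≤ ‖D‖ := h5.trans (Complex.abs_im_le_norm D)
        have h8 : y ^ 2 / 4 ≤ ‖D‖ ^ 2 := by
          have := pow_le_pow_left₀ (by positivity) h7 2
          rw [div_pow, sq_abs] at this; linarith
        have h9 : 1 ≤ y ^ 2 := by nlinarith [sq_abs y]
        have h10 : 1 ≤ 8 * (1 ^ 2 + y ^ 2)⁻¹ * ‖D‖ ^ 2 := by
          rw [mul_right_comm, ← div_eq_mul_inv, one_le_div (by positivity)]
          linarith
        linarith
  rw [norm_div, norm_pow, hre, div_le_iff₀ hn, add_mul, mul_assoc _ (D.re / ‖D‖ ^ 2),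
    div_mul_cancel₀ _ hn.ne']
  nlinarith

/-- The integral bound behind the decay of the resolvent. -/
lemma norm_integral_vertical_le (hG : PassiveSymbol G M C m) {μ : ℝ} (hμ : 0 < μ) {x t : ℝ}
    (hx : 0 < x) (hx1 : x ≤ 1) :
    ‖∫ y : ℝ, Complex.exp ((x + y * Complex.I) * t) * ((1 + μ * deriv G (x + y * Complex.I))
        / ((x + y * Complex.I) + μ * G (x + y * Complex.I)) ^ 2)‖
      ≤ Real.exp (x * t) * ((5 * (C + 1) + 1 / (μ * m)) * Real.pi + 8 * Real.pi) := by
  have h1 := hG.integrable_re_inv_denom hμ hx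
  have h2 := integrable_const_add_sq_inv one_pos
  have h3 : ∫ y : ℝ, Real.exp (x * t) * ((5 * (C + 1) + 1 / (μ * m))
      * (1 / ((x + y * Complex.I) + μ * G (x + y * Complex.I))).re + 8 * (1 ^ 2 + y ^ 2)⁻¹)
      = Real.exp (x * t) * ((5 * (C + 1) + 1 / (μ * m)) * Real.pi + 8 * Real.pi) := by
    rw [integral_const_mul, integral_add (h1.const_mul _) (h2.const_mul _), integral_const_mul,
      integral_const_mul, hG.integral_re_inv_denom hμ hx, integral_const_add_sq_inv one_pos, div_one]
  rw [← h3]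
  refine norm_integral_le_of_norm_le (((h1.const_mul _).add (h2.const_mul _)).const_mul _)
    (Eventually.of_forall fun y => ?_)
  rw [norm_mul, Complex.norm_exp]
  have e : (((x : ℂ) + y * Complex.I) * t).re = x * t := by simp
  rw [e]
  gcongr
  exact hG.norm_deriv_inv_denom_le hμ hx hx1 rfl

/-- The integral in `norm_integral_vertical_le` does not depend on the abscissa. -/
lemma integral_vertical_deriv_inv_denom_eq (hG : PassiveSymbol G M C m) {μ : ℝ} (hμ : 0 < μ)
    {a b t : ℝ} (ha : 0 < a) (hab : a ≤ b) (ht : 0 ≤ t) :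
    ∫ y : ℝ, Complex.exp ((a + y * Complex.I) * t) * ((1 + μ * deriv G (a + y * Complex.I))
        / ((a + y * Complex.I) + μ * G (a + y * Complex.I)) ^ 2)
      = ∫ y : ℝ, Complex.exp ((b + y * Complex.I) * t) * ((1 + μ * deriv G (b + y * Complex.I))
        / ((b + y * Complex.I) + μ * G (b + y * Complex.I)) ^ 2) := by
  have hC := hG.C_nonneg
  have hM := hG.M_nonneg
  have hdG : DifferentiableOn ℂ (deriv G) {z | 0 < z.re} := hG.diff.deriv (isOpen_lt_re 0)
  refine integral_vertical_eq (h := fun z => Complex.exp (z * t) * ((1 + μ * deriv G z)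
    / (z + μ * G z) ^ 2)) (K := Real.exp (b * t) * ((1 + μ * (C * M)) * (1 + μ * M / a) ^ 2))
    ?_ ha hab ?_
  · refine DifferentiableOn.mul (by fun_prop) (DifferentiableOn.div ?_ ?_ ?_)
    · exact (hdG.const_mul _).const_add _
    · exact (differentiableOn_id.add (hG.diff.const_mul _)).pow 2
    · exact fun z hz => pow_ne_zero _ (hG.denom_ne_zero hμ hz)
  · intro z hza hzb
    have hz0 : 0 < z.re := ha.trans_le hza
    have hD := norm_pos_iff.2 (hG.denom_ne_zero hμ hz0)
    have hzn : 0 < ‖z‖ := hz0.trans_le (Complex.re_le_norm z)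
    rw [norm_mul, Complex.norm_exp, norm_div, norm_pow, mul_div_assoc]
    have e : (z * t).re = z.re * t := by simp
    rw [e]
    have hnum : ‖1 + μ * deriv G z‖ ≤ 1 + μ * (C * M) := by
      refine (norm_add_le _ _).trans ?_
      rw [norm_one, norm_mul, Complex.norm_of_nonneg hμ.le]
      have h1 : ‖deriv G z‖ ≤ C * M := (hG.deriv_le z hz0).trans
        (mul_le_mul_of_nonneg_left ((Complex.re_le_norm _).trans (hG.bound z hz0)) hC)
      gcongr
    have h3 := hG.norm_le_denom hμ ha hza
    have h4 : ‖1 + μ * deriv G z‖ / ‖z + μ * G z‖ ^ 2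
        ≤ (1 + μ * (C * M)) * (1 + μ * M / a) ^ 2 / ‖z‖ ^ 2 := by
      rw [div_le_div_iff₀ (by positivity) (by positivity)]
      calc _ ≤ (1 + μ * (C * M)) * ((1 + μ * M / a) * ‖z + μ * G z‖) ^ 2 := by gcongr
        _ = _ := by ring
    gcongr

end PassiveSymbol

/-! ### The integrated kernel `c + ∫₀ᵗ k` -/

/-- The integrated kernel `c + ∫₀ᵗ k`, equal to `c` for `t ≤ 0`. -/
def memoryKernel (c : ℝ) (k : ℝ → ℝ) (t : ℝ) : ℝ := c + ∫ r in (0 : ℝ)..t, (Ioi (0 : ℝ)).indicator k r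

section memoryKernel

variable {c : ℝ} {k : ℝ → ℝ}

lemma integrable_indicator_Ioi (hk : IntegrableOn k (Ioi 0)) :
    Integrable ((Ioi (0 : ℝ)).indicator k) := (integrable_indicator_iff measurableSet_Ioi).2 hk

lemma continuous_memoryKernel (hk : IntegrableOn k (Ioi 0)) : Continuous (memoryKernel c k) :=
  continuous_const.add (intervalIntegral.continuous_primitive
    (fun _ _ => (integrable_indicator_Ioi hk).intervalIntegrable) 0)

lemma abs_memoryKernel_le (hk : IntegrableOn k (Ioi 0)) (t : ℝ) :
    |memoryKernel c k t| ≤ |c| + ∫ r in Ioi (0 : ℝ), ‖k r‖ := by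
  refine (abs_add_le _ _).trans (add_le_add le_rfl ?_)
  have h := intervalIntegral.norm_integral_le_integral_norm_uIoc (f := (Ioi (0 : ℝ)).indicator k)
    (μ := volume) (a := 0) (b := t)
  refine h.trans ((setIntegral_le_integral (integrable_indicator_Ioi hk).norm
    (Eventually.of_forall fun _ => norm_nonneg _)).trans (le_of_eq ?_))
  rw [← integral_indicator measurableSet_Ioi]
  congr 1; ext r
  rw [norm_indicator_eq_indicator_norm]

lemma tendsto_memoryKernel (hk : IntegrableOn k (Ioi 0)) :
    Tendsto (memoryKernel c k) atTop (𝓝 (c + ∫ r in Ioi (0 : ℝ), k r)) := by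
  refine tendsto_const_nhds.add ?_
  have := intervalIntegral_tendsto_integral_Ioi 0 (integrable_indicator_Ioi hk).integrableOn
    tendsto_id
  rwa [setIntegral_indicator measurableSet_Ioi, inter_self] at this

end memoryKernel

/-! ### Laplace transforms of convolutions and of the resolvent -/

lemma laplaceTransform_convolution {f g : ℝ → ℝ} {z : ℂ}
    (hf : IntegrableOn (fun t : ℝ => Complex.exp (-(z * t)) * (f t : ℂ)) (Ioi 0))
    (hg : IntegrableOn (fun t : ℝ => Complex.exp (-(z * t)) * (g t : ℂ)) (Ioi 0)) :
    laplaceTransform (fun t => ∫ r in (0 : ℝ)..t, f r * g (t - r)) z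
      = laplaceTransform f z * laplaceTransform g z := by
  have h := integral_posConvolution hf hg (ContinuousLinearMap.mul ℝ ℂ)
  simp only [ContinuousLinearMap.mul_apply'] at h
  rw [laplaceTransform, laplaceTransform, laplaceTransform, ← h]
  refine setIntegral_congr_fun measurableSet_Ioi fun t _ => ?_
  rw [← intervalIntegral.integral_ofReal, ← intervalIntegral.integral_const_mul]
  congr 1; ext r
  have : Complex.exp (-(z * t)) = Complex.exp (-(z * r)) * Complex.exp (-(z * ((t - r : ℝ) : ℂ))) := by
    rw [← Complex.exp_add]; congr 1; push_cast; ring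
  rw [this]; push_cast; ring

lemma integrableOn_laplace_integrand_one {z : ℂ} (hz : 0 < z.re) :
    IntegrableOn (fun t : ℝ => Complex.exp (-(z * t)) * ((1 : ℝ) : ℂ)) (Ioi 0) := by
  have := integrableOn_exp_mul_complex_Ioi (a := -z) (by simpa using hz) 0
  simpa [neg_mul] using this

lemma laplaceTransform_one {z : ℂ} (hz : 0 < z.re) : laplaceTransform (fun _ => 1) z = 1 / z := by
  have := integral_exp_mul_complex_Ioi (a := -z) (by simpa using hz) 0
  simp only [neg_mul, Complex.ofReal_zero, mul_zero, Complex.exp_zero] at this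
  rw [laplaceTransform]
  simp only [Complex.ofReal_one, mul_one]
  rw [this, div_neg, neg_div, neg_neg]

lemma integrableOn_laplace_integrand_of_le {f : ℝ → ℝ} (hf : Continuous f) {K σ : ℝ}
    (hb : ∀ t, 0 ≤ t → |f t| ≤ K * Real.exp (σ * t)) {z : ℂ} (hz : σ < z.re) :
    IntegrableOn (fun t : ℝ => Complex.exp (-(z * t)) * (f t : ℂ)) (Ioi 0) := by
  have hdom : IntegrableOn (fun t : ℝ => K * Real.exp (-(z.re - σ) * t)) (Ioi 0) :=
    (integrableOn_exp_mul_Ioi (by linarith) 0).const_mul K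
  refine Integrable.mono' hdom (Continuous.aestronglyMeasurable (by fun_prop)) ?_
  rw [ae_restrict_iff' measurableSet_Ioi]
  refine Eventually.of_forall fun t ht => ?_
  rw [norm_mul, norm_cexp_neg_mul, Complex.norm_real]
  calc _ ≤ Real.exp (-(z.re * t)) * (K * Real.exp (σ * t)) := by
        gcongr; exact hb t (le_of_lt ht)
    _ = K * (Real.exp (-(z.re * t)) * Real.exp (σ * t)) := by ring
    _ = _ := by rw [← Real.exp_add]; congr 2; ring

/-- The integrated kernel is c + k * 1 on t > 0, and 1 has transform 1/z. -/
lemma laplaceTransform_memoryKernel {c : ℝ} {k : ℝ → ℝ} (hk : IntegrableOn k (Ioi 0)) {z : ℂ}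
    (hz : 0 < z.re) : laplaceTransform (memoryKernel c k) z = (c + laplaceTransform k z) / z := by
  have h1 := integrableOn_laplace_integrand_one hz
  have h2 := integrableOn_laplace_integrand hk hz.le
  have hconv := laplaceTransform_convolution h2 h1
  rw [laplaceTransform_one hz] at hconv
  have hN := integrableOn_laplace_integrand_of_le (continuous_memoryKernel (c := c) hk) (σ := 0)
    (K := |c| + ∫ r in Ioi (0 : ℝ), ‖k r‖) (fun t _ => by simpa using abs_memoryKernel_le hk t) hz
  have hsplit : laplaceTransform (memoryKernel c k) z
      = c * laplaceTransform (fun _ => 1) z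
        + laplaceTransform (fun t => ∫ r in (0 : ℝ)..t, k r * (fun _ => (1 : ℝ)) (t - r)) z := by
    have hEq : ∀ t ∈ Ioi (0 : ℝ), Complex.exp (-(z * t)) * (memoryKernel c k t : ℂ)
        = c * (Complex.exp (-(z * t)) * ((1 : ℝ) : ℂ))
          + Complex.exp (-(z * t)) * ((∫ r in (0 : ℝ)..t, k r * (fun _ => (1 : ℝ)) (t - r) : ℝ) : ℂ) := by
      intro t ht
      have : ∫ r in (0 : ℝ)..t, (Ioi (0 : ℝ)).indicator k r = ∫ r in (0 : ℝ)..t, k r := by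
        rw [intervalIntegral.integral_of_le (le_of_lt ht), intervalIntegral.integral_of_le (le_of_lt ht)]
        exact setIntegral_congr_fun measurableSet_Ioc fun r hr => indicator_of_mem hr.1 k
      simp only [memoryKernel, this, mul_one]
      push_cast; ring
    rw [laplaceTransform, laplaceTransform, laplaceTransform, ← integral_const_mul,
      setIntegral_congr_fun measurableSet_Ioi hEq, integral_add (h1.const_mul _)]
    refine (hN.sub (h1.const_mul (c : ℂ))).congr_fun ?_ measurableSet_Ioi
    intro t ht
    simp only [Pi.sub_apply, hEq t ht, add_sub_cancel_left]
  rw [hsplit, hconv, laplaceTransform_one hz]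
  ring

section resolvent

variable {c : ℝ} {k : ℝ → ℝ}

/-- A bound for the integrated kernel. -/
def memoryBound (c : ℝ) (k : ℝ → ℝ) : ℝ := |c| + ∫ r in Ioi (0 : ℝ), ‖k r‖

lemma memoryBound_nonneg : 0 ≤ memoryBound c k :=
  add_nonneg (abs_nonneg _) (integral_nonneg fun _ => norm_nonneg _)

lemma continuous_resolvent_memoryKernel (hk : IntegrableOn k (Ioi 0)) :
    Continuous fun p : ℝ × ℝ => resolvent (memoryKernel c k) p.1 p.2 :=
  continuous_resolvent (continuous_memoryKernel hk) (abs_memoryKernel_le hk)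

/-- Transform of the Volterra equation. At this stage only the bound |S| ≤ exp(μMt) is known, so the
transform is available only far to the right; analyticity of 1/(z + μG) later permits moving the
line. -/
lemma laplaceTransform_resolvent {M C m : ℝ} (hk : IntegrableOn k (Ioi 0))
    (hG : PassiveSymbol (fun z => c + laplaceTransform k z) M C m) {μ : ℝ} (hμ : 0 < μ) {z : ℂ}
    (hz : μ * memoryBound c k < z.re) :
    laplaceTransform (fun t => resolvent (memoryKernel c k) t μ) z
      = 1 / (z + μ * (c + laplaceTransform k z)) := by
  have hz0 : 0 < z.re := (mul_nonneg hμ.le memoryBound_nonneg).trans_lt hz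
  have hNc := continuous_memoryKernel (c := c) hk
  have hsc : Continuous fun t => resolvent (memoryKernel c k) t μ :=
    (continuous_resolvent_memoryKernel hk).comp (by fun_prop : Continuous fun t : ℝ => (t, μ))
  have hN := integrableOn_laplace_integrand_of_le hNc (σ := 0)
    (K := memoryBound c k) (fun t _ => by
      rw [zero_mul, Real.exp_zero, mul_one]; exact abs_memoryKernel_le hk t) hz0
  have hs := integrableOn_laplace_integrand_of_le hsc (σ := μ * memoryBound c k)
    (K := 1) (fun t ht => by
      have := abs_resolvent_le (abs_memoryKernel_le (c := c) hk) t μ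
      rw [abs_of_nonneg (mul_nonneg hμ.le ht)] at this
      rw [one_mul]
      refine this.trans_eq ?_
      rw [memoryBound]; congr 1; ring) hz
  have h1 := integrableOn_laplace_integrand_one hz0
  have hconv := laplaceTransform_convolution hs hN
  have hEq : ∀ t : ℝ, Complex.exp (-(z * t)) * ((1 : ℝ) : ℂ)
      = Complex.exp (-(z * t)) * (resolvent (memoryKernel c k) t μ : ℂ)
      + μ * (Complex.exp (-(z * t)) * ((∫ r in (0 : ℝ)..t, resolvent (memoryKernel c k) r μ
        * memoryKernel c k (t - r) : ℝ) : ℂ)) := by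
    intro t
    have h := resolvent_eq hNc (abs_memoryKernel_le hk) t μ
    have h' : (1 : ℝ) = resolvent (memoryKernel c k) t μ + μ * ∫ r in (0 : ℝ)..t,
        resolvent (memoryKernel c k) r μ * memoryKernel c k (t - r) := by
      rw [h]
      simp_rw [mul_comm (resolvent (memoryKernel c k) _ μ)]
      ring
    conv_lhs => rw [h']
    push_cast; ring
  have hint : IntegrableOn (fun t : ℝ => μ * (Complex.exp (-(z * t))
      * ((∫ r in (0 : ℝ)..t, resolvent (memoryKernel c k) r μ
        * memoryKernel c k (t - r) : ℝ) : ℂ))) (Ioi 0) := by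
    refine (h1.sub hs).congr_fun ?_ measurableSet_Ioi
    intro t _
    simp only [Pi.sub_apply]
    rw [hEq t, add_sub_cancel_left]
  have htot : laplaceTransform (fun _ => 1) z
      = laplaceTransform (fun t => resolvent (memoryKernel c k) t μ) z
      + μ * laplaceTransform (fun t => ∫ r in (0 : ℝ)..t, resolvent (memoryKernel c k) r μ
        * memoryKernel c k (t - r)) z := by
    rw [laplaceTransform, laplaceTransform, laplaceTransform, ← integral_const_mul,
      ← integral_add hs hint]
    exact setIntegral_congr_fun measurableSet_Ioi fun t _ => hEq t
  rw [hconv, laplaceTransform_one hz0, laplaceTransform_memoryKernel hk hz0] at htot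
  have hzne : z ≠ 0 := by rintro rfl; simp at hz0
  rw [eq_div_iff (hG.denom_ne_zero hμ hz0)]
  field_simp at htot
  linear_combination -htot

/-- Inversion of the Laplace transform of `t ↦ t * resolvent t μ`. -/
lemma resolvent_inversion {M C m : ℝ} (hk : IntegrableOn k (Ioi 0))
    (hG : PassiveSymbol (fun z => c + laplaceTransform k z) M C m) {μ : ℝ} (hμ : 0 < μ) {x t : ℝ}
    (hx : μ * memoryBound c k < x) (ht : 0 < t) :
    ((t * resolvent (memoryKernel c k) t μ : ℝ) : ℂ) = ((2 * Real.pi)⁻¹ : ℂ) *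
      ∫ y : ℝ, Complex.exp ((x + y * Complex.I) * t)
        * ((1 + μ * deriv (fun z => c + laplaceTransform k z) (x + y * Complex.I))
        / ((x + y * Complex.I) + μ * (c + laplaceTransform k (x + y * Complex.I))) ^ 2) := by
  have hx0 : 0 < x := (mul_nonneg hμ.le memoryBound_nonneg).trans_lt hx
  set G : ℂ → ℂ := fun z => c + laplaceTransform k z with hGdef
  set φ : ℂ → ℂ := fun z => (1 + μ * deriv G z) / (z + μ * G z) ^ 2 with hφ
  set s : ℝ → ℝ := fun t => resolvent (memoryKernel c k) t μ with hs
  have hsc : Continuous s :=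
    (continuous_resolvent_memoryKernel hk).comp (by fun_prop : Continuous fun t : ℝ => (t, μ))
  have hsb : ∀ t, 0 ≤ t → |s t| ≤ Real.exp (μ * memoryBound c k * t) := fun t ht => by
    have := abs_resolvent_le (abs_memoryKernel_le (c := c) hk) t μ
    rw [abs_of_nonneg (mul_nonneg hμ.le ht)] at this
    refine this.trans_eq ?_
    rw [memoryBound]; congr 1; ring
  set f₀ : ℝ → ℂ := (Ioi (0 : ℝ)).indicator fun t => ((Real.exp (-(x * t)) * s t : ℝ) : ℂ) with hf₀
  -- The factor t differentiates the transform and turns 1/D into D'/D², which is integrable on the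
  -- line, so pointwise Fourier inversion is legitimate. It is also the source of the decay 1/t.
  set f₁ : ℝ → ℂ := (Ioi (0 : ℝ)).indicator fun t => ((t * (Real.exp (-(x * t)) * s t) : ℝ) : ℂ)
    with hf₁
  have hf₀i : Integrable f₀ := by
    rw [hf₀, integrable_indicator_iff measurableSet_Ioi]
    have := integrableOn_laplace_integrand_of_le hsc (K := 1) (fun t ht => by
      rw [one_mul]; exact hsb t ht) (z := x) (by simpa using hx)
    refine this.congr (Eventually.of_forall fun t => ?_)
    push_cast; rfl
  have hf₁i : Integrable f₁ := by
    rw [hf₁, integrable_indicator_iff measurableSet_Ioi]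
    -- Half of the gap in the exponent is spent on absorbing the factor t.
    set δ := (x - μ * memoryBound c k) / 2
    have hδ : 0 < δ := by simp only [δ]; linarith
    have := integrableOn_laplace_integrand_of_le (f := fun t => t * s t) (by fun_prop) (K := 1 / δ)
      (σ := μ * memoryBound c k + δ) (fun t ht => by
        rw [abs_mul, abs_of_nonneg ht, add_mul, Real.exp_add]
        have h1 : t ≤ 1 / δ * Real.exp (δ * t) := by
          rw [one_div, inv_mul_eq_div, le_div_iff₀ hδ]
          have := Real.add_one_le_exp (δ * t)
          linarith
        calc t * |s t| ≤ (1 / δ * Real.exp (δ * t)) * Real.exp (μ * memoryBound c k * t) := by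
              gcongr
              exact hsb t ht
          _ = _ := by ring) (z := x) (by simp only [Complex.ofReal_re, δ]; linarith)
    refine this.congr (Eventually.of_forall fun t => ?_)
    push_cast; ring
  have hf₁f₀ : ∀ t : ℝ, f₁ t = t * f₀ t := by
    intro t
    by_cases h : t ∈ Ioi (0 : ℝ)
    · simp only [hf₁, hf₀, indicator_of_mem h]; push_cast; ring
    · simp only [hf₁, hf₀, indicator_of_notMem h, mul_zero]
  have hF₀ : ∀ y : ℝ, 𝓕 f₀ y = 1 / ((x + 2 * Real.pi * y * Complex.I)
      + μ * G (x + 2 * Real.pi * y * Complex.I)) := by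
    intro y
    rw [hf₀, ← laplace_add_two_pi_mul_I, laplaceTransform_resolvent hk hG hμ (by simpa using hx)]
  have hline : ∀ y : ℝ, 0 < ((x : ℂ) + 2 * Real.pi * y * Complex.I).re := fun y => by simpa using hx0
  have hF₁ : ∀ y : ℝ, 𝓕 f₁ y = φ (x + 2 * Real.pi * y * Complex.I) := by
    intro y
    -- The transform of f₀ is differentiated twice over: under the integral sign, which gives the
    -- transform of f₁, and from the formula 1/D, which gives φ.
    have hd1 := Real.hasDerivAt_fourier hf₀i (hf₁i.congr (Eventually.of_forall fun t => by
      rw [hf₁f₀]; simp)) y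
    have hd1' : HasDerivAt (𝓕 f₀) ((-2 * Real.pi * Complex.I) * 𝓕 f₁ y) y := by
      convert! hd1 using 1
      rw [← smul_eq_mul, Real.fourier_eq, Real.fourier_eq, ← integral_smul]
      congr 1; ext t
      rw [hf₁f₀, smul_comm, smul_eq_mul, smul_eq_mul, ← mul_assoc]
    have hz := hline y
    have hGd : HasDerivAt G (deriv G (x + 2 * Real.pi * y * Complex.I))
        (x + 2 * Real.pi * y * Complex.I) :=
      (hG.diff.differentiableAt ((isOpen_lt_re 0).mem_nhds hz)).hasDerivAt
    have hD := ((hasDerivAt_id (𝕜 := ℂ) (x + 2 * Real.pi * y * Complex.I)).add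
      (hGd.const_mul (μ : ℂ))).fun_inv (hG.denom_ne_zero hμ hz)
    have hl : HasDerivAt (fun y : ℝ => (x : ℂ) + 2 * Real.pi * y * Complex.I)
        (2 * Real.pi * Complex.I) y := by
      have := (((Complex.ofRealCLM.hasDerivAt (x := y)).const_mul (2 * Real.pi : ℂ)).mul_const
        Complex.I).const_add (x : ℂ)
      simpa using this
    have hd2 := hD.scomp y hl
    have hd2' : HasDerivAt (𝓕 f₀) ((2 * Real.pi * Complex.I) *
        -(φ (x + 2 * Real.pi * y * Complex.I))) y := by
      refine (hd2.congr_of_eventuallyEq (Eventually.of_forall fun w => ?_)).congr_deriv ?_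
      · rw [hF₀ w, one_div]; rfl
      · rw [smul_eq_mul, hφ]
        simp only [id, Pi.add_apply]
        ring
    have hu := hd1'.unique hd2'
    have hpi : (2 * Real.pi * Complex.I : ℂ) ≠ 0 := Complex.two_pi_I_ne_zero
    refine mul_left_cancel₀ (neg_ne_zero.2 hpi) ?_
    linear_combination hu
  have hKb : Integrable fun y : ℝ => φ (x + y * Complex.I) := by
    have hdG : DifferentiableOn ℂ (deriv G) {z | 0 < z.re} := hG.diff.deriv (isOpen_lt_re 0)
    have hφd : DifferentiableOn ℂ φ {z | 0 < z.re} := by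
      refine DifferentiableOn.div ((hdG.const_mul _).const_add _)
        ((differentiableOn_id.add (hG.diff.const_mul _)).pow 2) ?_
      exact fun z hz => pow_ne_zero _ (hG.denom_ne_zero hμ hz)
    refine integrable_vertical hφd hx0 (K := (1 + μ * (C * M)) * (1 + μ * M / x) ^ 2) fun y => ?_
    have hz0 : 0 < ((x : ℂ) + y * Complex.I).re := by simpa using hx0
    have hC := hG.C_nonneg
    have hM := hG.M_nonneg
    have hD := norm_pos_iff.2 (hG.denom_ne_zero hμ hz0)
    have hzn : 0 < ‖(x : ℂ) + y * Complex.I‖ := hz0.trans_le (Complex.re_le_norm _)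
    have hnum : ‖1 + μ * deriv G (x + y * Complex.I)‖ ≤ 1 + μ * (C * M) := by
      refine (norm_add_le _ _).trans ?_
      rw [norm_one, norm_mul, Complex.norm_of_nonneg hμ.le]
      have h1 : ‖deriv G (x + y * Complex.I)‖ ≤ C * M := (hG.deriv_le _ hz0).trans
        (mul_le_mul_of_nonneg_left ((Complex.re_le_norm _).trans (hG.bound _ hz0)) hC)
      gcongr
    have h3 := hG.norm_le_denom hμ hx0 (z := x + y * Complex.I) (by simp)
    rw [hφ, norm_div, norm_pow, div_le_div_iff₀ (by positivity) (by positivity)]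
    calc _ ≤ (1 + μ * (C * M)) * ((1 + μ * M / x) * ‖(x + y * Complex.I) + μ * G (x + y * Complex.I)‖) ^ 2 := by
            gcongr
      _ = _ := by ring
  have hFi : Integrable (𝓕 f₁) := by
    have := hKb.comp_mul_left' (R := 2 * Real.pi) (by positivity)
    refine this.congr (Eventually.of_forall fun y => ?_)
    rw [hF₁]; push_cast; rfl
  have hcont : ContinuousAt f₁ t := by
    have : ContinuousAt (fun t : ℝ => ((t * (Real.exp (-(x * t)) * s t) : ℝ) : ℂ)) t :=
      Continuous.continuousAt (by fun_prop)
    refine this.congr ?_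
    filter_upwards [Ioi_mem_nhds ht] with r hr
    rw [hf₁, indicator_of_mem hr]
  have hinv := hf₁i.fourierInv_fourier_eq hFi hcont
  have hval : f₁ t = ((t * (Real.exp (-(x * t)) * s t) : ℝ) : ℂ) := by
    exact indicator_of_mem (show t ∈ Ioi (0 : ℝ) from ht) _
  rw [hval, Real.fourierInv_eq'] at hinv
  have hsub := Measure.integral_comp_mul_left (fun y : ℝ => Complex.exp ((x + y * Complex.I) * t)
        * φ (x + y * Complex.I)) (2 * Real.pi)
  rw [abs_of_pos (by positivity), Complex.real_smul] at hsub
  push_cast at hsub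
  change _ = ((2 * Real.pi)⁻¹ : ℂ) * ∫ y : ℝ, Complex.exp ((x + y * Complex.I) * t)
    * φ (x + y * Complex.I)
  rw [← hsub]
  have hexp : ∀ y : ℝ, Complex.exp ((x + 2 * Real.pi * y * Complex.I) * t)
      * φ (x + 2 * Real.pi * y * Complex.I)
      = Complex.exp (x * t) * (Complex.exp (((2 * Real.pi * ⟪y, t⟫ : ℝ) : ℂ) * Complex.I) • 𝓕 f₁ y) := by
    intro y
    rw [hF₁, smul_eq_mul, ← mul_assoc, ← Complex.exp_add]
    congr 2
    simp
    ring
  simp_rw [hexp]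
  rw [integral_const_mul, hinv]
  push_cast
  rw [mul_left_comm, ← mul_assoc (Complex.exp _), ← Complex.exp_add]
  simp [hs]

/-- Decay of the resolvent of an admissible kernel. -/
theorem exists_resolvent_decay {M C m : ℝ} (hk : IntegrableOn k (Ioi 0))
    (hG : PassiveSymbol (fun z => c + laplaceTransform k z) M C m) :
    ∃ K : ℝ, 0 ≤ K ∧ ∀ μ t : ℝ, 0 < μ → 0 < t →
      |resolvent (memoryKernel c k) t μ| ≤ K * (1 + 1 / μ) / t := by
  have hC := hG.C_nonneg
  have hm := hG.m_pos
  refine ⟨5 * (C + 1) + 1 / m + 8, by positivity, fun μ t hμ ht => ?_⟩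
  -- The inversion formula needs an abscissa beyond μ times the kernel bound, the estimate one in
  -- (0, 1]. The integral is shifted from x₀ to x ≤ 1, and finally x → 0 removes the factor exp(xt).
  set x₀ := max 1 (μ * memoryBound c k + 1)
  have hinv := resolvent_inversion hk hG hμ (x := x₀) (t := t)
    (lt_of_lt_of_le (by linarith) (le_max_right _ _)) ht
  have hbd : ∀ x : ℝ, 0 < x → x ≤ 1 → t * |resolvent (memoryKernel c k) t μ|
      ≤ Real.exp (x * t) * ((5 * (C + 1) + 1 / (μ * m)) + 8) / 2 := by
    intro x hx hx1
    have h1 := hG.integral_vertical_deriv_inv_denom_eq hμ hx (hx1.trans (le_max_left 1 _ : _ ≤ x₀))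
      ht.le
    have h2 := hG.norm_integral_vertical_le hμ (t := t) hx hx1
    rw [h1] at h2
    have h3 := congrArg norm hinv
    rw [Complex.norm_real, Real.norm_eq_abs, abs_mul, abs_of_pos ht, norm_mul] at h3
    rw [h3]
    have h4 : ‖((2 * Real.pi : ℂ))⁻¹‖ = (2 * Real.pi)⁻¹ := by
      rw [norm_inv, norm_mul, Complex.norm_real, Complex.norm_ofNat, Real.norm_of_nonneg Real.pi_pos.le]
    rw [h4, inv_mul_le_iff₀ (by positivity)]
    refine h2.trans_eq ?_
    ring
  have hlim : Tendsto (fun x : ℝ => Real.exp (x * t) * ((5 * (C + 1) + 1 / (μ * m)) + 8) / 2)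
      (𝓝[>] 0) (𝓝 (Real.exp (0 * t) * ((5 * (C + 1) + 1 / (μ * m)) + 8) / 2)) := by
    refine (Continuous.tendsto ?_ _).mono_left nhdsWithin_le_nhds
    fun_prop
  have h := ge_of_tendsto hlim (b := t * |resolvent (memoryKernel c k) t μ|) (by
    filter_upwards [Ioc_mem_nhdsGT (zero_lt_one' ℝ)] with x hx using hbd x hx.1 hx.2)
  rw [zero_mul, Real.exp_zero, one_mul] at h
  rw [le_div_iff₀ ht, mul_comm]
  refine h.trans ?_
  have e : (5 * (C + 1) + 1 / m + 8) * (1 + 1 / μ)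
      = 5 * (C + 1) + 8 + 1 / (μ * m) + (1 / m + (5 * (C + 1) + 8) / μ) := by
    field_simp; ring
  rw [e]
  have p1 : 0 ≤ 1 / (μ * m) := by positivity
  have p2 : 0 ≤ 1 / m + (5 * (C + 1) + 8) / μ := by positivity
  linarith

end resolvent

/-! ### From the distributional to the integral form of a Volterra equation -/

/-- Fubini's theorem on the cone `0 < v ≤ u`. -/
lemma integral_cone_swap {F : ℝ → ℝ → ℝ}
    (hF : Integrable ({p : ℝ × ℝ | 0 < p.2 ∧ p.2 ≤ p.1}.indicator (Function.uncurry F))) :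
    IntegrableOn (fun v => ∫ u in Ioi v, F u v) (Ioi 0) ∧
      ∫ u in Ioi (0 : ℝ), ∫ v in (0 : ℝ)..u, F u v = ∫ v in Ioi (0 : ℝ), ∫ u in Ioi v, F u v := by
  set S : Set (ℝ × ℝ) := {p | 0 < p.2 ∧ p.2 ≤ p.1} with hS
  have h1 : ∀ u : ℝ, ∫ v, S.indicator (Function.uncurry F) (u, v)
      = (Ioi (0 : ℝ)).indicator (fun u => ∫ v in (0 : ℝ)..u, F u v) u := by
    intro u
    by_cases hu : 0 < u
    · rw [indicator_of_mem (show u ∈ Ioi (0 : ℝ) from hu), intervalIntegral.integral_of_le hu.le,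
        ← integral_indicator measurableSet_Ioc]
      rfl
    · rw [indicator_of_notMem (show u ∉ Ioi (0 : ℝ) from hu)]
      rw [← integral_zero ℝ ℝ (μ := volume)]
      congr 1; ext v
      refine indicator_of_notMem ?_ _
      rintro ⟨h, h'⟩
      exact hu (lt_of_lt_of_le h h')
  have h2 : ∀ v : ℝ, ∫ u, S.indicator (Function.uncurry F) (u, v)
      = (Ioi (0 : ℝ)).indicator (fun v => ∫ u in Ioi v, F u v) v := by
    intro v
    by_cases hv : 0 < v
    · rw [indicator_of_mem (show v ∈ Ioi (0 : ℝ) from hv), ← integral_Ici_eq_integral_Ioi,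
        ← integral_indicator measurableSet_Ici]
      congr 1; ext u
      by_cases huv : v ≤ u
      · rw [indicator_of_mem (show u ∈ Ici v from huv), indicator_of_mem]
        · rfl
        · exact ⟨hv, huv⟩
      · rw [indicator_of_notMem (show u ∉ Ici v from huv), indicator_of_notMem]
        exact fun h => huv h.2
    · rw [indicator_of_notMem (show v ∉ Ioi (0 : ℝ) from hv)]
      rw [← integral_zero ℝ ℝ (μ := volume)]
      congr 1; ext u
      exact indicator_of_notMem (fun h => hv h.1) _
  have hF' : Integrable (S.indicator (Function.uncurry F)) (volume.prod volume) := hF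
  constructor
  · rw [← integrable_indicator_iff measurableSet_Ioi]
    exact hF'.integral_prod_right.congr (Eventually.of_forall fun v => h2 v)
  · rw [← integral_indicator measurableSet_Ioi, ← integral_indicator measurableSet_Ioi]
    simp_rw [← h1, ← h2]
    exact integral_integral_swap hF'

lemma measurableSet_cone : MeasurableSet {p : ℝ × ℝ | 0 < p.2 ∧ p.2 ≤ p.1} :=
  (measurableSet_lt measurable_const measurable_snd).inter
    (measurableSet_le measurable_snd measurable_fst)

lemma integral_Ioi_comp_add_right (f : ℝ → ℝ) (v r : ℝ) :
    ∫ u in Ioi v, f (u + r) = ∫ u in Ioi (v + r), f u := by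
  have h := (measurePreserving_add_right volume r).setIntegral_preimage_emb
    (measurableEmbedding_addRight r) f (Ioi (v + r))
  rwa [preimage_add_const_Ioi, add_sub_cancel_right] at h

lemma integral_Ioi_deriv_eq {θ : ℝ → ℝ} (hθ : ContDiff ℝ ∞ θ) (hc : HasCompactSupport θ) (r : ℝ) :
    ∫ u in Ioi r, deriv θ u = -θ r := by
  have h := HasCompactSupport.integral_Ioi_deriv_eq (hθ.of_le (by norm_cast)) hc r
  exact h

/-- Integration by parts for a kernel whose derivative k is merely integrable: N is written as c + ∫
k, the integrals over the cone are exchanged, and ∫ θ' = -θ is used in the inner one. -/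
lemma integral_deriv_mul_memoryKernel {c : ℝ} {k : ℝ → ℝ} (hk : IntegrableOn k (Ioi 0)) {θ : ℝ → ℝ}
    (hθ : ContDiff ℝ ∞ θ) (hc : HasCompactSupport θ) (r : ℝ) :
    ∫ t in Ioi r, deriv θ t * memoryKernel c k (t - r)
      = -(c * θ r + ∫ t in Ioi r, k (t - r) * θ t) := by
  have hθ' : Continuous (deriv θ) := hθ.continuous_deriv (by norm_cast)
  have hc' : HasCompactSupport (deriv θ) := hc.deriv
  have hshift : ∀ f : ℝ → ℝ, ∫ t in Ioi r, f t = ∫ u in Ioi (0 : ℝ), f (u + r) := fun f => by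
    rw [integral_Ioi_comp_add_right, zero_add]
  have hi1 : Integrable fun u => deriv θ (u + r) :=
    (hθ'.integrable_of_hasCompactSupport hc').comp_add_right r
  have hi2 := integrable_indicator_Ioi hk
  have hswap := integral_cone_swap (F := fun u v => deriv θ (u + r) * (Ioi (0 : ℝ)).indicator k v)
    ((hi1.mul_prod hi2).indicator measurableSet_cone)
  rw [hshift, hshift]
  simp only [add_sub_cancel_right]
  have e1 : ∀ u : ℝ, deriv θ (u + r) * memoryKernel c k u = c * deriv θ (u + r)
      + ∫ v in (0 : ℝ)..u, deriv θ (u + r) * (Ioi (0 : ℝ)).indicator k v := by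
    intro u
    rw [intervalIntegral.integral_const_mul, memoryKernel]; ring
  have hNc := continuous_memoryKernel (c := c) hk
  have hi3 : Integrable fun u => deriv θ (u + r) * memoryKernel c k u :=
    hi1.mul_bdd (c := |c| + ∫ r in Ioi (0 : ℝ), ‖k r‖) hNc.aestronglyMeasurable
      (Eventually.of_forall fun u => abs_memoryKernel_le hk u)
  have hi4 : Integrable fun u => ∫ v in (0 : ℝ)..u, deriv θ (u + r) * (Ioi (0 : ℝ)).indicator k v := by
    refine (hi3.sub (hi1.const_mul c)).congr (Eventually.of_forall fun u => ?_)
    simp only [Pi.sub_apply, e1, add_sub_cancel_left]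
  simp_rw [e1]
  rw [integral_add (hi1.const_mul c).integrableOn hi4.integrableOn, hswap.2, integral_const_mul,
    ← hshift (deriv θ), integral_Ioi_deriv_eq hθ hc]
  have e2 : ∀ v ∈ Ioi (0 : ℝ), ∫ u in Ioi v, deriv θ (u + r) * (Ioi (0 : ℝ)).indicator k v
      = -(k v * θ (v + r)) := by
    intro v hv
    rw [integral_mul_const, indicator_of_mem hv, integral_Ioi_comp_add_right (deriv θ),
      integral_Ioi_deriv_eq hθ hc]
    ring
  rw [setIntegral_congr_fun measurableSet_Ioi e2, integral_neg]
  ring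

lemma exists_pos_support_subset {f : ℝ → ℝ} (hc : HasCompactSupport f) :
    ∃ T > 0, ∀ t, T ≤ |t| → f t = 0 := by
  obtain ⟨T, hT0, hT⟩ := hc.isCompact.isBounded.subset_ball_lt 0 0
  refine ⟨T, hT0, fun t ht => ?_⟩
  by_contra h
  have := hT (subset_tsupport f h)
  rw [mem_ball_zero_iff, Real.norm_eq_abs] at this
  linarith

lemma continuous_memory_convolution {N h : ℝ → ℝ} (hN : Continuous N) (hh : Continuous h) :
    Continuous fun t => ∫ r in (0 : ℝ)..t, N (t - r) * h r :=
  intervalIntegral.continuous_parametric_intervalIntegral_of_continuous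
    (f := fun t r => N (t - r) * h r) (by simp only [Function.uncurry_def]; fun_prop) continuous_id

lemma integral_deriv_mul_memory_convolution {c : ℝ} {k : ℝ → ℝ} (hk : IntegrableOn k (Ioi 0))
    {θ : ℝ → ℝ} (hθ : ContDiff ℝ ∞ θ) (hc : HasCompactSupport θ) {h : ℝ → ℝ} (hh : Continuous h) :
    IntegrableOn (fun r => (c * θ r + ∫ t in Ioi r, k (t - r) * θ t) * h r) (Ioi 0) ∧
    ∫ t in Ioi (0 : ℝ), deriv θ t * ∫ r in (0 : ℝ)..t, memoryKernel c k (t - r) * h r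
      = -∫ r in Ioi (0 : ℝ), (c * θ r + ∫ t in Ioi r, k (t - r) * θ t) * h r := by
  have hθ' : Continuous (deriv θ) := hθ.continuous_deriv (by norm_cast)
  obtain ⟨T, hT0, hT⟩ := exists_pos_support_subset hc.deriv
  have hNc := continuous_memoryKernel (c := c) hk
  have hint : Integrable ({p : ℝ × ℝ | 0 < p.2 ∧ p.2 ≤ p.1}.indicator
      (Function.uncurry fun t r => deriv θ t * memoryKernel c k (t - r) * h r)) := by
    have hcont : Continuous (Function.uncurry fun t r => deriv θ t * memoryKernel c k (t - r) * h r) := by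
      simp only [Function.uncurry_def]; fun_prop
    -- Since θ' vanishes for t ≥ T and 0 < r ≤ t on the cone, the integrand lives on a compact
    -- square, where it is continuous.
    have hK : IsCompact (Icc (0 : ℝ) T ×ˢ Icc (0 : ℝ) T) := isCompact_Icc.prod isCompact_Icc
    have hi := ((hcont.continuousOn.integrableOn_compact (μ := volume) hK).integrable_indicator
      hK.measurableSet).indicator measurableSet_cone
    refine hi.congr (Eventually.of_forall fun p => ?_)
    by_cases hp : p ∈ {p : ℝ × ℝ | 0 < p.2 ∧ p.2 ≤ p.1}
    · rw [indicator_of_mem hp, indicator_of_mem hp]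
      by_cases hp2 : p ∈ Icc (0 : ℝ) T ×ˢ Icc (0 : ℝ) T
      · rw [indicator_of_mem hp2]
      · rw [indicator_of_notMem hp2]
        have h1 : T ≤ |p.1| := by
          by_contra hlt
          push Not at hlt
          refine hp2 ⟨⟨hp.1.le.trans hp.2, ?_⟩, ⟨hp.1.le, hp.2.trans ?_⟩⟩ <;>
            exact (le_abs_self _).trans hlt.le
        simp [Function.uncurry_def, hT _ h1]
    · rw [indicator_of_notMem hp, indicator_of_notMem hp]
  obtain ⟨hs1, hs2⟩ := integral_cone_swap hint
  have e : ∀ r : ℝ, ∫ t in Ioi r, deriv θ t * memoryKernel c k (t - r) * h r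
      = -((c * θ r + ∫ t in Ioi r, k (t - r) * θ t) * h r) := fun r => by
    rw [integral_mul_const, integral_deriv_mul_memoryKernel hk hθ hc]; ring
  simp_rw [e] at hs1 hs2
  refine ⟨by simpa using hs1.neg, ?_⟩
  rw [← integral_neg, ← hs2]
  congr 1; ext t
  rw [← intervalIntegral.integral_const_mul]
  congr 1; ext r; ring

/-- A primitive of φ need not have compact support. The one based at T vanishes to the right of the
support; where it may be nonzero to the left is harmless, because a cutoff at negative times does
not affect t > 0. -/
lemma exists_testFunction_deriv_eq {φ : ℝ → ℝ} (hφ : ContDiff ℝ ∞ φ) (hc : HasCompactSupport φ) :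
    ∃ θ : ℝ → ℝ, ContDiff ℝ ∞ θ ∧ HasCompactSupport θ ∧ ∀ t, 0 < t → deriv θ t = φ t := by
  obtain ⟨T, hT0, hT⟩ := exists_pos_support_subset hc
  set Ψ : ℝ → ℝ := fun t => ∫ u in T..t, φ u with hΨ
  have hΨd : ∀ t, HasDerivAt Ψ (φ t) t := fun t =>
    intervalIntegral.integral_hasDerivAt_right (hφ.continuous.intervalIntegrable _ _)
      (hφ.continuous.stronglyMeasurableAtFilter _ _) hφ.continuous.continuousAt
  have hΨc : ContDiff ℝ ∞ Ψ := by
    rw [contDiff_infty_iff_deriv]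
    refine ⟨fun t => (hΨd t).differentiableAt, ?_⟩
    have : deriv Ψ = φ := funext fun t => (hΨd t).deriv
    rwa [this]
  have hΨ0 : ∀ t, T ≤ t → Ψ t = 0 := by
    intro t ht
    rw [hΨ]
    refine intervalIntegral.integral_zero_ae (Eventually.of_forall fun u hu => ?_)
    rw [uIoc_of_le ht] at hu
    exact hT u (hu.1.le.trans (le_abs_self u))
  let χ : ContDiffBump (0 : ℝ) := ⟨T + 1, T + 2, by linarith, by linarith⟩
  refine ⟨fun t => Ψ t * χ t, hΨc.mul χ.contDiff, χ.hasCompactSupport.mul_left, fun t ht => ?_⟩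
  rcases lt_or_ge t (T + 1) with h | h
  · have : (fun t => Ψ t * χ t) =ᶠ[𝓝 t] Ψ := by
      have hmem : Metric.ball (0 : ℝ) (T + 1) ∈ 𝓝 t := by
        refine Metric.isOpen_ball.mem_nhds ?_
        rw [mem_ball_zero_iff, Real.norm_eq_abs, abs_of_pos ht]; exact h
      filter_upwards [hmem] with u hu
      rw [χ.one_of_mem_closedBall (Metric.ball_subset_closedBall hu), mul_one]
    rw [this.deriv_eq, (hΨd t).deriv]
  · have : (fun t => Ψ t * χ t) =ᶠ[𝓝 t] fun _ => 0 := by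
      filter_upwards [Ioi_mem_nhds (show T < t by linarith)] with u hu
      rw [hΨ0 u (le_of_lt hu), zero_mul]
    rw [this.deriv_eq, deriv_const, hT t ((by linarith : T ≤ t).trans (le_abs_self t))]

/-- The test functions need not vanish at 0, so θ' is arbitrary on (0, ∞) and G itself vanishes
there, not merely up to a constant. Continuity adds the point 0. -/
lemma eq_zero_of_integral_deriv_mul_eq_zero {G : ℝ → ℝ} (hG : Continuous G)
    (h : ∀ θ : ℝ → ℝ, ContDiff ℝ ∞ θ → HasCompactSupport θ →
      ∫ t in Ioi (0 : ℝ), deriv θ t * G t = 0) {t : ℝ} (ht : 0 ≤ t) : G t = 0 := by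
  have hae := isOpen_Ioi.ae_eq_zero_of_integral_contDiff_smul_eq_zero (U := Ioi (0 : ℝ)) (f := G)
    (μ := volume) (hG.locallyIntegrable.locallyIntegrableOn _) (fun φ hφ hc hsupp => by
      obtain ⟨θ, hθ, hθc, hθφ⟩ := exists_testFunction_deriv_eq hφ hc
      rw [← h θ hθ hθc, setIntegral_congr_fun measurableSet_Ioi
        (fun t ht => by simp only [hθφ t ht] : EqOn (fun t => deriv θ t * G t) (fun t => φ t * G t) (Ioi 0)),
        setIntegral_eq_integral_of_forall_compl_eq_zero]
      · rfl
      · intro x hx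
        rw [image_eq_zero_of_notMem_tsupport fun hmem => hx (hsupp hmem), zero_mul])
  have hEq : EqOn G 0 (Ioi 0) := by
    refine Measure.eqOn_open_of_ae_eq (μ := volume) ?_ isOpen_Ioi hG.continuousOn continuousOn_const
    rw [EventuallyEq, ae_restrict_iff' measurableSet_Ioi]
    exact hae
  have := hEq.closure hG continuous_const
  rw [closure_Ioi] at this
  exact this ht

/-- The distributional form in time of a Volterra equation implies the integral form. -/
theorem volterra_of_weak {c₁ c₂ g₀ : ℝ} {k₁ k₂ : ℝ → ℝ} (hk₁ : IntegrableOn k₁ (Ioi 0))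
    (hk₂ : IntegrableOn k₂ (Ioi 0)) {g h₁ h₂ : ℝ → ℝ} (hg : Continuous g) (hh₁ : Continuous h₁)
    (hh₂ : Continuous h₂)
    (hw : ∀ θ : ℝ → ℝ, ContDiff ℝ ∞ θ → HasCompactSupport θ →
      (∫ τ in Ioi (0 : ℝ), deriv θ τ * g τ + (c₁ * θ τ + ∫ r in Ioi τ, k₁ (r - τ) * θ r) * h₁ τ
        + (c₂ * θ τ + ∫ r in Ioi τ, k₂ (r - τ) * θ r) * h₂ τ) + θ 0 * g₀ = 0) {t : ℝ} (ht : 0 ≤ t) :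
    g t = g₀ + (∫ r in (0 : ℝ)..t, memoryKernel c₁ k₁ (t - r) * h₁ r)
      + ∫ r in (0 : ℝ)..t, memoryKernel c₂ k₂ (t - r) * h₂ r := by
  set Q₁ : ℝ → ℝ := fun t => ∫ r in (0 : ℝ)..t, memoryKernel c₁ k₁ (t - r) * h₁ r
  set Q₂ : ℝ → ℝ := fun t => ∫ r in (0 : ℝ)..t, memoryKernel c₂ k₂ (t - r) * h₂ r
  have hQ₁ : Continuous Q₁ := continuous_memory_convolution (continuous_memoryKernel hk₁) hh₁
  have hQ₂ : Continuous Q₂ := continuous_memory_convolution (continuous_memoryKernel hk₂) hh₂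
  -- The weak equation says that the defect of the integral equation is orthogonal to every θ'; the
  -- datum g₀ enters through ∫ θ' = -θ(0).
  have key := eq_zero_of_integral_deriv_mul_eq_zero (G := fun t => g t - (g₀ + Q₁ t + Q₂ t))
    (by fun_prop) (fun θ hθ hc => by
      obtain ⟨i1, e1⟩ := integral_deriv_mul_memory_convolution (c := c₁) hk₁ hθ hc hh₁
      obtain ⟨i2, e2⟩ := integral_deriv_mul_memory_convolution (c := c₂) hk₂ hθ hc hh₂
      have hθ' : Continuous (deriv θ) := hθ.continuous_deriv (by norm_cast)
      have hci : ∀ f : ℝ → ℝ, Continuous f → IntegrableOn (fun t => deriv θ t * f t) (Ioi 0) :=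
        fun f hf => ((hθ'.mul hf).integrable_of_hasCompactSupport hc.deriv.mul_right).integrableOn
      have hw' := hw θ hθ hc
      have e0 := integral_add ((hci g hg).add i1) i2
      simp only [Pi.add_apply] at e0
      rw [e0, integral_add (hci g hg) i1] at hw'
      have e3 : ∫ t in Ioi (0 : ℝ), deriv θ t * g₀ = -θ 0 * g₀ := by
        rw [integral_mul_const, integral_Ioi_deriv_eq hθ hc]
      have : ∫ t in Ioi (0 : ℝ), deriv θ t * (g t - (g₀ + Q₁ t + Q₂ t))
          = (∫ t in Ioi (0 : ℝ), deriv θ t * g t) - ((∫ t in Ioi (0 : ℝ), deriv θ t * g₀)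
            + (∫ t in Ioi (0 : ℝ), deriv θ t * Q₁ t) + ∫ t in Ioi (0 : ℝ), deriv θ t * Q₂ t) := by
        have a1 : ∫ t in Ioi (0 : ℝ), (deriv θ t * g₀ + deriv θ t * Q₁ t) = _ :=
          integral_add (hci _ continuous_const) (hci _ hQ₁)
        have a2 : ∫ t in Ioi (0 : ℝ), ((deriv θ t * g₀ + deriv θ t * Q₁ t) + deriv θ t * Q₂ t) = _ :=
          integral_add ((hci _ continuous_const).add (hci _ hQ₁)) (hci _ hQ₂)
        have a3 : ∫ t in Ioi (0 : ℝ), (deriv θ t * g t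
            - ((deriv θ t * g₀ + deriv θ t * Q₁ t) + deriv θ t * Q₂ t)) = _ :=
          integral_sub (hci g hg) (((hci _ continuous_const).add (hci _ hQ₁)).add (hci _ hQ₂))
        rw [← a1, ← a2, ← a3]
        congr 1; ext t; ring
      rw [this, e3, e1, e2]
      linarith) ht
  linarith

/-! ### The elastic operator on Schwartz fields -/

/-- The unit vector `e i` of `ℝ³`. -/
abbrev basisVec (i : Fin 3) : E3 := EuclideanSpace.single i (1 : ℝ)

/-- The real vector field obtained by applying a real functional to all components. -/
def mapField (ℓ : ℂ →L[ℝ] ℝ) : C3 →L[ℝ] E3 :=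
  LinearMap.toContinuousLinearMap
    { toFun := fun y => WithLp.toLp 2 fun i => ℓ (y i)
      map_add' := fun x y => by ext i; simp
      map_smul' := fun c y => by
        ext i
        simp only [PiLp.smul_apply, map_smul, smul_eq_mul, RingHom.id_apply] }

@[simp] lemma mapField_apply (ℓ : ℂ →L[ℝ] ℝ) (y : C3) (i : Fin 3) : mapField ℓ y i = ℓ (y i) := rfl

/-- The divergence of a complex Schwartz field. -/
def divSchwartz : 𝓢(E3, C3) →L[ℂ] 𝓢(E3, ℂ) :=
  ∑ j : Fin 3, LineDeriv.lineDerivOpCLM ℂ 𝓢(E3, ℂ) (basisVec j) ∘L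
    SchwartzMap.postcompCLM (EuclideanSpace.proj j : C3 →L[ℂ] ℂ)

/-- The gradient of the divergence of a complex Schwartz field. -/
def gradDiv : 𝓢(E3, C3) →L[ℂ] 𝓢(E3, C3) :=
  ∑ i : Fin 3, SchwartzMap.postcompCLM
      ((ContinuousLinearMap.id ℂ ℂ).smulRight (EuclideanSpace.single i (1 : ℂ) : C3)) ∘L
    LineDeriv.lineDerivOpCLM ℂ 𝓢(E3, ℂ) (basisVec i) ∘L divSchwartz

lemma divSchwartz_apply (ψ : 𝓢(E3, C3)) (x : E3) :
    divSchwartz ψ x = ∑ j : Fin 3, (fderiv ℝ ψ x (basisVec j)) j := by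
  simp only [divSchwartz, _root_.sum_apply, ContinuousLinearMap.comp_apply,
    LineDeriv.lineDerivOpCLM_apply, SchwartzMap.lineDerivOp_apply_eq_fderiv]
  refine Finset.sum_congr rfl fun j _ => ?_
  have h : (⇑(SchwartzMap.postcompCLM (EuclideanSpace.proj j : C3 →L[ℂ] ℂ) ψ) : E3 → ℂ)
      = fun y => ((EuclideanSpace.proj j : C3 →L[ℂ] ℂ).restrictScalars ℝ) (ψ y) := rfl
  have hd : HasFDerivAt (fun y => ((EuclideanSpace.proj j : C3 →L[ℂ] ℂ).restrictScalars ℝ) (ψ y))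
      (((EuclideanSpace.proj j : C3 →L[ℂ] ℂ).restrictScalars ℝ).comp (fderiv ℝ ψ x)) x :=
    ((EuclideanSpace.proj j : C3 →L[ℂ] ℂ).restrictScalars ℝ).hasFDerivAt.comp x (ψ.hasFDerivAt x)
  rw [h, hd.fderiv]
  rfl

lemma gradDiv_apply (ψ : 𝓢(E3, C3)) (x : E3) (i : Fin 3) :
    gradDiv ψ x i = fderiv ℝ (divSchwartz ψ) x (basisVec i) := by
  simp only [gradDiv, _root_.sum_apply, ContinuousLinearMap.comp_apply,
    LineDeriv.lineDerivOpCLM_apply, SchwartzMap.postcompCLM_apply,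
    SchwartzMap.lineDerivOp_apply_eq_fderiv, ContinuousLinearMap.smulRight_apply,
    ContinuousLinearMap.id_apply]
  rw [WithLp.ofLp_sum, Finset.sum_apply]
  simp [Finset.sum_ite_eq]

lemma gradient_apply (f : E3 → ℝ) (x : E3) (i : Fin 3) : (∇ f x) i = fderiv ℝ f x (basisVec i) := by
  have h : ⟪∇ f x, basisVec i⟫ = fderiv ℝ f x (basisVec i) := by
    rw [gradient, InnerProductSpace.toDual_symm_apply]
  rw [← h, EuclideanSpace.inner_single_right]
  simp

lemma divergence_mapField (ℓ : ℂ →L[ℝ] ℝ) (c : ℝ) (ψ : 𝓢(E3, C3)) (x : E3) :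
    divergence (fun x => c • mapField ℓ (ψ x)) x = c * ℓ (divSchwartz ψ x) := by
  have h : HasFDerivAt (fun x => c • mapField ℓ (ψ x)) (c • (mapField ℓ).comp (fderiv ℝ ψ x)) x :=
    ((mapField ℓ).hasFDerivAt.comp x (ψ.hasFDerivAt x)).const_smul c
  rw [divergence, h.fderiv, divSchwartz_apply, map_sum, Finset.mul_sum]
  rfl

/-- The operator has real constant coefficients, so it commutes with applying a real functional to
every component. Real test fields are thereby replaced by complex Schwartz fields. -/
lemma elasticOp_mapField (p q c : ℝ) (ℓ : ℂ →L[ℝ] ℝ) (ψ : 𝓢(E3, C3)) (x : E3) :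
    elasticOp p q (fun x => c • mapField ℓ (ψ x)) x
      = c • mapField ℓ (p • (Δ ψ) x + ((p + 2 * q) / 3) • gradDiv ψ x) := by
  have h1 : Δ (fun x => c • mapField ℓ (ψ x)) x = c • mapField ℓ ((Δ ψ) x) := by
    have hd : ContDiffAt ℝ 2 ψ x := (ψ.smooth 2).contDiffAt
    have e1 := InnerProductSpace.laplacian_smul c
      ((mapField ℓ).contDiff.contDiffAt.comp x hd : ContDiffAt ℝ 2 (mapField ℓ ∘ ψ) x)
    have e2 := hd.laplacian_CLM_comp_left (l := mapField ℓ)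
    rw [e2] at e1
    rw [SchwartzMap.laplacian_apply]
    exact e1
  have h2 : ∇ (divergence (fun x => c • mapField ℓ (ψ x))) x = c • mapField ℓ (gradDiv ψ x) := by
    ext i
    rw [gradient_apply]
    have e : divergence (fun x => c • mapField ℓ (ψ x)) = fun x => c * ℓ (divSchwartz ψ x) :=
      funext fun x => divergence_mapField ℓ c ψ x
    have hd : HasFDerivAt (fun x => c * ℓ (divSchwartz ψ x))
        (c • ℓ.comp (fderiv ℝ (divSchwartz ψ) x)) x :=
      (ℓ.hasFDerivAt.comp x ((divSchwartz ψ).hasFDerivAt x)).const_smul c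
    rw [e, hd.fderiv]
    simp [gradDiv_apply]
  rw [elasticOp, h1, h2]
  simp only [map_add, map_smul, smul_add]
  rw [smul_comm p c, smul_comm _ c (mapField ℓ (gradDiv ψ x))]

/-! ### The solution as a continuous curve in `L²` -/

/-- Plancherel, and the weight is at least 1 for s ≥ 0. -/
lemma eLpNorm_le_sobolevNorm {s : ℝ} (hs : 0 ≤ s) (f : E3 → C3) :
    eLpNorm f 2 volume ≤ sobolevNorm s f := by
  by_cases hf : MemLp f 2 (volume : Measure E3)
  · rw [sobolevNorm, dif_pos hf]
    have h1 : eLpNorm f 2 volume = eLpNorm (𝓕 (hf.toLp f) : Lp C3 2 (volume : Measure E3)) 2 volume := by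
      have := Lp.norm_fourier_eq (hf.toLp f)
      rw [Lp.norm_toLp, Lp.norm_def, ENNReal.toReal_eq_toReal_iff' (Lp.eLpNorm_ne_top _)
        hf.eLpNorm_ne_top] at this
      exact this.symm
    rw [h1, eLpNorm_eq_lintegral_rpow_enorm_toReal (by norm_num) (by norm_num)]
    simp only [ENNReal.toReal_ofNat]
    gcongr with η
    rw [ENNReal.rpow_ofNat]
    refine le_mul_of_one_le_left bot_le ?_
    rw [ENNReal.one_le_ofReal]
    exact Real.one_le_rpow (by nlinarith [sq_nonneg ‖(2 * Real.pi) • η‖]) hs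
  · rw [sobolevNorm, dif_neg hf]; exact le_top

lemma MemSobolevSpace.memLp {s : ℝ} {f : E3 → E3} (hf : MemSobolevSpace s f) :
    MemLp (complexify f) 2 (volume : Measure E3) := by
  by_contra h
  rw [MemSobolevSpace, sobolevNorm, dif_neg h] at hf
  exact lt_irrefl _ hf

lemma complexify_sub (f g : E3 → E3) :
    complexify (fun x => f x - g x) = complexify f - complexify g := by
  ext x i; simp [complexify]

/-- A curve in `C([0, ∞), H^s)` as a continuous curve in `L²`, extended by its initial value. -/
lemma ContinuousInSobolev.exists_curve {s : ℝ} (hs : 0 ≤ s) {v : ℝ → E3 → E3}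
    (hv : ContinuousInSobolev s v) : ∃ w : ℝ → Lp C3 2 (volume : Measure E3),
      Continuous w ∧ ∀ t, 0 ≤ t → w t =ᵐ[volume] complexify (v t) := by
  classical
  set u : ℝ → Lp C3 2 (volume : Measure E3) := fun t =>
    if h : MemLp (complexify (v t)) 2 (volume : Measure E3) then h.toLp else 0 with hu
  have hmem : ∀ t, 0 ≤ t → MemLp (complexify (v t)) 2 (volume : Measure E3) :=
    fun t ht => (hv.1 t ht).memLp
  have hut : ∀ t, 0 ≤ t → u t =ᵐ[volume] complexify (v t) := fun t ht => by
    simp only [hu, dif_pos (hmem t ht)]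
    exact (hmem t ht).coeFn_toLp
  have hcont : ContinuousOn u (Ici 0) := by
    intro t₀ ht₀
    have h := hv.2 t₀ ht₀
    rw [ContinuousWithinAt, Lp.tendsto_Lp_iff_tendsto_eLpNorm']
    refine tendsto_of_tendsto_of_tendsto_of_le_of_le' tendsto_const_nhds h
      (Eventually.of_forall fun _ => bot_le) ?_
    filter_upwards [self_mem_nhdsWithin] with t ht
    refine le_trans (le_of_eq ?_) (eLpNorm_le_sobolevNorm hs _)
    rw [complexify_sub]
    exact eLpNorm_congr_ae ((hut t ht).sub (hut t₀ ht₀))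
  refine ⟨fun t => u (max t 0), ?_, fun t ht => ?_⟩
  · exact hcont.comp_continuous (by fun_prop) fun t => le_max_right t 0
  · simp only [max_eq_left ht]; exact hut t ht

/-- Pairing with a Schwartz field, through a real functional. -/
lemma map_inner_toLp_eq {f : E3 → E3} {w : Lp C3 2 (volume : Measure E3)}
    (hw : w =ᵐ[volume] complexify f) (ℓ : ℂ →L[ℝ] ℝ) (ψ : 𝓢(E3, C3)) :
    ∫ x, ⟪f x, mapField ℓ (ψ x)⟫ = ℓ (inner ℂ w (ψ.toLp 2)) := by
  rw [L2.inner_def]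
  refine Eq.trans ?_ (ContinuousLinearMap.integral_comp_comm ℓ
    (L2.integrable_inner (𝕜 := ℂ) w (ψ.toLp 2 volume)))
  refine integral_congr_ae ?_
  filter_upwards [hw, ψ.coeFn_toLp 2 volume] with x h1 h2
  rw [h1, h2, PiLp.inner_apply, PiLp.inner_apply, map_sum]
  refine Finset.sum_congr rfl fun i _ => ?_
  have : inner ℂ ((complexify f x) i) (ψ x i) = (f x i) • ψ x i := by
    simp [complexify, mul_comm]
  rw [this, map_smul, mapField_apply]
  simp [mul_comm]

/-! ### The integral equation tested against compactly supported fields -/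

lemma integrableOn_shift_mul {k : ℝ → ℝ} (hk : IntegrableOn k (Ioi 0)) {θ : ℝ → ℝ}
    (hθ : Continuous θ) (hc : HasCompactSupport θ) (τ : ℝ) :
    IntegrableOn (fun r => k (r - τ) * θ r) (Ioi τ) := by
  obtain ⟨K, hK⟩ := hθ.bounded_above_of_compact_support hc
  have h1 : IntegrableOn (fun r => k (r - τ)) (Ioi τ) := by
    have := (measurePreserving_sub_right volume τ).integrableOn_comp_preimage
      (measurableEmbedding_subRight τ) (f := k) (s := Ioi 0)
    rw [preimage_sub_const_Ioi, zero_add] at this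
    exact this.2 hk
  exact h1.mul_bdd hθ.aestronglyMeasurable (Eventually.of_forall hK)

lemma setIntegral_smul_add_smul {F : Type*} [NormedAddCommGroup F] [NormedSpace ℝ F]
    [CompleteSpace F] {S : Set ℝ} {f g : ℝ → ℝ} (hf : IntegrableOn f S) (hg : IntegrableOn g S)
    (y z : F) : ∫ r in S, (f r • y + g r • z) = (∫ r in S, f r) • y + (∫ r in S, g r) • z := by
  have h := integral_add (hf.smul_const y) (hg.smul_const z)
  rwa [integral_smul_const, integral_smul_const] at h

/-- The adjoint operator of the viscoelastic system on a product test field. -/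
lemma adjoint_mapField {a₀ b₀ : ℝ} {a b : ℝ → ℝ} (ha : IntegrableOn a (Ioi 0))
    (hk : IntegrableOn (fun r => (a r + 2 * b r) / 3) (Ioi 0)) (ψ : 𝓢(E3, C3)) (ℓ : ℂ →L[ℝ] ℝ)
    {θ : ℝ → ℝ} (hθ : ContDiff ℝ ∞ θ) (hc : HasCompactSupport θ) (τ : ℝ) (x : E3) :
    deriv (fun r => θ r • mapField ℓ (ψ x)) τ
        + elasticOp a₀ b₀ (fun x => θ τ • mapField ℓ (ψ x)) x
        + ∫ r in Ioi τ, elasticOp (a (r - τ)) (b (r - τ)) (fun x => θ r • mapField ℓ (ψ x)) x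
      = mapField ℓ (deriv θ τ • ψ x
        + (a₀ * θ τ + ∫ r in Ioi τ, a (r - τ) * θ r) • (Δ ψ) x
        + ((a₀ + 2 * b₀) / 3 * θ τ + ∫ r in Ioi τ, (a (r - τ) + 2 * b (r - τ)) / 3 * θ r)
          • gradDiv ψ x) := by
  have e0 : HasDerivAt θ (deriv θ τ) τ := (hθ.differentiable (by simp) τ).hasDerivAt
  have e1 : deriv (fun r => θ r • mapField ℓ (ψ x)) τ = deriv θ τ • mapField ℓ (ψ x) :=
    (e0.smul_const (mapField ℓ (ψ x))).deriv
  have e2 : ∫ r in Ioi τ, elasticOp (a (r - τ)) (b (r - τ)) (fun x => θ r • mapField ℓ (ψ x)) x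
      = (∫ r in Ioi τ, a (r - τ) * θ r) • mapField ℓ ((Δ ψ) x)
      + (∫ r in Ioi τ, (a (r - τ) + 2 * b (r - τ)) / 3 * θ r) • mapField ℓ (gradDiv ψ x) := by
    rw [← setIntegral_smul_add_smul (integrableOn_shift_mul ha hθ.continuous hc τ)
      (integrableOn_shift_mul hk hθ.continuous hc τ)]
    refine integral_congr_ae (Eventually.of_forall fun r => ?_)
    dsimp only
    rw [elasticOp_mapField, map_add, map_smul, map_smul, smul_add, smul_smul, smul_smul,
      mul_comm (θ r), mul_comm (θ r)]
  rw [e1, e2, elasticOp_mapField]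
  generalize (∫ r in Ioi τ, a (r - τ) * θ r) = I₁
  generalize (∫ r in Ioi τ, (a (r - τ) + 2 * b (r - τ)) / 3 * θ r) = I₂
  simp only [map_add, map_smul]
  generalize mapField ℓ (ψ x) = y₀
  generalize mapField ℓ ((Δ ψ) x) = y₁
  generalize mapField ℓ (gradDiv ψ x) = y₂
  module

lemma map_inner_toLp_linear (ℓ : ℂ →L[ℝ] ℝ) (w : Lp C3 2 (volume : Measure E3))
    (ψ₁ ψ₂ ψ₃ : 𝓢(E3, C3)) (c₁ c₂ c₃ : ℝ) :
    ℓ (inner ℂ w ((c₁ • ψ₁ + c₂ • ψ₂ + c₃ • ψ₃ : 𝓢(E3, C3)).toLp 2 volume))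
      = c₁ * ℓ (inner ℂ w (ψ₁.toLp 2)) + c₂ * ℓ (inner ℂ w (ψ₂.toLp 2))
        + c₃ * ℓ (inner ℂ w (ψ₃.toLp 2)) := by
  have hlin : (c₁ • ψ₁ + c₂ • ψ₂ + c₃ • ψ₃ : 𝓢(E3, C3)).toLp 2 (volume : Measure E3)
      = c₁ • ψ₁.toLp 2 volume + c₂ • ψ₂.toLp 2 volume + c₃ • ψ₃.toLp 2 volume := by
    have := map_add (SchwartzMap.toLpCLM ℝ C3 2 (volume : Measure E3)) (c₁ • ψ₁ + c₂ • ψ₂) (c₃ • ψ₃)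
    rw [map_add _ (c₁ • ψ₁), map_smul, map_smul, map_smul] at this
    exact this
  have hsm : ∀ (c : ℝ) (y : Lp C3 2 (volume : Measure E3)), inner ℂ w (c • y)
      = c • inner ℂ w y := fun c y => inner_smul_right_eq_smul ..
  rw [hlin, inner_add_right, inner_add_right, hsm, hsm, hsm, map_add, map_add, map_smul, map_smul,
    map_smul]
  rfl

/-- The integral equation for the pairing of the solution with a compactly supported field. -/
theorem SolvesWeakly.pairing_eq {a₀ b₀ : ℝ} {a b : ℝ → ℝ} {v₀ : E3 → E3} {v : ℝ → E3 → E3}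
    (hweak : SolvesWeakly a₀ b₀ a b v₀ v) (h0 : v 0 =ᵐ[volume] v₀)
    (ha : IntegrableOn a (Ioi 0)) (hb : IntegrableOn b (Ioi 0))
    {w : ℝ → Lp C3 2 (volume : Measure E3)} (hwc : Continuous w)
    (hw : ∀ t, 0 ≤ t → w t =ᵐ[volume] complexify (v t))
    (ψ : 𝓢(E3, C3)) (hψ : HasCompactSupport ψ) {t : ℝ} (ht : 0 ≤ t) (ℓ : ℂ →L[ℝ] ℝ) :
    ℓ (inner ℂ (w t) (ψ.toLp 2)) = ℓ (inner ℂ (w 0) (ψ.toLp 2))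
      + (∫ r in (0 : ℝ)..t, memoryKernel a₀ a (t - r) * ℓ (inner ℂ (w r) ((Δ ψ).toLp 2)))
      + ∫ r in (0 : ℝ)..t, memoryKernel ((a₀ + 2 * b₀) / 3) (fun r => (a r + 2 * b r) / 3) (t - r)
          * ℓ (inner ℂ (w r) ((gradDiv ψ).toLp 2)) := by
  have hk₂ : IntegrableOn (fun r => (a r + 2 * b r) / 3) (Ioi 0) := (ha.add (hb.const_mul 2)).div_const 3
  have hcont : ∀ ψ : 𝓢(E3, C3), Continuous fun t => ℓ (inner ℂ (w t) (ψ.toLp 2)) := fun ψ =>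
    ℓ.continuous.comp (hwc.inner continuous_const)
  refine volterra_of_weak ha hk₂ (hcont _) (hcont _) (hcont _) (fun θ hθ hc => ?_) ht
  -- Product test fields separate time from space and reduce the weak formulation to a scalar one in
  -- time.
  have hΦ := hweak (fun r x => θ r • mapField ℓ (ψ x)) ?_ ?_
  · have h2 : ∫ x : E3, ⟪v₀ x, θ 0 • mapField ℓ (ψ x)⟫ = θ 0 * ℓ (inner ℂ (w 0) (ψ.toLp 2)) := by
      rw [← map_inner_toLp_eq (hw 0 le_rfl), ← integral_const_mul]
      refine integral_congr_ae ?_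
      filter_upwards [h0] with x hx
      rw [hx, real_inner_smul_right]
    rw [h2] at hΦ
    refine Eq.trans (congrArg (· + _) ?_) hΦ
    refine setIntegral_congr_fun measurableSet_Ioi fun τ (hτ : 0 < τ) => ?_
    simp_rw [adjoint_mapField ha hk₂ ψ ℓ hθ hc τ]
    rw [← map_inner_toLp_linear]
    exact (map_inner_toLp_eq (hw τ hτ.le) ℓ _).symm
  · have h1 : ContDiff ℝ ∞ fun y : ℝ × E3 => θ y.1 := hθ.comp contDiff_fst
    have h2 : ContDiff ℝ ∞ fun y : ℝ × E3 => mapField ℓ (ψ y.2) :=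
      (mapField ℓ).contDiff.comp ((ψ.smooth ⊤).comp contDiff_snd)
    exact h1.smul h2
  · refine HasCompactSupport.intro (hc.isCompact.prod hψ.isCompact) fun y hy => ?_
    rw [mem_prod, not_and_or] at hy
    rcases hy with hy | hy
    · rw [image_eq_zero_of_notMem_tsupport hy, zero_smul]
    · rw [image_eq_zero_of_notMem_tsupport hy, map_zero, smul_zero]

/-! ### Density of compactly supported Schwartz functions -/

/-- The complement of a smooth cutoff grows at most linearly, with all its derivatives. -/
lemma exists_norm_iteratedFDeriv_one_sub_bump_le {E : Type*} [NormedAddCommGroup E]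
    [InnerProductSpace ℝ E] [FiniteDimensional ℝ E] (f : ContDiffBump (0 : E)) (i : ℕ) :
    ∃ C, 0 ≤ C ∧ ∀ x, ‖iteratedFDeriv ℝ i (fun x => f x - 1) x‖ ≤ C * ‖x‖ := by
  have hf : ContDiff ℝ ∞ f := f.contDiff
  obtain ⟨K, hK⟩ := (f.hasCompactSupport.iteratedFDeriv (𝕜 := ℝ) i).exists_bound_of_continuous
    (hf.continuous_iteratedFDeriv (mod_cast le_top))
  have hK0 : 0 ≤ K := (norm_nonneg _).trans (hK 0)
  have h1 : ∀ x, ‖iteratedFDeriv ℝ i (fun x => f x - 1) x‖ ≤ K + 1 := fun x => by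
    have e : (fun x => f x - 1) = (f : E → ℝ) - fun _ => 1 := rfl
    rw [e, iteratedFDeriv_sub_apply (hf.of_le (mod_cast le_top)).contDiffAt contDiffAt_const]
    refine (norm_sub_le _ _).trans (add_le_add (hK x) ?_)
    rcases i with _ | i
    · simp
    · rw [iteratedFDeriv_const_of_ne (by simp)]; simp
  refine ⟨(K + 1) / f.rIn, by have := f.rIn_pos; positivity, fun x => ?_⟩
  by_cases hx : ‖x‖ < f.rIn
  · have hev : (fun x => f x - 1) =ᶠ[𝓝 x] fun _ => (0 : ℝ) := by
      have hb : Metric.ball (0 : E) f.rIn ∈ 𝓝 x := Metric.isOpen_ball.mem_nhds (by simpa using hx)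
      filter_upwards [hb] with y hy
      rw [f.one_of_mem_closedBall (Metric.ball_subset_closedBall hy), sub_self]
    rw [(hev.iteratedFDeriv ℝ i).eq_of_nhds, iteratedFDeriv_fun_zero]
    have := f.rIn_pos
    simp only [Pi.zero_apply, norm_zero]
    positivity
  · refine (h1 x).trans ?_
    rw [div_mul_eq_mul_div, le_div_iff₀ f.rIn_pos]
    exact mul_le_mul_of_nonneg_left (not_lt.1 hx) (by positivity)

/-- Cut off by f(x/(n + 1)). The error f - 1 and its derivatives are at most a constant times the
norm of the argument, which yields a factor 1/(n + 1) at the price of one power of |x|, paid for by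
the next Schwartz seminorm. -/
theorem exists_tendsto_hasCompactSupport {E F : Type*} [NormedAddCommGroup E]
    [InnerProductSpace ℝ E] [FiniteDimensional ℝ E] [NormedAddCommGroup F] [NormedSpace ℝ F]
    (ψ : 𝓢(E, F)) : ∃ u : ℕ → 𝓢(E, F),
      (∀ n, HasCompactSupport (u n)) ∧ Tendsto u atTop (𝓝 ψ) := by
  let f : ContDiffBump (0 : E) := ⟨1, 2, one_pos, one_lt_two⟩
  have hf : ContDiff ℝ ∞ f := f.contDiff
  have hn : ∀ n : ℕ, ((n : ℝ) + 1)⁻¹ ≠ 0 := fun n => by positivity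
  have hsm : ∀ n : ℕ, ContDiff ℝ ∞ fun x => f (((n : ℝ) + 1)⁻¹ • x) := fun n =>
    hf.comp (contDiff_const_smul _)
  have hcs : ∀ n : ℕ, HasCompactSupport fun x => f (((n : ℝ) + 1)⁻¹ • x) • ψ x := fun n =>
    HasCompactSupport.smul_right (f.hasCompactSupport.comp_smul (hn n))
  refine ⟨fun n => (hcs n).toSchwartzMap ((hsm n).smul (ψ.smooth ⊤)), hcs, ?_⟩
  rw [(schwartz_withSeminorms ℝ E F).tendsto_nhds]
  rintro ⟨k, l⟩ ε hε
  choose C hC0 hC using exists_norm_iteratedFDeriv_one_sub_bump_le f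
  set K := ∑ i ∈ Finset.range (l + 1), (l.choose i : ℝ) * C i * SchwartzMap.seminorm ℝ (k + 1) (l - i) ψ
    with hK
  have hK0 : 0 ≤ K := Finset.sum_nonneg fun i _ =>
    mul_nonneg (mul_nonneg (by positivity) (hC0 i)) (apply_nonneg _ _)
  have hbound : ∀ n : ℕ, SchwartzMap.seminorm ℝ k l
      ((hcs n).toSchwartzMap ((hsm n).smul (ψ.smooth ⊤)) - ψ) ≤ ((n : ℝ) + 1)⁻¹ * K := by
    intro n
    refine SchwartzMap.seminorm_le_bound ℝ k l _ (by positivity) fun x => ?_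
    have e : (⇑((hcs n).toSchwartzMap ((hsm n).smul (ψ.smooth ⊤)) - ψ) : E → F)
        = fun x => (f (((n : ℝ) + 1)⁻¹ • x) - 1) • ψ x := by
      ext y
      simp [sub_smul]
    have hsm1 : ContDiff ℝ ∞ fun x => f x - 1 := hf.sub contDiff_const
    have hsm2 : ContDiff ℝ ∞ fun x => f (((n : ℝ) + 1)⁻¹ • x) - 1 := (hsm n).sub contDiff_const
    rw [e]
    have hD : ∀ i, ‖iteratedFDeriv ℝ i (fun x => f (((n : ℝ) + 1)⁻¹ • x) - 1) x‖
        ≤ ((n : ℝ) + 1)⁻¹ * (C i * ‖x‖) := by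
      intro i
      have h := congrFun (iteratedFDeriv_comp_const_smul (i := i) (((n : ℝ) + 1)⁻¹)
        (hsm1.of_le (mod_cast le_top))) x
      rw [h, norm_smul, norm_pow, Real.norm_of_nonneg (by positivity)]
      have h2 := hC i (((n : ℝ) + 1)⁻¹ • x)
      rw [norm_smul, Real.norm_of_nonneg (by positivity)] at h2
      have h3 : ((n : ℝ) + 1)⁻¹ ^ i ≤ 1 := pow_le_one₀ (by positivity)
        (inv_le_one_of_one_le₀ (by simp))
      calc _ ≤ 1 * (C i * (((n : ℝ) + 1)⁻¹ * ‖x‖)) := by gcongr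
        _ = _ := by ring
    calc ‖x‖ ^ k * ‖iteratedFDeriv ℝ l (fun x => (f (((n : ℝ) + 1)⁻¹ • x) - 1) • ψ x) x‖
        ≤ ‖x‖ ^ k * ∑ i ∈ Finset.range (l + 1), (l.choose i : ℝ)
          * ‖iteratedFDeriv ℝ i (fun x => f (((n : ℝ) + 1)⁻¹ • x) - 1) x‖
          * ‖iteratedFDeriv ℝ (l - i) ψ x‖ := by
          gcongr
          exact norm_iteratedFDeriv_smul_le hsm2 (ψ.smooth ⊤) x (mod_cast le_top)
      _ ≤ ‖x‖ ^ k * ∑ i ∈ Finset.range (l + 1), (l.choose i : ℝ)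
          * (((n : ℝ) + 1)⁻¹ * (C i * ‖x‖)) * ‖iteratedFDeriv ℝ (l - i) ψ x‖ := by
          gcongr with i hi
          exact hD i
      _ = ((n : ℝ) + 1)⁻¹ * ∑ i ∈ Finset.range (l + 1), (l.choose i : ℝ) * C i
          * (‖x‖ ^ (k + 1) * ‖iteratedFDeriv ℝ (l - i) ψ x‖) := by
          rw [Finset.mul_sum, Finset.mul_sum]
          exact Finset.sum_congr rfl fun i _ => by ring
      _ ≤ ((n : ℝ) + 1)⁻¹ * K := by
          rw [hK]
          gcongr with i hi
          · exact mul_nonneg (by positivity) (hC0 i)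
          · exact SchwartzMap.le_seminorm ℝ (k + 1) (l - i) ψ x
  have hlim : Tendsto (fun n : ℕ => ((n : ℝ) + 1)⁻¹ * K) atTop (𝓝 (0 * K)) :=
    (tendsto_inv_atTop_zero.comp (tendsto_natCast_atTop_atTop.atTop_add tendsto_const_nhds)).mul_const K
  rw [zero_mul] at hlim
  filter_upwards [hlim.eventually (gt_mem_nhds hε)] with n hn
  exact (hbound n).trans_lt hn

/-! ### Fourier transforms of the differential operators -/

lemma fourier_postcomp {F G : Type*} [NormedAddCommGroup F] [NormedSpace ℂ F] [CompleteSpace F]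
    [NormedAddCommGroup G] [NormedSpace ℂ G] [CompleteSpace G] (L : F →L[ℂ] G) (f : 𝓢(E3, F))
    (η : E3) : 𝓕 (SchwartzMap.postcompCLM L f) η = L (𝓕 f η) := by
  rw [SchwartzMap.fourier_coe, SchwartzMap.fourier_coe, Real.fourier_eq, Real.fourier_eq,
    ← L.integral_comp_comm]
  · refine integral_congr_ae (Eventually.of_forall fun x => ?_)
    simp only [SchwartzMap.postcompCLM_apply, Circle.smul_def, map_smul]
  · exact (Real.fourierIntegral_convergent_iff η).2 f.integrable

lemma fourier_lineDeriv_apply {F : Type*} [NormedAddCommGroup F] [NormedSpace ℂ F]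
    [CompleteSpace F] (f : 𝓢(E3, F)) (m η : E3) :
    𝓕 (∂_{m} f : 𝓢(E3, F)) η = (2 * Real.pi * Complex.I * (⟪η, m⟫ : ℝ) : ℂ) • 𝓕 f η := by
  rw [SchwartzMap.fourier_lineDerivOp_eq, smul_apply,
    SchwartzMap.smulLeftCLM_apply_apply (by fun_prop), ← Complex.coe_smul, smul_smul]

lemma fourier_divSchwartz (ψ : 𝓢(E3, C3)) (η : E3) :
    𝓕 (divSchwartz ψ) η = ∑ j, 2 * Real.pi * Complex.I * (η j : ℂ) * 𝓕 ψ η j := by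
  have h : (𝓕 (divSchwartz ψ) : 𝓢(E3, ℂ)) = ∑ j : Fin 3, (𝓕 (∂_{basisVec j}
      (SchwartzMap.postcompCLM (EuclideanSpace.proj j : C3 →L[ℂ] ℂ) ψ)) : 𝓢(E3, ℂ)) := by
    rw [divSchwartz, _root_.sum_apply, FourierTransform.fourier_sum]
    rfl
  rw [h, _root_.sum_apply]
  refine Finset.sum_congr rfl fun j _ => ?_
  rw [fourier_lineDeriv_apply, fourier_postcomp, EuclideanSpace.inner_single_right]
  simp

lemma fourier_gradDiv (ψ : 𝓢(E3, C3)) (η : E3) (i : Fin 3) :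
    𝓕 (gradDiv ψ) η i = -((2 * Real.pi) ^ 2 * (η i : ℂ) * ∑ j, (η j : ℂ) * 𝓕 ψ η j) := by
  have h : (𝓕 (gradDiv ψ) : 𝓢(E3, C3)) = ∑ i : Fin 3, (𝓕 (SchwartzMap.postcompCLM
      ((ContinuousLinearMap.id ℂ ℂ).smulRight (EuclideanSpace.single i (1 : ℂ) : C3))
      (∂_{basisVec i} (divSchwartz ψ))) : 𝓢(E3, C3)) := by
    rw [gradDiv, _root_.sum_apply, FourierTransform.fourier_sum]
    rfl
  rw [h, _root_.sum_apply]
  simp_rw [fourier_postcomp, fourier_lineDeriv_apply, fourier_divSchwartz,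
    EuclideanSpace.inner_single_right]
  rw [WithLp.ofLp_sum, Finset.sum_apply]
  simp [Finset.sum_ite_eq]
  simp_rw [Finset.mul_sum, ← Finset.sum_neg_distrib]
  refine Finset.sum_congr rfl fun j _ => ?_
  linear_combination (4 * Real.pi ^ 2 * η i * η j * 𝓕 ψ η j : ℂ) * Complex.I_sq

lemma fourier_laplacian (ψ : 𝓢(E3, C3)) (η : E3) :
    𝓕 (Δ ψ) η = (-‖(2 * Real.pi) • η‖ ^ 2 : ℝ) • 𝓕 ψ η := by
  have h : 𝓕 (Δ ψ) = (-(2 * Real.pi) ^ 2 : ℝ) • SchwartzMap.smulLeftCLM C3 (fun x : E3 => ‖x‖ ^ 2) (𝓕 ψ) := by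
    rw [SchwartzMap.laplacian_eq_fourierMultiplierCLM, SchwartzMap.fourierMultiplierCLM_apply,
      FourierTransform.fourier_smul, FourierTransform.fourier_fourierInv_eq]
  rw [h, smul_apply, SchwartzMap.smulLeftCLM_apply_apply (by fun_prop), norm_smul,
    smul_smul]
  congr 1
  rw [Real.norm_of_nonneg (by positivity)]
  ring

/-! ### Uniqueness for families of scalar Volterra equations -/

lemma norm_pow_smul_le {X : Type*} {lam : X → ℝ} {h : X → ℂ} {R : ℝ} (h0 : ∀ x, 0 ≤ lam x)
    (hR : ∀ x, h x ≠ 0 → lam x ≤ R) (j : ℕ) (x : X) :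
    ‖lam x ^ j • h x‖ ≤ R ^ j * ‖h x‖ := by
  rw [norm_smul, norm_pow, Real.norm_of_nonneg (h0 x)]
  by_cases hx : h x = 0
  · simp [hx]
  · have := hR x hx
    have := h0 x
    gcongr

lemma norm_resolvent_smul_le {N : ℝ → ℝ} {M : ℝ} {X : Type*} {lam : X → ℝ} {h : X → ℂ} {R : ℝ}
    (hM : ∀ t, |N t| ≤ M) (h0 : ∀ x, 0 ≤ lam x)
    (hR : ∀ x, h x ≠ 0 → lam x ≤ R) (j : ℕ) {t T : ℝ} (ht : 0 ≤ t) (htT : t ≤ T) (x : X) :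
    ‖resolvent N t (lam x) • lam x ^ j • h x‖ ≤ Real.exp (R * T * M) * (R ^ j * ‖h x‖) := by
  by_cases hx : h x = 0
  · simp [hx]
  · have hM0 : 0 ≤ M := (abs_nonneg _).trans (hM 0)
    have h1 := hR x hx
    have h2 := h0 x
    rw [norm_smul]
    refine mul_le_mul ?_ (norm_pow_smul_le h0 hR j x) (norm_nonneg _) (Real.exp_pos _).le
    refine (abs_resolvent_le hM t (lam x)).trans ?_
    rw [abs_of_nonneg (by positivity)]
    have : 0 ≤ R := h2.trans h1
    gcongr

section VolterraFamily

variable {N : ℝ → ℝ} {M : ℝ} {X : Type*} [MeasurableSpace X] {μ : Measure X}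
  {lam : X → ℝ} {h : X → ℂ} {R : ℝ}

lemma integrable_pow_smul (hlam : Measurable lam) (h0 : ∀ x, 0 ≤ lam x) (hh : Integrable h μ)
    (hR : ∀ x, h x ≠ 0 → lam x ≤ R) (j : ℕ) : Integrable (fun x => lam x ^ j • h x) μ :=
  (hh.norm.const_mul (R ^ j)).mono'
    ((hlam.pow_const j).aestronglyMeasurable.smul hh.aestronglyMeasurable)
    (Eventually.of_forall fun x => norm_pow_smul_le h0 hR j x)

/-- The superposition of resolvents solves a chain of Volterra equations. -/
lemma integral_resolvent_smul_eq [SFinite μ] (hN : Continuous N) (hM : ∀ t, |N t| ≤ M)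
    (hlam : Measurable lam) (h0 : ∀ x, 0 ≤ lam x) (hh : Integrable h μ)
    (hR : ∀ x, h x ≠ 0 → lam x ≤ R) (j : ℕ) {t : ℝ} (ht : 0 ≤ t) :
    IntervalIntegrable (fun r => N (t - r) • ∫ x, resolvent N r (lam x) • lam x ^ (j + 1) • h x ∂μ)
      volume 0 t ∧
    ∫ x, resolvent N t (lam x) • lam x ^ j • h x ∂μ = (∫ x, lam x ^ j • h x ∂μ)
      - ∫ r in (0 : ℝ)..t, N (t - r) • ∫ x, resolvent N r (lam x) • lam x ^ (j + 1) • h x ∂μ := by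
  have hM0 : 0 ≤ M := (abs_nonneg _).trans (hM 0)
  set f : ℝ → X → ℂ := fun r x => N (t - r) • resolvent N r (lam x) • lam x ^ (j + 1) • h x with hf
  have hmeas : AEStronglyMeasurable (Function.uncurry f) ((volume.restrict (Ioc 0 t)).prod μ) := by
    have m1 : Measurable fun z : ℝ × X => N (t - z.1) := hN.measurable.comp (by fun_prop)
    have m2 : Measurable fun z : ℝ × X => resolvent N z.1 (lam z.2) :=
      (continuous_resolvent hN hM).measurable.comp
        (measurable_fst.prodMk (hlam.comp measurable_snd))
    have m3 : AEStronglyMeasurable (fun z : ℝ × X => h z.2) ((volume.restrict (Ioc 0 t)).prod μ) :=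
      hh.aestronglyMeasurable.comp_snd
    exact m1.aestronglyMeasurable.smul (m2.aestronglyMeasurable.smul
      (((hlam.comp measurable_snd).pow_const _).aestronglyMeasurable.smul m3))
  have hint : Integrable (Function.uncurry f) ((volume.restrict (Ioc 0 t)).prod μ) := by
    refine Integrable.mono' ((hh.norm.const_mul (M * (Real.exp (R * t * M) * R ^ (j + 1)))).comp_snd _)
      hmeas ?_
    have hb : ∀ᵐ r ∂(volume.restrict (Ioc (0 : ℝ) t)), r ∈ Ioc (0 : ℝ) t :=
      ae_restrict_mem measurableSet_Ioc
    filter_upwards [Measure.quasiMeasurePreserving_fst.ae hb] with z hz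
    have h1 := norm_resolvent_smul_le hM h0 hR (j + 1) hz.1.le hz.2 z.2
    have : ‖Function.uncurry f z‖ ≤ M * (Real.exp (R * t * M) * (R ^ (j + 1) * ‖h z.2‖)) := by
      simp only [Function.uncurry, hf]
      rw [norm_smul]
      exact mul_le_mul (hM _) h1 (norm_nonneg _) hM0
    refine this.trans (le_of_eq (by ring))
  have hfr : ∀ r, ∫ x, f r x ∂μ = N (t - r) • ∫ x, resolvent N r (lam x) • lam x ^ (j + 1) • h x ∂μ :=
    fun r => integral_smul _ _
  have hswap : ∫ r in (0 : ℝ)..t, N (t - r) • ∫ x, resolvent N r (lam x) • lam x ^ (j + 1) • h x ∂μ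
      = ∫ x, (∫ r in (0 : ℝ)..t, f r x) ∂μ := by
    simp_rw [← hfr, intervalIntegral.integral_of_le ht]
    exact integral_integral_swap hint
  have hswapint : Integrable (fun x => ∫ r in (0 : ℝ)..t, f r x) μ := by
    simp_rw [intervalIntegral.integral_of_le ht]
    exact hint.integral_prod_right
  refine ⟨?_, ?_⟩
  · rw [intervalIntegrable_iff_integrableOn_Ioc_of_le ht]
    have := hint.integral_prod_left
    simp only [Function.uncurry, hfr] at this
    exact this
  · rw [hswap, ← integral_sub (integrable_pow_smul hlam h0 hh hR j) hswapint]
    refine integral_congr_ae (Eventually.of_forall fun x => ?_)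
    have e : ∀ r, f r x = (N (t - r) * resolvent N r (lam x)) • lam x ^ (j + 1) • h x := fun r => by
      simp only [hf, smul_smul]; ring_nf
    simp only [e]
    rw [intervalIntegral.integral_smul_const, resolvent_eq hN hM t (lam x), sub_smul, one_smul,
      smul_smul, smul_smul]
    congr 2
    rw [pow_succ]
    ring

/-- Moments of a curve that solve the chain of Volterra equations are those of the resolvents. -/
theorem eq_integral_resolvent_smul [SFinite μ] (hN : Continuous N) (hM : ∀ t, |N t| ≤ M)
    (hlam : Measurable lam) (h0 : ∀ x, 0 ≤ lam x) (hh : Integrable h μ) 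
    (hR : ∀ x, h x ≠ 0 → lam x ≤ R) {P : ℕ → ℝ → ℂ} (hP : ∀ j, Continuous (P j))
    (heq : ∀ j t, 0 ≤ t → P j t = (∫ x, lam x ^ j • h x ∂μ)
      - ∫ r in (0 : ℝ)..t, N (t - r) • P (j + 1) r)
    {B T : ℝ} (hT : 0 ≤ T) (hB : ∀ j t, 0 ≤ t → t ≤ T → ‖P j t‖ ≤ B * R ^ j) :
    P 0 T = ∫ x, resolvent N T (lam x) • h x ∂μ := by
  have hM0 : 0 ≤ M := (abs_nonneg _).trans (hM 0)
  set F : ℕ → ℝ → ℂ := fun j t => ∫ x, resolvent N t (lam x) • lam x ^ j • h x ∂μ with hF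
  set C := B + Real.exp (R * T * M) * ∫ x, ‖h x‖ ∂μ with hC
  have hFb : ∀ j t, 0 ≤ t → t ≤ T → ‖F j t‖ ≤ Real.exp (R * T * M) * (∫ x, ‖h x‖ ∂μ) * R ^ j := by
    intro j t ht htT
    have := norm_integral_le_of_norm_le (μ := μ) (hh.norm.const_mul (Real.exp (R * T * M) * R ^ j))
      (Eventually.of_forall fun x => (norm_resolvent_smul_le hM h0 hR j ht htT x).trans
        (le_of_eq (mul_assoc _ _ _).symm))
    rw [integral_const_mul] at this
    refine this.trans (le_of_eq (by ring))
  have hdiff : ∀ j t, 0 ≤ t → P j t - F j t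
      = -∫ r in (0 : ℝ)..t, N (t - r) • (P (j + 1) r - F (j + 1) r) := by
    intro j t ht
    obtain ⟨i1, e1⟩ := integral_resolvent_smul_eq hN hM hlam h0 hh hR j ht
    have i2 : IntervalIntegrable (fun r => N (t - r) • P (j + 1) r) volume 0 t :=
      ((hN.comp (continuous_const.sub continuous_id)).smul (hP (j + 1))).intervalIntegrable _ _
    have e2 : ∫ r in (0 : ℝ)..t, N (t - r) • (P (j + 1) r - F (j + 1) r)
        = (∫ r in (0 : ℝ)..t, N (t - r) • P (j + 1) r)
          - ∫ r in (0 : ℝ)..t, N (t - r) • F (j + 1) r := by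
      rw [← intervalIntegral.integral_sub i2 i1]
      simp only [smul_sub]
      rfl
    rw [e2, heq j t ht, show F j t = _ from e1]
    ring
  -- Iterating the homogeneous chain m times raises the moment index by m, which costs Rᵐ, while m
  -- nested integrations give (Mt)ᵐ/m!. As m is arbitrary, the difference vanishes.
  have hiter : ∀ m j t, 0 ≤ t → t ≤ T →
      ‖P j t - F j t‖ ≤ C * R ^ j * ((R * M * t) ^ m / m.factorial) := by
    intro m
    induction m with
    | zero =>
      intro j t ht htT
      refine (norm_sub_le _ _).trans ((add_le_add (hB j t ht htT) (hFb j t ht htT)).trans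
        (le_of_eq ?_))
      simp [hC]; ring
    | succ m ih =>
      intro j t ht htT
      rw [hdiff j t ht, norm_neg]
      have hb : ∀ r ∈ Ioc 0 t, ‖N (t - r) • (P (j + 1) r - F (j + 1) r)‖
          ≤ M * (C * R ^ (j + 1) * ((R * M) ^ m / m.factorial)) * r ^ m := by
        intro r hr
        rw [norm_smul]
        refine (mul_le_mul (hM _) (ih (j + 1) r hr.1.le (hr.2.trans htT)) (norm_nonneg _)
          hM0).trans (le_of_eq ?_)
        rw [mul_pow]; ring
      refine (intervalIntegral.norm_integral_le_of_norm_le ht (Eventually.of_forall hb)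
        (Continuous.intervalIntegrable (by fun_prop) _ _)).trans (le_of_eq ?_)
      rw [intervalIntegral.integral_const_mul, integral_pow, Nat.factorial_succ]
      push_cast
      have : (m.factorial : ℝ) ≠ 0 := by positivity
      field_simp
      ring
  have hlim : Tendsto (fun m : ℕ => C * R ^ 0 * ((R * M * T) ^ m / m.factorial)) atTop (𝓝 0) := by
    have := (FloorSemiring.tendsto_pow_div_factorial_atTop (R * M * T)).const_mul (C * R ^ 0)
    rwa [mul_zero] at this
  have hz : ‖P 0 T - F 0 T‖ ≤ 0 :=
    ge_of_tendsto hlim (Eventually.of_forall fun m => hiter m 0 T hT le_rfl)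
  rw [norm_le_zero_iff, sub_eq_zero] at hz
  rw [hz]
  simp [hF]

end VolterraFamily

/-! ### The integral equation tested against Schwartz fields -/

lemma intervalIntegral_smul_inner {H : Type*} [NormedAddCommGroup H] [InnerProductSpace ℂ H]
    [NormedSpace ℝ H] [IsScalarTower ℝ ℂ H] [CompleteSpace H] {N : ℝ → ℝ} (hN : Continuous N)
    {w : ℝ → H} (hw : Continuous w) (c : H) (a b t : ℝ) :
    ∫ r in a..b, N (t - r) • inner ℂ (w r) c = inner ℂ (∫ r in a..b, N (t - r) • w r) c := by
  have hf : IntervalIntegrable (fun r => N (t - r) • w r) volume a b :=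
    ((hN.comp (continuous_const.sub continuous_id)).smul hw).intervalIntegrable a b
  have h := ContinuousLinearMap.intervalIntegral_comp_comm
    ((Complex.conjCLE : ℂ →L[ℝ] ℂ).comp ((innerSL ℂ c).restrictScalars ℝ)) hf
  simpa using h

lemma eq_of_forall_functional {N₁ N₂ : ℝ → ℝ} (hN₁ : Continuous N₁) (hN₂ : Continuous N₂)
    {p₁ p₂ : ℝ → ℂ} (hp₁ : Continuous p₁) (hp₂ : Continuous p₂) {z z₀ : ℂ} {t : ℝ}
    (h : ∀ ℓ : ℂ →L[ℝ] ℝ, ℓ z = ℓ z₀ + (∫ r in (0 : ℝ)..t, N₁ (t - r) * ℓ (p₁ r))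
      + ∫ r in (0 : ℝ)..t, N₂ (t - r) * ℓ (p₂ r)) :
    z = z₀ + (∫ r in (0 : ℝ)..t, N₁ (t - r) • p₁ r) + ∫ r in (0 : ℝ)..t, N₂ (t - r) • p₂ r := by
  have hi : ∀ {N : ℝ → ℝ} {p : ℝ → ℂ}, Continuous N → Continuous p →
      IntervalIntegrable (fun r => N (t - r) • p r) volume 0 t := fun hN hp =>
    ((hN.comp (continuous_const.sub continuous_id)).smul hp).intervalIntegrable 0 t
  have hℓ : ∀ ℓ : ℂ →L[ℝ] ℝ, ℓ z = ℓ (z₀ + (∫ r in (0 : ℝ)..t, N₁ (t - r) • p₁ r)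
      + ∫ r in (0 : ℝ)..t, N₂ (t - r) • p₂ r) := by
    intro ℓ
    rw [h ℓ, map_add, map_add, ← ContinuousLinearMap.intervalIntegral_comp_comm ℓ (hi hN₁ hp₁),
      ← ContinuousLinearMap.intervalIntegral_comp_comm ℓ (hi hN₂ hp₂)]
    simp only [map_smul, smul_eq_mul]
  exact Complex.ext (hℓ Complex.reCLM) (hℓ Complex.imCLM)

lemma eq_of_eq_on_hasCompactSupport {f g : 𝓢(E3, C3) → ℂ} (hf : Continuous f) (hg : Continuous g)
    (h : ∀ ψ : 𝓢(E3, C3), HasCompactSupport ψ → f ψ = g ψ) (ψ : 𝓢(E3, C3)) : f ψ = g ψ := by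
  obtain ⟨u, hu, hlim⟩ := exists_tendsto_hasCompactSupport ψ
  refine tendsto_nhds_unique ((hf.tendsto ψ).comp hlim) ?_
  have e : f ∘ u = g ∘ u := funext fun n => h (u n) (hu n)
  rw [e]
  exact (hg.tendsto ψ).comp hlim

lemma continuous_toLp {p : ℝ≥0∞} [Fact (1 ≤ p)] :
    Continuous fun ψ : 𝓢(E3, C3) => ψ.toLp p (volume : Measure E3) :=
  (SchwartzMap.toLpCLM ℂ C3 p (volume : Measure E3)).continuous

lemma continuous_laplacian : Continuous fun ψ : 𝓢(E3, C3) => Δ ψ :=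
  (LineDeriv.laplacianCLM ℝ E3 𝓢(E3, C3)).continuous

/-- Moving the time integral into the first slot of the inner product leaves a fixed vector of L²,
so only the continuity of ψ ↦ Dψ in L² is needed. -/
lemma continuous_pairing_memory {N : ℝ → ℝ} (hN : Continuous N)
    {w : ℝ → Lp C3 2 (volume : Measure E3)} (hw : Continuous w) {D : 𝓢(E3, C3) → 𝓢(E3, C3)}
    (hD : Continuous D) (t : ℝ) :
    Continuous fun ψ => ∫ r in (0 : ℝ)..t, N (t - r) • inner ℂ (w r) ((D ψ).toLp 2) := by
  simp only [intervalIntegral_smul_inner hN hw]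
  exact continuous_const.inner (continuous_toLp.comp hD)

lemma pairing_of_forall_hasCompactSupport {N₁ N₂ : ℝ → ℝ} (hN₁ : Continuous N₁)
    (hN₂ : Continuous N₂) {w : ℝ → Lp C3 2 (volume : Measure E3)} (hw : Continuous w)
    {D₁ D₂ : 𝓢(E3, C3) → 𝓢(E3, C3)} (hD₁ : Continuous D₁) (hD₂ : Continuous D₂) {t : ℝ}
    (h : ∀ ψ : 𝓢(E3, C3), HasCompactSupport ψ → ∀ ℓ : ℂ →L[ℝ] ℝ,
      ℓ (inner ℂ (w t) (ψ.toLp 2)) = ℓ (inner ℂ (w 0) (ψ.toLp 2))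
        + (∫ r in (0 : ℝ)..t, N₁ (t - r) * ℓ (inner ℂ (w r) ((D₁ ψ).toLp 2)))
        + ∫ r in (0 : ℝ)..t, N₂ (t - r) * ℓ (inner ℂ (w r) ((D₂ ψ).toLp 2))) (ψ : 𝓢(E3, C3)) :
    inner ℂ (w t) (ψ.toLp 2) = inner ℂ (w 0) (ψ.toLp 2)
      + (∫ r in (0 : ℝ)..t, N₁ (t - r) • inner ℂ (w r) ((D₁ ψ).toLp 2))
      + ∫ r in (0 : ℝ)..t, N₂ (t - r) • inner ℂ (w r) ((D₂ ψ).toLp 2) := by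
  have hL : ∀ t, Continuous fun ψ : 𝓢(E3, C3) => inner ℂ (w t) (ψ.toLp 2 (volume : Measure E3)) :=
    fun t => continuous_const.inner continuous_toLp
  have hR := ((hL 0).add (continuous_pairing_memory hN₁ hw hD₁ t)).add
    (continuous_pairing_memory hN₂ hw hD₂ t)
  have hp : ∀ y : Lp C3 2 (volume : Measure E3), Continuous fun r => inner ℂ (w r) y := fun y =>
    hw.inner continuous_const
  exact eq_of_eq_on_hasCompactSupport (hL t) hR (fun ψ hψ =>
    eq_of_forall_functional hN₁ hN₂ (hp _) (hp _) (h ψ hψ)) ψ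

/-- The weak formulation, integrated in time, in `L²` and tested against Schwartz fields. -/
theorem SolvesWeakly.pairing_schwartz {a₀ b₀ : ℝ} {a b : ℝ → ℝ} {v₀ : E3 → E3} {v : ℝ → E3 → E3}
    (hweak : SolvesWeakly a₀ b₀ a b v₀ v) (h0 : v 0 =ᵐ[volume] v₀)
    (ha : IntegrableOn a (Ioi 0)) (hb : IntegrableOn b (Ioi 0))
    {w : ℝ → Lp C3 2 (volume : Measure E3)} (hwc : Continuous w)
    (hw : ∀ t, 0 ≤ t → w t =ᵐ[volume] complexify (v t))
    (ψ : 𝓢(E3, C3)) {t : ℝ} (ht : 0 ≤ t) :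
    inner ℂ (w t) (ψ.toLp 2) = inner ℂ (w 0) (ψ.toLp 2)
      + (∫ r in (0 : ℝ)..t, memoryKernel a₀ a (t - r) • inner ℂ (w r) ((Δ ψ).toLp 2))
      + ∫ r in (0 : ℝ)..t, memoryKernel ((a₀ + 2 * b₀) / 3) (fun r => (a r + 2 * b r) / 3) (t - r)
          • inner ℂ (w r) ((gradDiv ψ).toLp 2) := by
  have hk₂ : IntegrableOn (fun r => (a r + 2 * b r) / 3) (Ioi 0) :=
    (ha.add (hb.const_mul 2)).div_const 3
  have hN₁ := continuous_memoryKernel (c := a₀) ha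
  have hN₂ := continuous_memoryKernel (c := (a₀ + 2 * b₀) / 3) hk₂
  have hpair := fun (ψ : 𝓢(E3, C3)) (hψ : HasCompactSupport ψ) (ℓ : ℂ →L[ℝ] ℝ) =>
    hweak.pairing_eq h0 ha hb hwc hw ψ hψ ht ℓ
  exact pairing_of_forall_hasCompactSupport hN₁ hN₂ hwc continuous_laplacian gradDiv.continuous
    hpair ψ

/-! ### Test fields in frequency space -/

/-- The squared angular frequency `|2πη|²`. -/
def freq (η : E3) : ℝ := ‖(2 * Real.pi) • η‖ ^ 2

lemma freq_nonneg (η : E3) : 0 ≤ freq η := sq_nonneg _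

lemma contDiff_freq : ContDiff ℝ ∞ freq := (contDiff_const_smul _).norm_sq ℝ

lemma freq_eq (η : E3) : freq η = (2 * Real.pi) ^ 2 * ‖η‖ ^ 2 := by
  rw [freq, norm_smul, mul_pow, Real.norm_of_nonneg (by positivity)]

/-- The Schwartz field `g d` of a test function `g` and a linear field `d`. -/
def freqField (d : E3 →L[ℝ] C3) (g : E3 → ℝ) (hg : ContDiff ℝ ∞ g) (hc : HasCompactSupport g) :
    𝓢(E3, C3) :=
  HasCompactSupport.toSchwartzMap (f := fun η => g η • d η) hc.smul_right (hg.smul d.contDiff)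

lemma freqField_apply (d : E3 →L[ℝ] C3) (g : E3 → ℝ) (hg : ContDiff ℝ ∞ g)
    (hc : HasCompactSupport g) (η : E3) : freqField d g hg hc η = g η • d η := rfl

lemma contDiff_freq_pow_mul {g : E3 → ℝ} (hg : ContDiff ℝ ∞ g) (j : ℕ) :
    ContDiff ℝ ∞ fun η => freq η ^ j * g η := (contDiff_freq.pow j).mul hg

lemma hasCompactSupport_freq_pow_mul {g : E3 → ℝ} (hc : HasCompactSupport g) (j : ℕ) :
    HasCompactSupport fun η => freq η ^ j * g η := hc.mul_left

lemma memoryKernel_add_mul {c₁ c₂ : ℝ} {k₁ k₂ : ℝ → ℝ} (hk₁ : IntegrableOn k₁ (Ioi 0))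
    (hk₂ : IntegrableOn k₂ (Ioi 0)) (ε t : ℝ) :
    memoryKernel (c₁ + ε * c₂) (fun r => k₁ r + ε * k₂ r) t
      = memoryKernel c₁ k₁ t + ε * memoryKernel c₂ k₂ t := by
  have e : ∀ r, (Ioi (0 : ℝ)).indicator (fun r => k₁ r + ε * k₂ r) r
      = (Ioi (0 : ℝ)).indicator k₁ r + ε * (Ioi (0 : ℝ)).indicator k₂ r := fun r => by
    by_cases hr : r ∈ Ioi (0 : ℝ) <;> simp [hr]
  simp only [memoryKernel, e]
  rw [intervalIntegral.integral_add (integrable_indicator_Ioi hk₁).intervalIntegrable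
    ((integrable_indicator_Ioi hk₂).const_mul ε).intervalIntegrable,
    intervalIntegral.integral_const_mul]
  ring

lemma inner_toLp_eq_inner_fourier (w : Lp C3 2 (volume : Measure E3)) (ψ : 𝓢(E3, C3)) :
    inner ℂ w (ψ.toLp 2) = inner ℂ (𝓕 w : Lp C3 2 (volume : Measure E3)) ((𝓕 ψ).toLp 2) := by
  rw [← SchwartzMap.toLp_fourier_eq, Lp.inner_fourier_eq]

lemma inner_freqField (W : Lp C3 2 (volume : Measure E3)) (d : E3 →L[ℝ] C3) (g : E3 → ℝ)
    (hg : ContDiff ℝ ∞ g) (hc : HasCompactSupport g) :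
    Integrable (fun η => g η • inner ℂ (W η) (d η)) ∧
    inner ℂ W ((freqField d g hg hc).toLp 2) = ∫ η, g η • inner ℂ (W η) (d η) := by
  have e : (fun η => inner ℂ (W η) ((freqField d g hg hc).toLp 2 volume η))
      =ᵐ[volume] fun η => g η • inner ℂ (W η) (d η) := by
    filter_upwards [(freqField d g hg hc).coeFn_toLp 2 volume] with η hη
    rw [hη, freqField_apply, inner_smul_right_eq_smul]
  exact ⟨(L2.integrable_inner (𝕜 := ℂ) W _).congr e, by rw [L2.inner_def, integral_congr_ae e]⟩

/-- Along a linear field of eigenvectors of `η ηᵀ`, the Fourier transform of the solution is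
propagated by a scalar resolvent. -/
theorem SolvesWeakly.inner_fourier_ae {a₀ b₀ : ℝ} {a b : ℝ → ℝ} {v₀ : E3 → E3} {v : ℝ → E3 → E3}
    (hweak : SolvesWeakly a₀ b₀ a b v₀ v) (h0 : v 0 =ᵐ[volume] v₀)
    (ha : IntegrableOn a (Ioi 0)) (hb : IntegrableOn b (Ioi 0))
    {w : ℝ → Lp C3 2 (volume : Measure E3)} (hwc : Continuous w)
    (hw : ∀ t, 0 ≤ t → w t =ᵐ[volume] complexify (v t))
    (d : E3 →L[ℝ] C3) (ε : ℝ)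
    (hd : ∀ η i, (η i : ℂ) * ∑ j, (η j : ℂ) * d η j = (ε * ‖η‖ ^ 2 : ℝ) * d η i)
    {t : ℝ} (ht : 0 ≤ t) :
    ∀ᵐ η, inner ℂ ((𝓕 (w t) : Lp C3 2 (volume : Measure E3)) η) (d η)
      = resolvent (memoryKernel (a₀ + ε * ((a₀ + 2 * b₀) / 3))
          (fun r => a r + ε * ((a r + 2 * b r) / 3))) t (freq η)
        • inner ℂ ((𝓕 (w 0) : Lp C3 2 (volume : Measure E3)) η) (d η) := by
  have hk₂ : IntegrableOn (fun r => (a r + 2 * b r) / 3) (Ioi 0) :=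
    (ha.add (hb.const_mul 2)).div_const 3
  have hk : IntegrableOn (fun r => a r + ε * ((a r + 2 * b r) / 3)) (Ioi 0) :=
    ha.add (hk₂.const_mul ε)
  set N := memoryKernel (a₀ + ε * ((a₀ + 2 * b₀) / 3))
    (fun r => a r + ε * ((a r + 2 * b r) / 3)) with hN
  set W : ℝ → Lp C3 2 (volume : Measure E3) := fun t => 𝓕 (w t) with hW
  have hWc : Continuous W := (Lp.fourierTransformₗᵢ E3 C3).continuous.comp hwc
  have hloc : ∀ r, LocallyIntegrable (fun η => inner ℂ (W r η) (d η)) := by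
    intro r
    rw [locallyIntegrable_iff]
    intro K hK
    obtain ⟨C, hC⟩ := hK.exists_bound_of_continuousOn d.continuous.continuousOn
    have h1 : LocallyIntegrable (W r) := (Lp.memLp (W r)).locallyIntegrable (by norm_num)
    refine Integrable.mono' ((h1.integrableOn_isCompact hK).norm.const_mul C)
      (((Lp.aestronglyMeasurable (W r)).inner d.continuous.aestronglyMeasurable).restrict) ?_
    filter_upwards [ae_restrict_mem hK.measurableSet] with η hη
    refine (norm_inner_le_norm _ _).trans ?_
    rw [mul_comm]
    exact mul_le_mul_of_nonneg_right (hC η hη) (norm_nonneg _)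
  have hres : Continuous fun η => resolvent N t (freq η) :=
    (continuous_resolvent (continuous_memoryKernel hk) (abs_memoryKernel_le hk)).comp
      (continuous_const.prodMk contDiff_freq.continuous)
  suffices h : ∀ᵐ η, inner ℂ (W t η) (d η) - resolvent N t (freq η) • inner ℂ (W 0 η) (d η) = 0 by
    filter_upwards [h] with η hη using sub_eq_zero.1 hη
  refine ae_eq_zero_of_integral_contDiff_smul_eq_zero
    ((hloc t).sub ((hloc 0).continuous_smul hres)) fun g hg hc => ?_
  -- The fields tested against are the inverse transforms of these. They are Schwartz but not
  -- compactly supported in space in general, which is why the weak form was extended by density. On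
  -- them Δ and ∇∇· raise j by one, with factors -1 and -ε.
  set Φ : ℕ → 𝓢(E3, C3) := fun j => freqField d (fun η => freq η ^ j * g η)
    (contDiff_freq_pow_mul hg j) (hasCompactSupport_freq_pow_mul hc j) with hΦ
  have hΔΦ : ∀ j, 𝓕 (Δ (𝓕⁻ (Φ j)) : 𝓢(E3, C3)) = -Φ (j + 1) := by
    intro j
    ext1 η
    rw [fourier_laplacian, FourierTransform.fourier_fourierInv_eq]
    change _ = -(Φ (j + 1) η)
    simp only [hΦ, freqField_apply, smul_smul, ← neg_smul]
    congr 1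
    rw [pow_succ, freq]; ring
  have hgΦ : ∀ j, 𝓕 (gradDiv (𝓕⁻ (Φ j))) = -(ε • Φ (j + 1)) := by
    intro j
    ext η i
    rw [fourier_gradDiv, FourierTransform.fourier_fourierInv_eq]
    change _ = -((ε • Φ (j + 1) η) i)
    simp only [hΦ, freqField_apply, PiLp.smul_apply, Complex.real_smul]
    have h1 : ∑ k, (η k : ℂ) * (((freq η ^ j * g η : ℝ) : ℂ) * d η k)
        = ((freq η ^ j * g η : ℝ) : ℂ) * ∑ k, (η k : ℂ) * d η k := by
      rw [Finset.mul_sum]; exact Finset.sum_congr rfl fun k _ => by ring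
    rw [h1, pow_succ]
    have h2 := hd η i
    have h3 : (freq η : ℂ) = (2 * Real.pi) ^ 2 * (‖η‖ : ℂ) ^ 2 := by rw [freq_eq]; push_cast; ring
    push_cast at h2 ⊢
    rw [h3]
    linear_combination (-(2 * Real.pi) ^ 2 * (((2 * Real.pi) ^ 2 * (‖η‖ : ℂ) ^ 2) ^ j * g η) : ℂ) * h2
  set P : ℕ → ℝ → ℂ := fun j r => inner ℂ (W r) ((Φ j).toLp 2) with hP
  have hneg : ∀ ψ : 𝓢(E3, C3), (-ψ).toLp 2 (volume : Measure E3) = -ψ.toLp 2 volume := fun ψ =>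
    map_neg (SchwartzMap.toLpCLM ℂ C3 2 (volume : Measure E3)) ψ
  have hsm : ∀ (c : ℝ) (ψ : 𝓢(E3, C3)), (c • ψ).toLp 2 (volume : Measure E3) = c • ψ.toLp 2 volume :=
    fun c ψ => map_smul (SchwartzMap.toLpCLM ℝ C3 2 (volume : Measure E3)) c ψ
  have hPc : ∀ j, Continuous (P j) := fun j => hWc.inner continuous_const
  have heq : ∀ j t, 0 ≤ t → P j t = P j 0 - ∫ r in (0 : ℝ)..t, N (t - r) • P (j + 1) r := by
    intro j t ht
    have h := hweak.pairing_schwartz h0 ha hb hwc hw (𝓕⁻ (Φ j)) ht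
    have e0 : ∀ r, inner ℂ (w r) ((𝓕⁻ (Φ j)).toLp 2) = P j r := fun r => by
      rw [inner_toLp_eq_inner_fourier, FourierTransform.fourier_fourierInv_eq]
    have e1 : ∀ r, inner ℂ (w r) ((Δ (𝓕⁻ (Φ j)) : 𝓢(E3, C3)).toLp 2) = -P (j + 1) r := fun r => by
      rw [inner_toLp_eq_inner_fourier, hΔΦ, hneg, inner_neg_right]
    have e2 : ∀ r, inner ℂ (w r) ((gradDiv (𝓕⁻ (Φ j))).toLp 2) = -(ε • P (j + 1) r) := fun r => by
      rw [inner_toLp_eq_inner_fourier, hgΦ, hneg, hsm, inner_neg_right, inner_smul_right_eq_smul]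
    simp only [e0, e1, e2] at h
    have i1 : IntervalIntegrable (fun r => memoryKernel a₀ a (t - r) • -P (j + 1) r) volume 0 t :=
      (((continuous_memoryKernel ha).comp (continuous_const.sub continuous_id)).smul
        (hPc _).neg).intervalIntegrable 0 t
    have i2 : IntervalIntegrable (fun r => memoryKernel ((a₀ + 2 * b₀) / 3)
        (fun r => (a r + 2 * b r) / 3) (t - r) • -(ε • P (j + 1) r)) volume 0 t :=
      (((continuous_memoryKernel hk₂).comp (continuous_const.sub continuous_id)).smul
        ((hPc _).const_smul ε).neg).intervalIntegrable 0 t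
    have h' := intervalIntegral.integral_add i1 i2
    have e3 : ∫ r in (0 : ℝ)..t, (memoryKernel a₀ a (t - r) • -P (j + 1) r
        + memoryKernel ((a₀ + 2 * b₀) / 3) (fun r => (a r + 2 * b r) / 3) (t - r)
          • -(ε • P (j + 1) r)) = -∫ r in (0 : ℝ)..t, N (t - r) • P (j + 1) r := by
      rw [← intervalIntegral.integral_neg]
      congr 1; ext r
      rw [hN, memoryKernel_add_mul ha hk₂]
      module
    rw [sub_eq_add_neg, ← e3, h', ← add_assoc]
    exact h
  -- R bounds the squared frequency on the support of g, so the j-th moment grows at most like Rʲ,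
  -- as the uniqueness argument requires.
  obtain ⟨R, hR⟩ := hc.isCompact.exists_bound_of_continuousOn contDiff_freq.continuous.continuousOn
  obtain ⟨B, hB⟩ := (isCompact_Icc (a := 0) (b := t)).exists_bound_of_continuousOn hWc.continuousOn
  have hR' : ∀ η, g η ≠ 0 → freq η ≤ R := fun η hη => by
    have := hR η (subset_tsupport g hη)
    rwa [Real.norm_of_nonneg (freq_nonneg η)] at this
  obtain ⟨hi0, he0⟩ := inner_freqField (W 0) d g hg hc
  obtain ⟨hit, het⟩ := inner_freqField (W t) d g hg hc
  have hΦ0 : Φ 0 = freqField d g hg hc := by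
    ext1 η; simp [hΦ, freqField_apply]
  have hΦj : ∀ j, ‖(Φ j).toLp 2 (volume : Measure E3)‖ ≤ R ^ j * ‖(Φ 0).toLp 2 (volume : Measure E3)‖ := by
    intro j
    refine Lp.norm_le_mul_norm_of_ae_le_mul ?_
    filter_upwards [(Φ j).coeFn_toLp 2 volume, (Φ 0).coeFn_toLp 2 volume] with η h1 h2
    rw [h1, h2, hΦ0]
    simp only [hΦ, freqField_apply, norm_smul, norm_mul, norm_pow, Real.norm_of_nonneg (freq_nonneg η)]
    by_cases hη : g η = 0
    · simp [hη]
    · have h3 := hR' η hη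
      have h4 := freq_nonneg η
      rw [← mul_assoc]
      gcongr
  have key := eq_integral_resolvent_smul (μ := (volume : Measure E3)) (lam := freq) (N := N)
    (h := fun η => g η • inner ℂ (W 0 η) (d η)) (R := R) (P := P)
    (B := B * ‖(Φ 0).toLp 2 (volume : Measure E3)‖)
    (continuous_memoryKernel hk) (abs_memoryKernel_le hk) contDiff_freq.continuous.measurable
    freq_nonneg hi0 (fun η hη => hR' η fun h => hη (by simp [h])) hPc
    (fun j t ht => ?_) ht (fun j r hr hrt => ?_)
  · have e1 : P 0 t = ∫ η, g η • inner ℂ (W t η) (d η) := by rw [← het, ← hΦ0]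
    rw [e1, ← sub_eq_zero, ← integral_sub hit] at key
    · rw [← key]
      refine integral_congr_ae (Eventually.of_forall fun η => ?_)
      dsimp only
      rw [smul_sub, smul_comm]
    · have := ((hloc 0).continuous_smul hres).integrable_smul_left_of_hasCompactSupport hg.continuous hc
      refine this.congr (Eventually.of_forall fun η => ?_)
      dsimp only
      rw [smul_comm]
  · rw [heq j t ht]
    congr 1
    have := (inner_freqField (W 0) d _ (contDiff_freq_pow_mul hg j)
      (hasCompactSupport_freq_pow_mul hc j)).2
    simp only [hP, hΦ]
    rw [this]
    simp only [mul_smul]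
  · refine (norm_inner_le_norm _ _).trans ?_
    refine (mul_le_mul (hB r ⟨hr, hrt⟩) (hΦj j) (norm_nonneg _) ((norm_nonneg _).trans
      (hB r ⟨hr, hrt⟩))).trans (le_of_eq (by ring))

/-! ### The solution in frequency space -/

/-- The identity `η ↦ η`, with values in `ℂ³`. -/
def longField : E3 →L[ℝ] C3 :=
  LinearMap.toContinuousLinearMap
    { toFun := fun η => WithLp.toLp 2 fun i => ((η i : ℝ) : ℂ)
      map_add' := fun x y => by ext i; simp
      map_smul' := fun c y => by ext i; simp }

@[simp] lemma longField_apply (η : E3) (i : Fin 3) : longField η i = (η i : ℂ) := rfl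

/-- The transverse field `η ↦ η_j e_i - η_i e_j`. -/
def transField (i j : Fin 3) : E3 →L[ℝ] C3 :=
  (EuclideanSpace.proj j : E3 →L[ℝ] ℝ).smulRight (EuclideanSpace.single i (1 : ℂ))
    - (EuclideanSpace.proj i : E3 →L[ℝ] ℝ).smulRight (EuclideanSpace.single j (1 : ℂ))

lemma transField_apply (i j : Fin 3) (η : E3) (k : Fin 3) : transField i j η k
    = (if k = i then (η j : ℂ) else 0) - (if k = j then (η i : ℂ) else 0) := by
  simp [transField]

/-- The orthogonal projection `(η ηᵀ / |η|²) y` of `y` onto the line of `η`. -/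
def longProj (η : E3) (y : C3) : C3 :=
  WithLp.toLp 2 fun i => ((η i / ‖η‖ ^ 2 : ℝ) : ℂ) * ∑ j, (η j : ℂ) * y j

lemma longProj_apply (η : E3) (y : C3) (i : Fin 3) :
    longProj η y i = ((η i / ‖η‖ ^ 2 : ℝ) : ℂ) * ∑ j, (η j : ℂ) * y j := rfl

lemma longProj_eq_smul (η : E3) (y : C3) :
    longProj η y = ((‖η‖ ^ 2 : ℝ)⁻¹ : ℂ) • (inner ℂ (longField η) y) • longField η := by
  ext i
  simp only [longProj_apply, PiLp.smul_apply, smul_eq_mul, longField_apply, PiLp.inner_apply]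
  simp only [RCLike.inner_apply, Complex.conj_ofReal]
  push_cast
  simp_rw [mul_comm (y _)]
  ring

lemma norm_longField (η : E3) : ‖longField η‖ = ‖η‖ := by
  rw [EuclideanSpace.norm_eq, EuclideanSpace.norm_eq]
  simp

lemma norm_longProj_le (η : E3) (y : C3) : ‖longProj η y‖ ≤ ‖y‖ := by
  rw [longProj_eq_smul, norm_smul, norm_smul]
  have h := norm_inner_le_norm (𝕜 := ℂ) (longField η) y
  rw [norm_longField] at h ⊢
  have e : ‖((‖η‖ ^ 2 : ℝ)⁻¹ : ℂ)‖ = (‖η‖ ^ 2)⁻¹ := by simp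
  rw [e]
  by_cases hη : ‖η‖ = 0
  · simp [hη]
  · rw [inv_mul_le_iff₀ (by positivity)]
    nlinarith [norm_nonneg η]

lemma longProj_sub (η : E3) (y z : C3) : longProj η (y - z) = longProj η y - longProj η z := by
  rw [longProj_eq_smul, longProj_eq_smul, longProj_eq_smul, inner_sub_right, sub_smul, smul_sub]

lemma longProj_smul (η : E3) (c : ℝ) (y : C3) : longProj η (c • y) = c • longProj η y := by
  rw [longProj_eq_smul, longProj_eq_smul, inner_smul_right_eq_smul]
  rw [smul_assoc, smul_comm _ c]

/-- The propagator of the system in frequency space: the gradient part is multiplied by `p`, the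
divergence free part by `q`. -/
def propagate (p q : ℝ) (η : E3) (y : C3) : C3 := p • longProj η y + q • (y - longProj η y)

/-- The transverse fields span the orthogonal complement of η. Explicitly |η|² z_i = Σ_j η_j (η_j
z_i - η_i z_j) + η_i Σ_j η_j z_j, so z is determined by the given pairings. -/
lemma eq_propagate {η : E3} (hη : η ≠ 0) {y z : C3} {p q : ℝ}
    (hp : inner ℂ z (longField η) = p • inner ℂ y (longField η))
    (hq : ∀ i j, inner ℂ z (transField i j η) = q • inner ℂ y (transField i j η)) :
    z = propagate p q η y := by
  have hL : ∀ y : C3, inner ℂ y (longField η) = (starRingEnd ℂ) (∑ j, (η j : ℂ) * y j) := fun y => by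
    simp [PiLp.inner_apply]
  have hT : ∀ (y : C3) (i j : Fin 3), inner ℂ y (transField i j η)
      = (starRingEnd ℂ) ((η j : ℂ) * y i - (η i : ℂ) * y j) := fun y i j => by
    simp [PiLp.inner_apply, transField_apply, sub_mul, Finset.sum_sub_distrib]
  have hconj : ∀ (a b : ℂ) (c : ℝ), (starRingEnd ℂ) a = c • (starRingEnd ℂ) b → a = c * b := by
    intro a b c h
    have := congrArg (starRingEnd ℂ) h
    simpa using this
  have hp' : ∑ j, (η j : ℂ) * z j = p * ∑ j, (η j : ℂ) * y j := by
    rw [hL, hL] at hp; exact hconj _ _ _ hp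
  have hq' : ∀ i j, (η j : ℂ) * z i - (η i : ℂ) * z j = q * ((η j : ℂ) * y i - (η i : ℂ) * y j) := by
    intro i j
    have := hq i j
    rw [hT, hT] at this
    exact hconj _ _ _ this
  have hn : (‖η‖ : ℂ) ^ 2 = (η 0 : ℂ) ^ 2 + (η 1 : ℂ) ^ 2 + (η 2 : ℂ) ^ 2 := by
    have := EuclideanSpace.real_norm_sq_eq η
    rw [Fin.sum_univ_three] at this
    exact_mod_cast this
  have hn0 : (‖η‖ : ℂ) ^ 2 ≠ 0 := by simpa using hη
  ext i
  simp only [propagate, PiLp.add_apply, PiLp.smul_apply, PiLp.sub_apply, longProj_apply,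
    Complex.real_smul]
  rw [Fin.sum_univ_three, Fin.sum_univ_three] at hp'
  rw [Fin.sum_univ_three]
  push_cast
  refine mul_left_cancel₀ hn0 ?_
  have hr : (‖η‖ : ℂ) ^ 2 * ((η i : ℂ) / (‖η‖ : ℂ) ^ 2) = η i := mul_div_cancel₀ _ hn0
  linear_combination (η 0 : ℂ) * hq' i 0 + (η 1 : ℂ) * hq' i 1 + (η 2 : ℂ) * hq' i 2
    + (η i : ℂ) * hp' + (z i - q * y i) * hn
    + ((q : ℂ) - p) * ((η 0 : ℂ) * y 0 + (η 1 : ℂ) * y 1 + (η 2 : ℂ) * y 2) * hr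

/-- The Fourier transform of the solution. -/
theorem SolvesWeakly.fourier_ae {a₀ b₀ : ℝ} {a b : ℝ → ℝ} {v₀ : E3 → E3} {v : ℝ → E3 → E3}
    (hweak : SolvesWeakly a₀ b₀ a b v₀ v) (h0 : v 0 =ᵐ[volume] v₀)
    (ha : IntegrableOn a (Ioi 0)) (hb : IntegrableOn b (Ioi 0))
    {w : ℝ → Lp C3 2 (volume : Measure E3)} (hwc : Continuous w)
    (hw : ∀ t, 0 ≤ t → w t =ᵐ[volume] complexify (v t)) {t : ℝ} (ht : 0 ≤ t) :
    ∀ᵐ η, (𝓕 (w t) : Lp C3 2 (volume : Measure E3)) η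
      = propagate
        (resolvent (memoryKernel ((4 * a₀ + 2 * b₀) / 3) (fun t => (4 * a t + 2 * b t) / 3)) t (freq η))
        (resolvent (memoryKernel a₀ a) t (freq η)) η
        ((𝓕 (w 0) : Lp C3 2 (volume : Measure E3)) η) := by
  -- On the line of η the eigenvalue is ε = 1 and the moduli combine to a + (a + 2b)/3 = β; on its
  -- complement ε = 0 and only a remains.
  have h1 := hweak.inner_fourier_ae h0 ha hb hwc hw longField 1 (fun η i => by
    have hn := EuclideanSpace.real_norm_sq_eq η
    rw [Fin.sum_univ_three] at hn ⊢
    rw [one_mul, hn]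
    simp only [longField_apply]
    push_cast
    ring) ht
  have h2 := fun i j => hweak.inner_fourier_ae h0 ha hb hwc hw (transField i j) 0 (fun η k => by
    simp only [transField_apply, mul_sub, Finset.sum_sub_distrib, mul_ite, mul_zero,
      Finset.sum_ite_eq', Finset.mem_univ, if_true, zero_mul, Complex.ofReal_zero]
    rw [mul_comm (η i : ℂ) (η j : ℂ), sub_self]
    simp) ht
  have e1 : (fun r => a r + 1 * ((a r + 2 * b r) / 3)) = fun t => (4 * a t + 2 * b t) / 3 := by
    ext r; ring
  have e2 : a₀ + 1 * ((a₀ + 2 * b₀) / 3) = (4 * a₀ + 2 * b₀) / 3 := by ring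
  rw [e1, e2] at h1
  simp only [zero_mul, add_zero] at h2
  have h2' : ∀ᵐ η, ∀ i j, inner ℂ ((𝓕 (w t) : Lp C3 2 (volume : Measure E3)) η) (transField i j η)
      = resolvent (memoryKernel a₀ a) t (freq η)
        • inner ℂ ((𝓕 (w 0) : Lp C3 2 (volume : Measure E3)) η) (transField i j η) :=
    ae_all_iff.2 fun i => ae_all_iff.2 fun j => h2 i j
  filter_upwards [h1, h2', Measure.ae_ne volume 0] with η hp hq hη
  exact eq_propagate hη hp hq

/-! ### Decay of the weighted distance to the heat multiplier -/

/-- The target exponent -2 is chosen because (1 + |ξ|²)⁻² is integrable on ℝ³; it serves as the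
common majorant below. -/
lemma exists_rpow_mul_exp_le (p : ℝ) {c : ℝ} (hc : 0 < c) :
    ∃ C, 0 ≤ C ∧ ∀ x, 0 ≤ x → (1 + x) ^ p * Real.exp (-(c * x)) ≤ C * (1 + x) ^ (-2 : ℝ) := by
  obtain ⟨n, hn⟩ := exists_nat_ge (p + 2)
  refine ⟨n.factorial * Real.exp c / c ^ n, by positivity, fun x hx => ?_⟩
  have h1 : (1 : ℝ) ≤ 1 + x := by linarith
  have h2 := Real.pow_div_factorial_le_exp (c * (1 + x)) (by positivity) n
  have h3 : (1 + x) ^ (p + 2) ≤ (1 + x) ^ n := by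
    rw [← Real.rpow_natCast]
    exact Real.rpow_le_rpow_of_exponent_le h1 hn
  have h4 : (1 + x) ^ n ≤ n.factorial * Real.exp c / c ^ n * Real.exp (c * x) := by
    rw [mul_pow, div_le_iff₀ (by positivity), mul_add, mul_one, Real.exp_add] at h2
    rw [div_mul_eq_mul_div, le_div_iff₀ (by positivity)]
    nlinarith
  have h5 : (1 + x) ^ p = (1 + x) ^ (p + 2) * (1 + x) ^ (-2 : ℝ) := by
    rw [← Real.rpow_add (by linarith)]; congr 1; ring
  rw [h5, mul_right_comm]
  refine mul_le_mul_of_nonneg_right ?_ (by positivity)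
  rw [Real.exp_neg, ← div_eq_mul_inv, div_le_iff₀ (Real.exp_pos _)]
  exact h3.trans h4

lemma lintegral_one_add_freq_rpow_lt_top :
    ∫⁻ η : E3, ENNReal.ofReal ((1 + freq η) ^ (-2 : ℝ)) < ⊤ := by
  have h : Integrable (fun η : E3 => (1 + ‖η‖ ^ 2) ^ (-(4 : ℝ) / 2)) :=
    integrable_rpow_neg_one_add_norm_sq (by simp; norm_num)
  refine lt_of_le_of_lt (lintegral_mono fun η => ?_) h.lintegral_lt_top
  refine ENNReal.ofReal_le_ofReal ?_
  rw [show (-(4 : ℝ) / 2) = -2 by norm_num]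
  refine Real.rpow_le_rpow_of_nonpos (by positivity) ?_ (by norm_num)
  rw [freq_eq]
  have : (1 : ℝ) ≤ (2 * Real.pi) ^ 2 := by nlinarith [Real.pi_gt_three]
  nlinarith [sq_nonneg ‖η‖]

lemma norm_smul_sub_smul_sq_le {F : Type*} [NormedAddCommGroup F] [NormedSpace ℝ F] (p q : ℝ)
    (x y : F) : ‖p • x - q • y‖ ^ 2 ≤ 2 * (p ^ 2 * ‖x‖ ^ 2) + 2 * (q ^ 2 * ‖y‖ ^ 2) := by
  have h := norm_sub_le (p • x) (q • y)
  rw [norm_smul, norm_smul, Real.norm_eq_abs, Real.norm_eq_abs] at h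
  rw [← sq_abs p, ← sq_abs q]
  nlinarith [sq_nonneg (|p| * ‖x‖ - |q| * ‖y‖), norm_nonneg (p • x - q • y)]

section HeatMultiplier

variable {s κ M K : ℝ} {S : ℝ → ℝ → ℝ} {u : E3 → C3} {V : C3}

/-- The weighted squared distance of a multiplier to the heat multiplier. -/
def heatDefect (s κ : ℝ) (S : ℝ → ℝ → ℝ) (u : E3 → C3) (V : C3) (t : ℝ) (η : E3) : ℝ :=
  (1 + freq η) ^ s * ‖S t (freq η) • u η - Real.exp (-(κ * (freq η * t))) • V‖ ^ 2

lemma heatDefect_le (t : ℝ) (η : E3) : heatDefect s κ S u V t η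
    ≤ 2 * S t (freq η) ^ 2 * ((1 + freq η) ^ s * ‖u η‖ ^ 2)
      + 2 * ‖V‖ ^ 2 * ((1 + freq η) ^ s * Real.exp (-(2 * κ * t * freq η))) := by
  have h0 : 0 ≤ (1 + freq η) ^ s := Real.rpow_nonneg (by linarith [freq_nonneg η]) s
  refine (mul_le_mul_of_nonneg_left (norm_smul_sub_smul_sq_le _ _ _ _) h0).trans (le_of_eq ?_)
  rw [← Real.exp_nat_mul]
  push_cast
  rw [show (2 : ℝ) * -(κ * (freq η * t)) = -(2 * κ * t * freq η) by ring]
  ring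

lemma measurable_weight : Measurable fun η : E3 => (1 + freq η) ^ s :=
  (measurable_const.add contDiff_freq.continuous.measurable).pow_const s

lemma measurable_weight_mul (hu : Continuous u) (c : ℝ≥0∞) :
    Measurable fun η => c * ENNReal.ofReal ((1 + freq η) ^ s * ‖u η‖ ^ 2) :=
  (measurable_weight.mul (hu.measurable.norm.pow_const 2)).ennreal_ofReal.const_mul c

lemma measurable_heatDefect (hS : ∀ t, Continuous (S t)) (hu : Continuous u) (t : ℝ) :
    Measurable (heatDefect s κ S u V t) := by
  have hf : Continuous freq := contDiff_freq.continuous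
  have h : Continuous fun η => ‖S t (freq η) • u η - Real.exp (-(κ * (freq η * t))) • V‖ ^ 2 := by
    have := (hS t).comp hf
    simp only [Function.comp_def] at this
    fun_prop
  exact measurable_weight.mul h.measurable

/-- For fixed t the multiplier is bounded: by the exponential bound for frequencies up to 1 and by
the decay bound beyond. -/
lemma lintegral_heatDefect_lt_top (hκ : 0 < κ) (hu : Continuous u)
    (hexp : ∀ t μ, |S t μ| ≤ Real.exp (|μ * t| * M))
    (hdec : ∀ μ t, 0 < μ → 0 < t → |S t μ| ≤ K * (1 + 1 / μ) / t) (hM : 0 ≤ M) (hK : 0 ≤ K)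
    (hus : ∫⁻ η, ENNReal.ofReal ((1 + freq η) ^ s * ‖u η‖ ^ 2) < ⊤) {t : ℝ} (ht : 0 < t) :
    ∫⁻ η, ENNReal.ofReal (heatDefect s κ S u V t η) < ⊤ := by
  obtain ⟨C, hC0, hC⟩ := exists_rpow_mul_exp_le s (c := 2 * κ * t) (by positivity)
  set D := max (Real.exp (t * M)) (2 * K / t) with hD
  have hSD : ∀ η, S t (freq η) ^ 2 ≤ D ^ 2 := fun η => by
    have hf := freq_nonneg η
    refine sq_le_sq.2 ((?_ : |S t (freq η)| ≤ D).trans (le_abs_self _))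
    rcases le_or_gt (freq η) 1 with h | h
    · refine (hexp t _).trans ((Real.exp_le_exp.2 ?_).trans (le_max_left _ _))
      rw [abs_of_nonneg (by positivity)]
      nlinarith [mul_nonneg ht.le hM]
    · refine (hdec _ t (by linarith) ht).trans (le_trans ?_ (le_max_right _ _))
      have h1 : 1 / freq η ≤ 1 := by rw [div_le_one (by linarith)]; exact h.le
      have h2 : K * (1 + 1 / freq η) ≤ 2 * K := by nlinarith
      gcongr
  have hle : ∀ η, ENNReal.ofReal (heatDefect s κ S u V t η)
      ≤ ENNReal.ofReal (2 * D ^ 2) * ENNReal.ofReal ((1 + freq η) ^ s * ‖u η‖ ^ 2)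
        + ENNReal.ofReal (2 * ‖V‖ ^ 2 * C) * ENNReal.ofReal ((1 + freq η) ^ (-2 : ℝ)) := fun η => by
    have hf := freq_nonneg η
    rw [← ENNReal.ofReal_mul (by positivity), ← ENNReal.ofReal_mul (by positivity),
      ← ENNReal.ofReal_add (by positivity) (by positivity)]
    refine ENNReal.ofReal_le_ofReal ((heatDefect_le t η).trans ?_)
    rw [mul_assoc (2 * ‖V‖ ^ 2)]
    have h1 := hSD η
    have h2 := hC _ hf
    gcongr
  refine lt_of_le_of_lt (lintegral_mono hle) ?_
  rw [lintegral_add_left (measurable_weight_mul hu _),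
    lintegral_const_mul' _ _ ENNReal.ofReal_ne_top, lintegral_const_mul' _ _ ENNReal.ofReal_ne_top]
  exact ENNReal.add_lt_top.2 ⟨ENNReal.mul_lt_top ENNReal.ofReal_lt_top hus,
    ENNReal.mul_lt_top ENNReal.ofReal_lt_top lintegral_one_add_freq_rpow_lt_top⟩

/-- Here 1 + 1/μ ≤ 2, so the squared multiplier is at most 4K²/t², which beats t^(3/2); the heat
part is exponentially small. -/
lemma tendsto_high_frequency (hκ : 0 < κ) (hu : Continuous u)
    (hdec : ∀ μ t, 0 < μ → 0 < t → |S t μ| ≤ K * (1 + 1 / μ) / t) (hK : 0 ≤ K)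
    (hus : ∫⁻ η, ENNReal.ofReal ((1 + freq η) ^ s * ‖u η‖ ^ 2) < ⊤) :
    Tendsto (fun t : ℝ => ENNReal.ofReal (t ^ (3 / 2 : ℝ))
      * ∫⁻ η in {η | 1 < freq η}, ENNReal.ofReal (heatDefect s κ S u V t η)) atTop (𝓝 0) := by
  obtain ⟨C, hC0, hC⟩ := exists_rpow_mul_exp_le s (c := κ) hκ
  have hset : MeasurableSet {η : E3 | 1 < freq η} :=
    measurableSet_lt measurable_const contDiff_freq.continuous.measurable
  set I₁ := ∫⁻ η, ENNReal.ofReal ((1 + freq η) ^ s * ‖u η‖ ^ 2) with hI₁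
  set I₂ := ∫⁻ η : E3, ENNReal.ofReal ((1 + freq η) ^ (-2 : ℝ)) with hI₂
  have hle : ∀ t : ℝ, 1 ≤ t → ENNReal.ofReal (t ^ (3 / 2 : ℝ))
      * ∫⁻ η in {η | 1 < freq η}, ENNReal.ofReal (heatDefect s κ S u V t η)
      ≤ ENNReal.ofReal (8 * K ^ 2 * t ^ (-(1 / 2 : ℝ))) * I₁
        + ENNReal.ofReal (2 * ‖V‖ ^ 2 * C * (t ^ (3 / 2 : ℝ) * Real.exp (-κ * t))) * I₂ := by
    intro t ht
    have ht0 : 0 < t := by linarith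
    have hpt : ∀ η, η ∈ {η : E3 | 1 < freq η} → ENNReal.ofReal (heatDefect s κ S u V t η)
      ≤ ENNReal.ofReal (8 * K ^ 2 / t ^ 2) * ENNReal.ofReal ((1 + freq η) ^ s * ‖u η‖ ^ 2)
        + ENNReal.ofReal (2 * ‖V‖ ^ 2 * C * Real.exp (-κ * t))
          * ENNReal.ofReal ((1 + freq η) ^ (-2 : ℝ)) := by
      intro η (hη : 1 < freq η)
      have hf := freq_nonneg η
      rw [← ENNReal.ofReal_mul (by positivity), ← ENNReal.ofReal_mul (by positivity),
        ← ENNReal.ofReal_add (by positivity) (by positivity)]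
      refine ENNReal.ofReal_le_ofReal ((heatDefect_le t η).trans ?_)
      have h1 : S t (freq η) ^ 2 ≤ (2 * K / t) ^ 2 := by
        refine sq_le_sq.2 ((?_ : |S t (freq η)| ≤ 2 * K / t).trans (le_abs_self _))
        refine (hdec _ t (by linarith) ht0).trans ?_
        have h3 : 1 / freq η ≤ 1 := by rw [div_le_one (by linarith)]; exact hη.le
        have h4 : K * (1 + 1 / freq η) ≤ 2 * K := by nlinarith
        gcongr
      have h2 : (1 + freq η) ^ s * Real.exp (-(2 * κ * t * freq η))
          ≤ Real.exp (-κ * t) * (C * (1 + freq η) ^ (-2 : ℝ)) := by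
        -- For t ≥ 1 and frequency λ ≥ 1 one has t + λ ≤ 2tλ: one factor gives decay in t, the other
        -- compensates the Sobolev weight.
        have h3 : Real.exp (-(2 * κ * t * freq η)) ≤ Real.exp (-κ * t) * Real.exp (-(κ * freq η)) := by
          rw [← Real.exp_add, Real.exp_le_exp]
          nlinarith [mul_nonneg hκ.le (mul_nonneg (sub_nonneg.2 ht) hf),
            mul_nonneg hκ.le (mul_nonneg ht0.le (sub_nonneg.2 hη.le))]
        calc _ ≤ (1 + freq η) ^ s * (Real.exp (-κ * t) * Real.exp (-(κ * freq η))) := by gcongr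
          _ = Real.exp (-κ * t) * ((1 + freq η) ^ s * Real.exp (-(κ * freq η))) := by ring
          _ ≤ _ := mul_le_mul_of_nonneg_left (hC _ hf) (Real.exp_pos _).le
      calc _ ≤ 2 * (2 * K / t) ^ 2 * ((1 + freq η) ^ s * ‖u η‖ ^ 2)
          + 2 * ‖V‖ ^ 2 * (Real.exp (-κ * t) * (C * (1 + freq η) ^ (-2 : ℝ))) := by gcongr
        _ = _ := by ring
    have h := (setLIntegral_mono' (μ := volume) hset hpt).trans (setLIntegral_le_lintegral _ _)
    rw [lintegral_add_left (measurable_weight_mul hu _),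
      lintegral_const_mul' _ _ ENNReal.ofReal_ne_top,
      lintegral_const_mul' _ _ ENNReal.ofReal_ne_top] at h
    refine (mul_le_mul_right h (ENNReal.ofReal (t ^ (3 / 2 : ℝ)))).trans (le_of_eq ?_)
    rw [mul_add, ← mul_assoc, ← mul_assoc, ← ENNReal.ofReal_mul (by positivity),
      ← ENNReal.ofReal_mul (by positivity)]
    congr 3
    · rw [show (-(1 / 2) : ℝ) = 3 / 2 - 2 by norm_num, Real.rpow_sub ht0]
      norm_num
      ring
    · ring
  have hlim1 : Tendsto (fun t : ℝ => 8 * K ^ 2 * t ^ (-(1 / 2 : ℝ))) atTop (𝓝 0) := by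
    simpa using (tendsto_rpow_neg_atTop (by norm_num : (0 : ℝ) < 1 / 2)).const_mul (8 * K ^ 2)
  have hlim2 : Tendsto (fun t : ℝ => 2 * ‖V‖ ^ 2 * C * (t ^ (3 / 2 : ℝ) * Real.exp (-κ * t))) atTop
      (𝓝 0) := by
    simpa using (tendsto_rpow_mul_exp_neg_mul_atTop_nhds_zero (3 / 2) κ hκ).const_mul
      (2 * ‖V‖ ^ 2 * C)
  have h1 := ENNReal.Tendsto.mul_const (ENNReal.tendsto_ofReal hlim1) (Or.inr hus.ne)
  have h2 := ENNReal.Tendsto.mul_const (ENNReal.tendsto_ofReal hlim2)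
    (Or.inr lintegral_one_add_freq_rpow_lt_top.ne)
  have h3 := h1.add h2
  simp only [ENNReal.ofReal_zero, zero_mul, add_zero] at h3
  refine tendsto_of_tendsto_of_tendsto_of_le_of_le' tendsto_const_nhds h3
    (Eventually.of_forall fun _ => bot_le) ?_
  filter_upwards [eventually_ge_atTop 1] with t ht using hle t ht

lemma freq_smul (c : ℝ) (η : E3) : freq (c • η) = c ^ 2 * freq η := by
  rw [freq_eq, freq_eq, norm_smul, Real.norm_eq_abs, ← sq_abs c]; ring

/-- The Jacobian in dimension 3 is the origin of the rate: t^(3/2) for the squared norm. -/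
lemma lintegral_comp_inv_sqrt_smul {f : E3 → ℝ≥0∞} (hf : Measurable f) {t : ℝ} (ht : 0 < t) :
    ∫⁻ η, f ((Real.sqrt t)⁻¹ • η) = ENNReal.ofReal (t ^ (3 / 2 : ℝ)) * ∫⁻ η, f η := by
  have hs : 0 < Real.sqrt t := Real.sqrt_pos.2 ht
  have h := Measure.map_addHaar_smul (volume : Measure E3) (inv_ne_zero hs.ne')
  have e : ∫⁻ η, f ((Real.sqrt t)⁻¹ • η)
      = ∫⁻ η, f η ∂(Measure.map ((Real.sqrt t)⁻¹ • ·) (volume : Measure E3)) :=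
    (lintegral_map hf (measurable_const_smul _)).symm
  rw [e, h, lintegral_smul_measure, smul_eq_mul]
  congr 2
  rw [finrank_euclideanSpace_fin, inv_pow, inv_inv, abs_of_pos (by positivity), Real.sqrt_eq_rpow,
    ← Real.rpow_natCast, ← Real.rpow_mul ht.le]
  norm_num

/-- After the substitution η → η/√t the multiplier is S(t, μ/t), which tends to exp(-κμ), while
u(η/√t) tends to u(0) = V. The squared multiplier has the majorant E²(1 + μ)⁻² on the rescaled
region μ ≤ t. -/
lemma tendsto_low_frequency (hs : 0 ≤ s) (hκ : 0 < κ) (hS : ∀ t, Continuous (S t))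
    (hu : Continuous u) {L : ℝ} (hL : ∀ η, ‖u η‖ ≤ L) (hV : u 0 = V)
    (hexp : ∀ t μ, |S t μ| ≤ Real.exp (|μ * t| * M))
    (hdec : ∀ μ t, 0 < μ → 0 < t → |S t μ| ≤ K * (1 + 1 / μ) / t) (hM : 0 ≤ M) (hK : 0 ≤ K)
    (hlim : ∀ μ, Tendsto (fun t => S t (μ / t)) atTop (𝓝 (Real.exp (-(κ * μ))))) :
    Tendsto (fun t : ℝ => ENNReal.ofReal (t ^ (3 / 2 : ℝ))
      * ∫⁻ η in {η | freq η ≤ 1}, ENNReal.ofReal (heatDefect s κ S u V t η)) atTop (𝓝 0) := by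
  obtain ⟨C, hC0, hC⟩ := exists_rpow_mul_exp_le 0 (c := 2 * κ) (by positivity)
  have hset : MeasurableSet {η : E3 | freq η ≤ 1} :=
    measurableSet_le contDiff_freq.continuous.measurable measurable_const
  have hL0 : 0 ≤ L := (norm_nonneg _).trans (hL 0)
  set F : ℝ → E3 → ℝ≥0∞ := fun t =>
    {η | freq η ≤ 1}.indicator fun η => ENNReal.ofReal (heatDefect s κ S u V t η) with hF
  have hFm : ∀ t, Measurable (F t) := fun t =>
    (measurable_heatDefect hS hu t).ennreal_ofReal.indicator hset
  have hscale : ∀ t : ℝ, 0 < t → ENNReal.ofReal (t ^ (3 / 2 : ℝ))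
      * ∫⁻ η in {η | freq η ≤ 1}, ENNReal.ofReal (heatDefect s κ S u V t η)
      = ∫⁻ η, F t ((Real.sqrt t)⁻¹ • η) := fun t ht => by
    rw [lintegral_comp_inv_sqrt_smul (hFm t) ht, hF, lintegral_indicator hset]
  have hfs : ∀ (t : ℝ) (η : E3), 0 < t → freq ((Real.sqrt t)⁻¹ • η) = freq η / t := fun t η ht => by
    rw [freq_smul, inv_pow, Real.sq_sqrt ht.le]; ring
  -- The first summand serves μ ≤ 1, where 1 + μ ≤ 2; the second serves μ > 1, where |S| ≤ 2K/μ and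
  -- 1 + μ ≤ 2μ.
  set E := Real.exp M * 2 + 4 * K with hE
  set D := 2 ^ s * (2 * (E ^ 2 * L ^ 2) + 2 * (‖V‖ ^ 2 * C)) with hD
  suffices h : Tendsto (fun t : ℝ => ∫⁻ η, F t ((Real.sqrt t)⁻¹ • η)) atTop (𝓝 (∫⁻ _ : E3, 0)) by
    rw [lintegral_zero] at h
    refine h.congr' ?_
    filter_upwards [eventually_gt_atTop 0] with t ht using (hscale t ht).symm
  refine tendsto_lintegral_filter_of_dominated_convergence
    (fun η => ENNReal.ofReal (D * (1 + freq η) ^ (-2 : ℝ)))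
    (Eventually.of_forall fun t => (hFm t).comp (measurable_const_smul _)) ?_ ?_ ?_
  · filter_upwards [eventually_gt_atTop 0] with t ht
    refine Eventually.of_forall fun η => ?_
    simp only [hF, indicator_apply, mem_ofPred_eq, hfs t η ht]
    split_ifs with h
    · refine ENNReal.ofReal_le_ofReal ?_
      have hf := freq_nonneg η
      have hμ : 0 ≤ freq η / t := by positivity
      have h1 : |S t (freq η / t)| ≤ E * (1 + freq η)⁻¹ := by
        rw [← div_eq_mul_inv, le_div_iff₀ (by positivity)]
        rcases le_or_gt (freq η) 1 with h1 | h1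
        · have h2 : |S t (freq η / t)| ≤ Real.exp M := by
            refine (hexp _ _).trans (Real.exp_le_exp.2 ?_)
            rw [div_mul_cancel₀ _ ht.ne', abs_of_nonneg hf]
            nlinarith
          have := abs_nonneg (S t (freq η / t))
          have := Real.exp_pos M
          nlinarith
        · have h2 : |S t (freq η / t)| ≤ 2 * K / freq η := by
            refine (hdec _ t (by positivity) ht).trans ?_
            -- The cutoff to original frequencies at most 1 is used here: the term 1 in 1 + 1/μ is
            -- then absorbed by 1/μ.
            have h3 : 1 ≤ 1 / (freq η / t) := by rw [le_div_iff₀ (by positivity)]; linarith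
            calc K * (1 + 1 / (freq η / t)) / t ≤ K * (2 * (1 / (freq η / t))) / t := by
                  gcongr; linarith
              _ = 2 * K / freq η := by field_simp
          rw [le_div_iff₀ (by linarith)] at h2
          have := abs_nonneg (S t (freq η / t))
          have := Real.exp_pos M
          nlinarith
      have h2 : S t (freq η / t) ^ 2 ≤ E ^ 2 * (1 + freq η) ^ (-2 : ℝ) := by
        have e : (1 + freq η) ^ (-2 : ℝ) = ((1 + freq η)⁻¹) ^ 2 := by
          rw [Real.rpow_neg (by positivity), inv_pow]; norm_num
        rw [e, ← mul_pow, ← sq_abs]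
        exact pow_le_pow_left₀ (abs_nonneg _) h1 2
      have h3 : Real.exp (-(κ * (freq η / t * t))) ^ 2 ≤ C * (1 + freq η) ^ (-2 : ℝ) := by
        have := hC _ hf
        rw [Real.rpow_zero, one_mul] at this
        refine le_trans (le_of_eq ?_) this
        rw [← Real.exp_nat_mul, div_mul_cancel₀ _ ht.ne']
        congr 1; push_cast; ring
      have h4 : (1 + freq η / t) ^ s ≤ 2 ^ s :=
        Real.rpow_le_rpow (by positivity) (by linarith) hs
      rw [heatDefect, hfs t η ht]
      refine (mul_le_mul h4 (norm_smul_sub_smul_sq_le _ _ _ _) (by positivity)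
        (by positivity)).trans ?_
      rw [hD, mul_assoc]
      refine mul_le_mul_of_nonneg_left ?_ (by positivity)
      have h5 : ‖u ((Real.sqrt t)⁻¹ • η)‖ ^ 2 ≤ L ^ 2 :=
        pow_le_pow_left₀ (norm_nonneg _) (hL _) 2
      calc _ ≤ 2 * (E ^ 2 * (1 + freq η) ^ (-2 : ℝ) * L ^ 2)
            + 2 * (C * (1 + freq η) ^ (-2 : ℝ) * ‖V‖ ^ 2) := by gcongr
        _ = _ := by ring
    · exact bot_le
  · have : ∀ η : E3, ENNReal.ofReal (D * (1 + freq η) ^ (-2 : ℝ))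
        = ENNReal.ofReal D * ENNReal.ofReal ((1 + freq η) ^ (-2 : ℝ)) := fun η =>
      ENNReal.ofReal_mul (by positivity)
    simp only [this]
    rw [lintegral_const_mul' _ _ ENNReal.ofReal_ne_top]
    exact (ENNReal.mul_lt_top ENNReal.ofReal_lt_top lintegral_one_add_freq_rpow_lt_top).ne
  · refine Eventually.of_forall fun η => ?_
    have hη : Tendsto (fun t : ℝ => (Real.sqrt t)⁻¹ • η) atTop (𝓝 0) := by
      have := (Real.tendsto_sqrt_atTop.inv_tendsto_atTop).smul_const η
      rwa [zero_smul] at this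
    have h1 : Tendsto (fun t : ℝ => S t (freq η / t) • u ((Real.sqrt t)⁻¹ • η)
        - Real.exp (-(κ * freq η)) • V) atTop (𝓝 0) := by
      have := ((hlim (freq η)).smul ((hu.tendsto 0).comp hη)).sub_const
        (Real.exp (-(κ * freq η)) • V)
      rwa [hV, sub_self] at this
    have h2 : Tendsto (fun t : ℝ => ENNReal.ofReal (2 ^ s * ‖S t (freq η / t)
        • u ((Real.sqrt t)⁻¹ • η) - Real.exp (-(κ * freq η)) • V‖ ^ 2)) atTop (𝓝 0) := by
      have := ENNReal.tendsto_ofReal ((h1.norm.pow 2).const_mul (2 ^ s))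
      simpa using this
    refine tendsto_of_tendsto_of_tendsto_of_le_of_le' tendsto_const_nhds h2
      (Eventually.of_forall fun _ => bot_le) ?_
    filter_upwards [eventually_gt_atTop 0] with t ht
    simp only [hF, indicator_apply, mem_ofPred_eq, hfs t η ht]
    split_ifs with h
    · refine ENNReal.ofReal_le_ofReal ?_
      have hf := freq_nonneg η
      have h4 : (1 + freq η / t) ^ s ≤ 2 ^ s :=
        Real.rpow_le_rpow (by positivity) (by linarith) hs
      rw [heatDefect, hfs t η ht, div_mul_cancel₀ _ ht.ne']
      gcongr
    · exact bot_le

/-- The weighted squared distance to the heat multiplier is `o(t^(-3/2))`. -/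
theorem tendsto_lintegral_heatDefect (hs : 0 ≤ s) (hκ : 0 < κ) (hS : ∀ t, Continuous (S t))
    (hu : Continuous u) {L : ℝ} (hL : ∀ η, ‖u η‖ ≤ L) (hV : u 0 = V)
    (hexp : ∀ t μ, |S t μ| ≤ Real.exp (|μ * t| * M))
    (hdec : ∀ μ t, 0 < μ → 0 < t → |S t μ| ≤ K * (1 + 1 / μ) / t) (hM : 0 ≤ M) (hK : 0 ≤ K)
    (hlim : ∀ μ, Tendsto (fun t => S t (μ / t)) atTop (𝓝 (Real.exp (-(κ * μ)))))
    (hus : ∫⁻ η, ENNReal.ofReal ((1 + freq η) ^ s * ‖u η‖ ^ 2) < ⊤) :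
    Tendsto (fun t : ℝ => ENNReal.ofReal (t ^ (3 / 2 : ℝ))
      * ∫⁻ η, ENNReal.ofReal (heatDefect s κ S u V t η)) atTop (𝓝 0) := by
  have h1 := tendsto_low_frequency hs hκ hS hu hL hV hexp hdec hM hK hlim
  have h2 := tendsto_high_frequency (V := V) hκ hu hdec hK hus
  have h := h1.add h2
  rw [add_zero] at h
  refine h.congr fun t => ?_
  have hset : MeasurableSet {η : E3 | freq η ≤ 1} :=
    measurableSet_le contDiff_freq.continuous.measurable measurable_const
  have hc : {η : E3 | freq η ≤ 1}ᶜ = {η | 1 < freq η} := by ext; simp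
  rw [← mul_add, ← hc, lintegral_add_compl _ hset]

end HeatMultiplier

/-! ### The Fourier transform on `L¹ ∩ L²` -/

lemma ae_eq_of_integral_schwartz_smul_eq {f g : E3 → C3} (hf : LocallyIntegrable f)
    (hg : LocallyIntegrable g) (h : ∀ φ : 𝓢(E3, ℂ), ∫ x, φ x • f x = ∫ x, φ x • g x) :
    f =ᵐ[volume] g := by
  refine ae_eq_of_integral_contDiff_smul_eq hf hg fun φ hφ hc => ?_
  have h1 : HasCompactSupport (Complex.ofRealCLM ∘ φ) := hc.comp_left rfl
  have h2 : ContDiff ℝ ∞ (Complex.ofRealCLM ∘ φ) := Complex.ofRealCLM.contDiff.comp hφ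
  exact h (h1.toSchwartzMap h2)

lemma continuous_fourier {f : E3 → C3} (hf : Integrable f) : Continuous (𝓕 f) :=
  VectorFourier.fourierIntegral_continuous Real.continuous_fourierChar continuous_inner hf

lemma integral_fourier_smul_flip (φ : 𝓢(E3, ℂ)) {f : E3 → C3} (hf : Integrable f) :
    ∫ x, 𝓕 φ x • f x = ∫ x, φ x • 𝓕 f x := by
  have h := VectorFourier.integral_fourierIntegral_smul_eq_flip (μ := volume) (ν := volume)
    (L := innerₗ E3) (f := ⇑φ) (g := f) Real.continuous_fourierChar continuous_inner φ.integrable hf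
  rw [flip_innerₗ] at h
  exact h

lemma integral_fourierInv_smul_flip (φ : 𝓢(E3, ℂ)) {f : E3 → C3} (hf : Integrable f) :
    ∫ x, 𝓕⁻ φ x • f x = ∫ x, φ x • 𝓕⁻ f x := by
  have h1 : ∀ x, 𝓕⁻ φ x = 𝓕 φ (-x) := fun x => by
    rw [SchwartzMap.fourierInv_coe, SchwartzMap.fourier_coe, Real.fourierInv_eq_fourier_neg]
  simp only [h1]
  rw [← integral_neg_eq_self, Real.fourierInv_eq_fourier_comp_neg]
  simp only [neg_neg]
  exact integral_fourier_smul_flip φ hf.comp_neg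

/-- Both transforms have the same pairing with every Schwartz function: one by compatibility with
tempered distributions, the other by Fubini. -/
theorem fourier_toLp_ae_eq {f : E3 → C3} (hf : Integrable f) (hf2 : MemLp f 2 volume) :
    (𝓕 (hf2.toLp f) : Lp C3 2 (volume : Measure E3)) =ᵐ[volume] 𝓕 f := by
  refine ae_eq_of_integral_schwartz_smul_eq ((Lp.memLp _).locallyIntegrable (by norm_num))
    (continuous_fourier hf).locallyIntegrable fun φ => ?_
  have h := congrArg (fun T => T φ) (Lp.fourier_toTemperedDistribution_eq (hf2.toLp f))
  simp only [TemperedDistribution.fourier_apply, Lp.toTemperedDistribution_apply] at h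
  rw [← h, ← integral_fourier_smul_flip φ hf]
  refine integral_congr_ae ?_
  filter_upwards [hf2.coeFn_toLp] with x hx
  rw [hx]

theorem fourierInv_toLp_ae_eq {f : E3 → C3} (hf : Integrable f) (hf2 : MemLp f 2 volume) :
    (𝓕⁻ (hf2.toLp f) : Lp C3 2 (volume : Measure E3)) =ᵐ[volume] 𝓕⁻ f := by
  have hc : Continuous (𝓕⁻ f) := by
    rw [Real.fourierInv_eq_fourier_comp_neg]; exact continuous_fourier hf.comp_neg
  refine ae_eq_of_integral_schwartz_smul_eq ((Lp.memLp _).locallyIntegrable (by norm_num))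
    hc.locallyIntegrable fun φ => ?_
  have h := congrArg (fun T => T φ) (Lp.fourierInv_toTemperedDistribution_eq (hf2.toLp f))
  simp only [TemperedDistribution.fourierInv_apply, Lp.toTemperedDistribution_apply] at h
  rw [← h, ← integral_fourierInv_smul_flip φ hf]
  refine integral_congr_ae ?_
  filter_upwards [hf2.coeFn_toLp] with x hx
  rw [hx]

/-! ### The fundamental solution of the Stokes system -/

lemma integrable_fourierInv_integrand {F : Type*} [NormedAddCommGroup F] [NormedSpace ℂ F]
    {f : E3 → F} (hf : Integrable f) (x : E3) :
    Integrable fun η => Real.fourierChar ⟪η, x⟫ • f η := by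
  have := (Real.fourierIntegral_convergent_iff (μ := volume) (-x)).2 hf
  simpa using this

lemma fourierInv_add {f g : E3 → ℂ} (hf : Integrable f) (hg : Integrable g) (x : E3) :
    𝓕⁻ (fun η => f η + g η) x = 𝓕⁻ f x + 𝓕⁻ g x := by
  rw [Real.fourierInv_eq, Real.fourierInv_eq, Real.fourierInv_eq,
    ← integral_add (integrable_fourierInv_integrand hf x) (integrable_fourierInv_integrand hg x)]
  simp only [smul_add]

lemma fourierInv_sum {ι : Type*} (t : Finset ι) (c : ι → ℂ) {f : ι → E3 → ℂ}
    (hf : ∀ j, Integrable (f j)) (x : E3) :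
    𝓕⁻ (fun η => ∑ j ∈ t, c j * f j η) x = ∑ j ∈ t, c j * 𝓕⁻ (f j) x := by
  simp only [Real.fourierInv_eq, Finset.smul_sum]
  rw [integral_finsetSum t fun j _ => integrable_fourierInv_integrand ((hf j).const_mul (c j)) x]
  refine Finset.sum_congr rfl fun j _ => ?_
  rw [← integral_const_mul]
  congr 1; ext η
  rw [mul_smul_comm]

lemma fourierInv_component {f : E3 → C3} (hf : Integrable f) (x : E3) (i : Fin 3) :
    𝓕⁻ f x i = 𝓕⁻ (fun η => f η i) x := by
  have h := (EuclideanSpace.proj i : C3 →L[ℂ] ℂ).integral_comp_comm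
    (integrable_fourierInv_integrand hf x)
  rw [Real.fourierInv_eq, Real.fourierInv_eq]
  refine Eq.trans h.symm (integral_congr_ae (Eventually.of_forall fun η => ?_))
  simp [Circle.smul_def]

lemma integrable_exp_freq {c : ℝ} (hc : 0 < c) : Integrable fun η : E3 => Real.exp (-(c * freq η)) := by
  obtain ⟨C, hC0, hC⟩ := exists_rpow_mul_exp_le 0 hc
  have hm : Continuous fun η : E3 => Real.exp (-(c * freq η)) := by
    have := contDiff_freq.continuous
    fun_prop
  refine ⟨hm.aestronglyMeasurable, ?_⟩
  rw [hasFiniteIntegral_iff_ofReal (Eventually.of_forall fun η => (Real.exp_pos _).le)]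
  have h : ∀ η : E3, ENNReal.ofReal (Real.exp (-(c * freq η)))
      ≤ ENNReal.ofReal C * ENNReal.ofReal ((1 + freq η) ^ (-2 : ℝ)) := fun η => by
    rw [← ENNReal.ofReal_mul hC0]
    refine ENNReal.ofReal_le_ofReal ?_
    simpa using hC _ (freq_nonneg η)
  refine lt_of_le_of_lt (lintegral_mono h) ?_
  rw [lintegral_const_mul' _ _ ENNReal.ofReal_ne_top]
  exact ENNReal.mul_lt_top ENNReal.ofReal_lt_top lintegral_one_add_freq_rpow_lt_top

/-- The Fourier transform of `Vᵀ U(x, B t) + Vᵀ V(x, A t)`. -/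
def stokesSymbol (A B : ℝ) (V : C3) (t : ℝ) (η : E3) : C3 :=
  propagate (Real.exp (-(B * (freq η * t)))) (Real.exp (-(A * (freq η * t)))) η V

lemma norm_propagate_le (p q : ℝ) (η : E3) (y : C3) :
    ‖propagate p q η y‖ ≤ (|p| + 2 * |q|) * ‖y‖ := by
  have h1 := norm_longProj_le η y
  have h2 := norm_sub_le y (longProj η y)
  refine (norm_add_le _ _).trans ?_
  rw [norm_smul, norm_smul, Real.norm_eq_abs, Real.norm_eq_abs]
  nlinarith [abs_nonneg p, abs_nonneg q, mul_le_mul_of_nonneg_left h1 (abs_nonneg p),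
    mul_le_mul_of_nonneg_left (h2.trans (add_le_add le_rfl h1)) (abs_nonneg q)]

lemma measurable_longProj (V : C3) : Measurable fun η => longProj η V := by
  simp only [longProj_eq_smul]
  have h : Continuous fun η : E3 => (inner ℂ (longField η) V) • longField η := by fun_prop
  have h2 : Measurable fun η : E3 => (((‖η‖ ^ 2 : ℝ) : ℂ))⁻¹ :=
    (Complex.measurable_ofReal.comp (measurable_norm.pow_const 2)).inv
  exact h2.smul h.measurable

lemma measurable_propagate {p q : E3 → ℝ} (hp : Measurable p) (hq : Measurable q) (V : C3) :
    Measurable fun η => propagate (p η) (q η) η V :=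
  (hp.smul (measurable_longProj V)).add (hq.smul (measurable_const.sub (measurable_longProj V)))

lemma measurable_exp_freq (c t : ℝ) : Measurable fun η : E3 => Real.exp (-(c * (freq η * t))) := by
  have := contDiff_freq.continuous
  exact Continuous.measurable (by fun_prop)

lemma integrable_exp_freq_mul {c t : ℝ} (hc : 0 < c) (ht : 0 < t) :
    Integrable fun η : E3 => Real.exp (-(c * (freq η * t))) := by
  refine (integrable_exp_freq (mul_pos hc ht)).congr (Eventually.of_forall fun η => ?_)
  dsimp only
  congr 1; ring

lemma integrable_stokesSymbol {A B : ℝ} (hA : 0 < A) (hB : 0 < B) (V : C3) {t : ℝ} (ht : 0 < t) :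
    Integrable (stokesSymbol A B V t) := by
  refine (((integrable_exp_freq_mul hB ht).add ((integrable_exp_freq_mul hA ht).const_mul
    2)).mul_const ‖V‖).mono'
    (measurable_propagate (measurable_exp_freq B t) (measurable_exp_freq A t) V).aestronglyMeasurable
    (Eventually.of_forall fun η => ?_)
  refine (norm_propagate_le _ _ η V).trans (le_of_eq ?_)
  simp [abs_of_pos (Real.exp_pos _)]

lemma norm_stokesSymbol_le {A B : ℝ} (hA : 0 < A) (hB : 0 < B) (V : C3) {t : ℝ} (ht : 0 < t)
    (η : E3) : ‖stokesSymbol A B V t η‖ ≤ 3 * ‖V‖ := by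
  have h : ∀ {c : ℝ}, 0 < c → |Real.exp (-(c * (freq η * t)))| ≤ 1 := fun {c} hc => by
    have := freq_nonneg η
    rw [abs_of_pos (Real.exp_pos _), Real.exp_le_one_iff]
    have : 0 ≤ c * (freq η * t) := by positivity
    linarith
  refine (norm_propagate_le _ _ η V).trans (mul_le_mul_of_nonneg_right ?_ (norm_nonneg V))
  linarith [h hA, h hB]

lemma memLp_stokesSymbol {A B : ℝ} (hA : 0 < A) (hB : 0 < B) (V : C3) {t : ℝ} (ht : 0 < t) :
    MemLp (stokesSymbol A B V t) 2 volume := by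
  have hi := integrable_stokesSymbol hA hB V ht
  rw [memLp_two_iff_integrable_sq_norm hi.aestronglyMeasurable]
  refine (hi.norm.const_mul (3 * ‖V‖)).mono' (hi.aestronglyMeasurable.norm.pow 2)
    (Eventually.of_forall fun η => ?_)
  have h := norm_stokesSymbol_le hA hB V ht η
  rw [Real.norm_of_nonneg (by positivity), sq]
  exact mul_le_mul_of_nonneg_right h (norm_nonneg _)

/-- The projection is homogeneous of degree 0 in the frequency, so the factor 2π survives only in
the exponential. The row index labels the input vector, in accordance with the product wᵀM. -/
lemma gradSymbol_eq (c t : ℝ) (η : E3) (j i : Fin 3) :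
    gradSymbol (c * t) ((2 * Real.pi) • η) j i
      = propagate (Real.exp (-(c * (freq η * t)))) 0 η (EuclideanSpace.single j 1) i := by
  have e : ‖(2 * Real.pi) • η‖ ^ 2 * (c * t) = c * (freq η * t) := by rw [freq]; ring
  have e2 : (2 * Real.pi * η j) * (2 * Real.pi * η i) / ‖(2 * Real.pi) • η‖ ^ 2
      = η j * η i / ‖η‖ ^ 2 := by
    rw [norm_smul, mul_pow, Real.norm_of_nonneg (by positivity)]
    rw [show (2 * Real.pi * η j) * (2 * Real.pi * η i) = (2 * Real.pi) ^ 2 * (η j * η i) by ring]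
    exact mul_div_mul_left _ _ (by positivity)
  simp only [gradSymbol, propagate, PiLp.smul_apply, smul_eq_mul, e, e2, zero_smul, add_zero,
    longProj_apply, Complex.real_smul, PiLp.single_apply, mul_ite, mul_one, mul_zero,
    Finset.sum_ite_eq', Finset.mem_univ, if_true]
  push_cast
  ring

lemma solSymbol_eq (c t : ℝ) (η : E3) (j i : Fin 3) :
    solSymbol (c * t) ((2 * Real.pi) • η) j i
      = propagate 0 (Real.exp (-(c * (freq η * t)))) η (EuclideanSpace.single j 1) i := by
  have e : ‖(2 * Real.pi) • η‖ ^ 2 * (c * t) = c * (freq η * t) := by rw [freq]; ring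
  have e2 : (2 * Real.pi * η j) * (2 * Real.pi * η i) / ‖(2 * Real.pi) • η‖ ^ 2
      = η j * η i / ‖η‖ ^ 2 := by
    rw [norm_smul, mul_pow, Real.norm_of_nonneg (by positivity)]
    rw [show (2 * Real.pi * η j) * (2 * Real.pi * η i) = (2 * Real.pi) ^ 2 * (η j * η i) by ring]
    exact mul_div_mul_left _ _ (by positivity)
  simp only [solSymbol, propagate, PiLp.smul_apply, PiLp.sub_apply, smul_eq_mul, e, e2, zero_smul,
    zero_add, longProj_apply, Complex.real_smul, PiLp.single_apply, mul_ite, mul_one,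
    mul_zero, Finset.sum_ite_eq', Finset.mem_univ, if_true, Matrix.one_apply]
  rw [if_congr (eq_comm (a := i) (b := j)) rfl rfl]
  split_ifs <;> push_cast <;> ring

lemma propagate_zero_right (p q : ℝ) (η : E3) (y : C3) :
    propagate p q η y = propagate p 0 η y + propagate 0 q η y := by
  simp [propagate]

lemma sum_mul_propagate (w : E3) (p q : ℝ) (η : E3) (i : Fin 3) :
    ∑ j, (w j : ℂ) * propagate p q η (EuclideanSpace.single j 1) i
      = propagate p q η (longField w) i := by
  simp only [propagate, PiLp.add_apply, PiLp.smul_apply, PiLp.sub_apply, longProj_apply,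
    longField_apply, PiLp.single_apply, mul_ite, mul_one, mul_zero, Finset.sum_ite_eq',
    Finset.mem_univ, if_true, Complex.real_smul, Fin.sum_univ_three]
  fin_cases i <;> simp <;> ring

lemma integrable_component {f : E3 → C3} (hf : Integrable f) (i : Fin 3) :
    Integrable fun η => f η i :=
  (EuclideanSpace.proj i : C3 →L[ℂ] ℂ).integrable_comp hf

lemma integrable_gradSymbol {c t : ℝ} (hc : 0 < c) (ht : 0 < t) (j i : Fin 3) :
    Integrable fun η : E3 => gradSymbol (c * t) ((2 * Real.pi) • η) j i := by
  simp only [gradSymbol_eq]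
  refine integrable_component (f := fun η => propagate (Real.exp (-(c * (freq η * t)))) 0 η
    (EuclideanSpace.single j 1)) ?_ i
  refine (integrable_exp_freq_mul hc ht).mono' (measurable_propagate (measurable_exp_freq c t)
    measurable_const _).aestronglyMeasurable (Eventually.of_forall fun η => ?_)
  refine (norm_propagate_le _ _ _ _).trans (le_of_eq ?_)
  simp

lemma integrable_solSymbol {c t : ℝ} (hc : 0 < c) (ht : 0 < t) (j i : Fin 3) :
    Integrable fun η : E3 => solSymbol (c * t) ((2 * Real.pi) • η) j i := by
  simp only [solSymbol_eq]
  refine integrable_component (f := fun η => propagate 0 (Real.exp (-(c * (freq η * t)))) η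
    (EuclideanSpace.single j 1)) ?_ i
  refine ((integrable_exp_freq_mul hc ht).const_mul 2).mono' (measurable_propagate measurable_const
    (measurable_exp_freq c t) _).aestronglyMeasurable (Eventually.of_forall fun η => ?_)
  refine (norm_propagate_le _ _ _ _).trans (le_of_eq ?_)
  simp

lemma rowMul_stokes_eq {A B : ℝ} (hA : 0 < A) (hB : 0 < B) (w : E3) {t : ℝ} (ht : 0 < t) (x : E3) :
    rowMul w (stokesU x (B * t)) + rowMul w (stokesV x (A * t))
      = 𝓕⁻ (stokesSymbol A B (longField w) t) x := by
  ext i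
  rw [fourierInv_component (integrable_stokesSymbol hA hB _ ht)]
  have e : (fun η => stokesSymbol A B (longField w) t η i) = fun η =>
      (∑ j, (w j : ℂ) * gradSymbol (B * t) ((2 * Real.pi) • η) j i)
        + ∑ j, (w j : ℂ) * solSymbol (A * t) ((2 * Real.pi) • η) j i := by
    ext η
    simp only [gradSymbol_eq, solSymbol_eq, sum_mul_propagate]
    rw [stokesSymbol, propagate_zero_right, PiLp.add_apply]
  have i1 := fun j => integrable_gradSymbol hB ht j i
  have i2 := fun j => integrable_solSymbol hA ht j i
  rw [e, fourierInv_add (integrable_finsetSum _ fun j _ => (i1 j).const_mul _)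
    (integrable_finsetSum _ fun j _ => (i2 j).const_mul _), fourierInv_sum _ _ i1,
    fourierInv_sum _ _ i2]
  simp [rowMul, Matrix.vecMul, dotProduct, stokesU, stokesV]

/-! ### The remainder -/

lemma complexify_apply (f : E3 → E3) (x : E3) : complexify f x = longField (f x) := rfl

lemma integrable_complexify {f : E3 → E3} (hf : Integrable f) : Integrable (complexify f) :=
  longField.integrable_comp hf

lemma integral_complexify {f : E3 → E3} (hf : Integrable f) :
    ∫ x, complexify f x = longField (∫ x, f x) := longField.integral_comp_comm hf

lemma fourier_zero_eq_integral (f : E3 → C3) : 𝓕 f 0 = ∫ x, f x := by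
  rw [Real.fourier_eq]; simp

lemma norm_fourier_le_integral (f : E3 → C3) (η : E3) : ‖𝓕 f η‖ ≤ ∫ x, ‖f x‖ :=
  VectorFourier.norm_fourierIntegral_le_integral_norm _ _ _ _ _

lemma sobolevNorm_eq {s : ℝ} {f : E3 → C3} (hf : MemLp f 2 (volume : Measure E3)) {g : E3 → C3}
    (hg : (𝓕 (hf.toLp f) : Lp C3 2 (volume : Measure E3)) =ᵐ[volume] g) :
    sobolevNorm s f = (∫⁻ η, ENNReal.ofReal ((1 + freq η) ^ s * ‖g η‖ ^ 2)) ^ (1 / 2 : ℝ) := by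
  rw [sobolevNorm, dif_pos hf]
  congr 1
  refine lintegral_congr_ae ?_
  filter_upwards [hg] with η hη
  rw [hη, ENNReal.ofReal_mul (Real.rpow_nonneg (by linarith [freq_nonneg η]) s),
    ENNReal.ofReal_pow (norm_nonneg _), ofReal_norm]
  rfl

lemma propagate_sub (p q p' q' : ℝ) (η : E3) (y z : C3) :
    propagate p q η y - propagate p' q' η z
      = longProj η (p • y - p' • z) + ((q • y - q' • z) - longProj η (q • y - q' • z)) := by
  simp only [propagate, longProj_sub, longProj_smul, smul_sub]
  abel

/-- The projection does not increase norms, so the difference is at most x + 2y with x, y the two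
defects, and (x + 2y)² ≤ 2x² + 8y². -/
lemma norm_propagate_sub_sq_le (p q p' q' : ℝ) (η : E3) (y z : C3) :
    ‖propagate p q η y - propagate p' q' η z‖ ^ 2
      ≤ 2 * ‖p • y - p' • z‖ ^ 2 + 8 * ‖q • y - q' • z‖ ^ 2 := by
  rw [propagate_sub]
  have h1 := norm_add_le (longProj η (p • y - p' • z))
    ((q • y - q' • z) - longProj η (q • y - q' • z))
  have h2 := norm_longProj_le η (p • y - p' • z)
  have h3 := norm_sub_le (q • y - q' • z) (longProj η (q • y - q' • z))
  have h4 := norm_longProj_le η (q • y - q' • z)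
  have h5 := h1.trans (add_le_add h2 (h3.trans (add_le_add le_rfl h4)))
  refine (pow_le_pow_left₀ (norm_nonneg _) h5 2).trans ?_
  nlinarith [sq_nonneg (‖p • y - p' • z‖ - 2 * ‖q • y - q' • z‖)]

/-- The Fourier transform of the remainder, and hence its Sobolev norm. -/
lemma sobolevNorm_remainder {s A B : ℝ} (hA : 0 < A) (hB : 0 < B) (w : E3) {v : ℝ → E3 → E3}
    {t : ℝ} (ht : 0 < t) {W : Lp C3 2 (volume : Measure E3)}
    (hW : W =ᵐ[volume] complexify (v t)) {g : E3 → C3}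
    (hg : (𝓕 W : Lp C3 2 (volume : Measure E3)) =ᵐ[volume] g) :
    sobolevNorm s (remainder A B w v t) = (∫⁻ η, ENNReal.ofReal ((1 + freq η) ^ s
      * ‖g η - stokesSymbol A B (longField w) t η‖ ^ 2)) ^ (1 / 2 : ℝ) := by
  have hZ := integrable_stokesSymbol hA hB (longField w) ht
  have hZ2 := memLp_stokesSymbol hA hB (longField w) ht
  set Z : Lp C3 2 (volume : Measure E3) := hZ2.toLp with hZdef
  -- The Stokes kernel is an inverse Fourier integral of a function in L¹ ∩ L², so the remainder is
  -- an L² difference whose transform is known.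
  have hR : (W - 𝓕⁻ Z : Lp C3 2 (volume : Measure E3)) =ᵐ[volume] remainder A B w v t := by
    filter_upwards [Lp.coeFn_sub W (𝓕⁻ Z : Lp C3 2 (volume : Measure E3)), hW,
      fourierInv_toLp_ae_eq hZ hZ2] with x h1 h2 h3
    rw [h1, Pi.sub_apply, h2, h3, ← rowMul_stokes_eq hA hB w ht x, remainder, sub_sub]
  have hmem : MemLp (remainder A B w v t) 2 (volume : Measure E3) := (memLp_congr_ae hR).1 (Lp.memLp _)
  have hto : hmem.toLp = W - 𝓕⁻ Z := by
    rw [← Lp.toLp_coeFn (W - 𝓕⁻ Z : Lp C3 2 (volume : Measure E3)) (Lp.memLp _)]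
    exact MemLp.toLp_congr _ _ hR.symm
  refine sobolevNorm_eq hmem ?_
  have hsub : (𝓕 (W - 𝓕⁻ Z) : Lp C3 2 (volume : Measure E3)) = 𝓕 W - 𝓕 (𝓕⁻ Z) :=
    map_sub (Lp.fourierTransformₗᵢ E3 C3) W (𝓕⁻ Z)
  rw [hto, hsub, FourierTransform.fourier_fourierInv_eq]
  filter_upwards [Lp.coeFn_sub (𝓕 W : Lp C3 2 (volume : Measure E3)) Z, hg, hZ2.coeFn_toLp]
    with η h1 h2 h3
  rw [h1, Pi.sub_apply, h2, h3]

/-- The multiplier of an admissible kernel approaches the heat multiplier. -/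
lemma AdmissibleKernel.heatDefect_bounds {α c : ℝ} (hα : 0 < α) {k : ℝ → ℝ}
    (h : AdmissibleKernel α c k) {s : ℝ} (hs : 0 ≤ s) {u : E3 → C3} (hu : Continuous u) {L : ℝ}
    (hL : ∀ η, ‖u η‖ ≤ L) (hus : ∫⁻ η, ENNReal.ofReal ((1 + freq η) ^ s * ‖u η‖ ^ 2) < ⊤) :
    (∀ t, 0 < t → ∫⁻ η, ENNReal.ofReal (heatDefect s (c + ∫ r in Ioi (0 : ℝ), k r)
      (resolvent (memoryKernel c k)) u (u 0) t η) < ⊤) ∧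
    Tendsto (fun t : ℝ => ENNReal.ofReal (t ^ (3 / 2 : ℝ))
      * ∫⁻ η, ENNReal.ofReal (heatDefect s (c + ∫ r in Ioi (0 : ℝ), k r)
        (resolvent (memoryKernel c k)) u (u 0) t η)) atTop (𝓝 0) := by
  obtain ⟨⟨M, C, m, hG⟩, hκ⟩ := h.exists_symbol hα
  have hk := h.integrable
  obtain ⟨K, hK, hdec⟩ := exists_resolvent_decay hk hG
  have hN := continuous_memoryKernel (c := c) hk
  have hM := abs_memoryKernel_le (c := c) hk
  have hexp : ∀ t μ, |resolvent (memoryKernel c k) t μ| ≤ Real.exp (|μ * t| * _) := fun t μ =>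
    abs_resolvent_le hM t μ
  have hM0 : 0 ≤ |c| + ∫ r in Ioi (0 : ℝ), ‖k r‖ := memoryBound_nonneg
  have hS : ∀ t, Continuous (resolvent (memoryKernel c k) t) := fun t =>
    (continuous_resolvent hN hM).comp (continuous_const.prodMk continuous_id)
  exact ⟨fun t ht => lintegral_heatDefect_lt_top hκ hu hexp hdec hM0 hK hus ht,
    tendsto_lintegral_heatDefect hs hκ hS hu hL rfl hexp hdec hM0 hK
      (fun μ => tendsto_resolvent hN hM (tendsto_memoryKernel hk) μ) hus⟩

/-- Taking square roots halves the exponent 3/2. -/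
lemma isLittleO_toReal_sqrt {F : ℝ → ℝ≥0∞}
    (h : Tendsto (fun t : ℝ => ENNReal.ofReal (t ^ (3 / 2 : ℝ)) * F t) atTop (𝓝 0)) :
    (fun t => (F t ^ (1 / 2 : ℝ)).toReal) =o[atTop] fun t : ℝ => t ^ (-(3 : ℝ) / 4) := by
  have h1 : Tendsto (fun t : ℝ => (ENNReal.ofReal (t ^ (3 / 2 : ℝ)) * F t).toReal) atTop (𝓝 0) := by
    have := (ENNReal.tendsto_toReal ENNReal.zero_ne_top).comp h
    rwa [ENNReal.toReal_zero] at this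
  have h2 := h1.rpow_const (p := 1 / 2) (Or.inr (by norm_num))
  rw [Real.zero_rpow (by norm_num)] at h2
  rw [isLittleO_iff_tendsto' (by
    filter_upwards [eventually_gt_atTop 0] with t ht h0
    exact absurd h0 (Real.rpow_pos_of_pos ht _).ne')]
  refine h2.congr' ?_
  filter_upwards [eventually_gt_atTop 0] with t ht
  rw [ENNReal.toReal_mul, ENNReal.toReal_ofReal (by positivity), Real.mul_rpow (by positivity)
    ENNReal.toReal_nonneg, ← ENNReal.toReal_rpow, ← Real.rpow_mul ht.le, eq_div_iff
    (Real.rpow_pos_of_pos ht _).ne', mul_right_comm, ← Real.rpow_add ht]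
  norm_num

/-- The distance of the solution to the Stokes flow in frequency space is controlled by the
defects of its gradient and divergence free parts. -/
lemma remainder_bound {s p₁ p₂ : ℝ} {S₁ S₂ : ℝ → ℝ → ℝ} {u : E3 → C3} (hu : Continuous u)
    (hS₁ : ∀ t, Continuous (S₁ t)) (V : C3) (t : ℝ) :
    ∫⁻ η, ENNReal.ofReal ((1 + freq η) ^ s * ‖propagate (S₁ t (freq η)) (S₂ t (freq η)) η (u η)
        - stokesSymbol p₂ p₁ V t η‖ ^ 2)
      ≤ ENNReal.ofReal 2 * (∫⁻ η, ENNReal.ofReal (heatDefect s p₁ S₁ u V t η))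
        + ENNReal.ofReal 8 * ∫⁻ η, ENNReal.ofReal (heatDefect s p₂ S₂ u V t η) := by
  rw [← lintegral_const_mul' _ _ ENNReal.ofReal_ne_top, ← lintegral_const_mul' _ _ ENNReal.ofReal_ne_top,
    ← lintegral_add_left ((measurable_heatDefect hS₁ hu t).ennreal_ofReal.const_mul _)]
  refine lintegral_mono fun η => ?_
  have h0 : 0 ≤ (1 + freq η) ^ s := Real.rpow_nonneg (by linarith [freq_nonneg η]) s
  have hd : ∀ p S, 0 ≤ heatDefect s p S u V t η := fun p S => mul_nonneg h0 (sq_nonneg _)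
  rw [← ENNReal.ofReal_mul (by norm_num), ← ENNReal.ofReal_mul (by norm_num),
    ← ENNReal.ofReal_add (mul_nonneg (by norm_num) (hd _ _)) (mul_nonneg (by norm_num) (hd _ _))]
  refine ENNReal.ofReal_le_ofReal ?_
  refine (mul_le_mul_of_nonneg_left (norm_propagate_sub_sq_le _ _ _ _ _ _ _) h0).trans (le_of_eq ?_)
  rw [heatDefect, heatDefect]
  ring

end

end BoltzmannVisco

/-! ### Proof of the asymptotic expansion -/

open BoltzmannVisco

theorem theorem6p2
    (s : ℝ) (hs : 0 ≤ s)
    (a₀ b₀ : ℝ) (a b : ℝ → ℝ)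
    (α : ℝ) (hα : 0 < α)
    (ha : BoltzmannVisco.AdmissibleKernel α a₀ a)
    (hβ : BoltzmannVisco.AdmissibleKernel α ((4 * a₀ + 2 * b₀) / 3)
      (fun t => (4 * a t + 2 * b t) / 3))
    (v₀ : BoltzmannVisco.E3 → BoltzmannVisco.E3)
    (hv₀_int : Integrable v₀ volume)
    (hv₀_sob : BoltzmannVisco.MemSobolevSpace s v₀)
    (v : ℝ → BoltzmannVisco.E3 → BoltzmannVisco.E3)
    (hv : BoltzmannVisco.IsSolution s a₀ b₀ a b v₀ v)
    (A B : ℝ)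
    (hA : A = a₀ + ∫ r in Ioi (0 : ℝ), a r)
    (hB : B = 4 / 3 * A + 2 / 3 * (b₀ + ∫ r in Ioi (0 : ℝ), b r))
    (V₀ : BoltzmannVisco.E3) (hV₀ : V₀ = ∫ x, v₀ x) :
    (∀ t, 0 < t →
      BoltzmannVisco.sobolevNorm s (BoltzmannVisco.remainder A B V₀ v t) < ⊤) ∧
    (fun t => (BoltzmannVisco.sobolevNorm s (BoltzmannVisco.remainder A B V₀ v t)).toReal)
      =o[atTop] (fun t : ℝ => t ^ (-(3 : ℝ) / 4)) := by
  -- Integrability of b is recovered from b = (3β - 4a)/2.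
  have hkb : IntegrableOn b (Ioi 0) := by
    refine (((hβ.integrable.const_mul 3).sub (ha.integrable.const_mul 4)).div_const 2).congr
      (Eventually.of_forall fun t => ?_)
    simp only [Pi.sub_apply]
    ring
  -- B is the limit of the integrated kernel of the pair (β₀, β), as A is for (a₀, a).
  have hB' : B = (4 * a₀ + 2 * b₀) / 3 + ∫ r in Ioi (0 : ℝ), (4 * a r + 2 * b r) / 3 := by
    have h := integral_add (ha.integrable.const_mul 4) (hkb.const_mul 2)
    rw [integral_const_mul, integral_const_mul] at h
    rw [integral_div, h, hB, hA]
    ring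
  obtain ⟨w, hwc, hw⟩ := hv.continuous.exists_curve hs
  have hw0 : w 0 =ᵐ[volume] complexify v₀ := by
    filter_upwards [hw 0 le_rfl, hv.initial] with x h1 h2
    rw [h1, complexify_apply, complexify_apply, h2]
  have hL1 := integrable_complexify hv₀_int
  have hL2 := hv₀_sob.memLp
  set u : E3 → C3 := 𝓕 (complexify v₀) with hudef
  have hu : Continuous u := continuous_fourier hL1
  have hu_ae := fourier_toLp_ae_eq hL1 hL2
  have hW0 : (𝓕 (w 0) : Lp C3 2 (volume : Measure E3)) =ᵐ[volume] u := by
    have e : w 0 = hL2.toLp := by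
      rw [← Lp.toLp_coeFn (w 0) (Lp.memLp _)]
      exact MemLp.toLp_congr _ _ hw0
    rw [e]; exact hu_ae
  -- The total momentum is the value of the continuous transform at frequency 0; this selects the
  -- leading term.
  have hV : u 0 = longField V₀ := by
    rw [hudef, fourier_zero_eq_integral, integral_complexify hv₀_int, hV₀]
  have hus : ∫⁻ η, ENNReal.ofReal ((1 + freq η) ^ s * ‖u η‖ ^ 2) < ⊤ := by
    have h := hv₀_sob
    rw [MemSobolevSpace, sobolevNorm_eq hL2 hu_ae] at h
    exact (ENNReal.rpow_lt_top_iff_of_pos (by norm_num)).1 h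
  have hAκ : 0 < A := by
    rw [hA]; exact (ha.exists_symbol hα).2
  have hBκ : 0 < B := by
    rw [hB']; exact (hβ.exists_symbol hα).2
  have hL := norm_fourier_le_integral (complexify v₀)
  obtain ⟨fa, ta⟩ := ha.heatDefect_bounds hα hs hu hL hus
  obtain ⟨fb, tb⟩ := hβ.heatDefect_bounds hα hs hu hL hus
  rw [← hA, hV] at fa ta
  rw [← hB', hV] at fb tb
  set Sa := resolvent (memoryKernel a₀ a) with hSa
  set Sb := resolvent (memoryKernel ((4 * a₀ + 2 * b₀) / 3) fun t => (4 * a t + 2 * b t) / 3) with hSb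
  have hSbc : ∀ t, Continuous (Sb t) := fun t =>
    (continuous_resolvent (continuous_memoryKernel hβ.integrable)
      (abs_memoryKernel_le hβ.integrable)).comp (continuous_const.prodMk continuous_id)
  set F : ℝ → ℝ≥0∞ := fun t => ∫⁻ η, ENNReal.ofReal ((1 + freq η) ^ s
    * ‖propagate (Sb t (freq η)) (Sa t (freq η)) η (u η)
      - stokesSymbol A B (longField V₀) t η‖ ^ 2) with hF
  have hnorm : ∀ t, 0 < t → sobolevNorm s (remainder A B V₀ v t) = F t ^ (1 / 2 : ℝ) := by
    intro t ht
    refine sobolevNorm_remainder hAκ hBκ V₀ ht (hw t ht.le) ?_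
    filter_upwards [hv.weak.fourier_ae hv.initial ha.integrable hkb hwc hw ht.le, hW0] with η h1 h2
    rw [h1, h2]
  have hbound : ∀ t, F t ≤ _ := fun t => remainder_bound (p₁ := B) (p₂ := A) (S₂ := Sa) hu hSbc
    (longField V₀) t
  have hfin : ∀ t, 0 < t → F t < ⊤ := fun t ht => (hbound t).trans_lt
    (ENNReal.add_lt_top.2 ⟨ENNReal.mul_lt_top ENNReal.ofReal_lt_top (fb t ht),
      ENNReal.mul_lt_top ENNReal.ofReal_lt_top (fa t ht)⟩)
  have hlim : Tendsto (fun t : ℝ => ENNReal.ofReal (t ^ (3 / 2 : ℝ)) * F t) atTop (𝓝 0) := by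
    have h := (ENNReal.Tendsto.const_mul (a := ENNReal.ofReal 2) tb
      (Or.inr ENNReal.ofReal_ne_top)).add (ENNReal.Tendsto.const_mul (a := ENNReal.ofReal 8) ta
      (Or.inr ENNReal.ofReal_ne_top))
    rw [mul_zero, mul_zero, add_zero] at h
    refine tendsto_of_tendsto_of_tendsto_of_le_of_le tendsto_const_nhds h (fun _ => bot_le)
      fun t => ?_
    refine (mul_le_mul_right (hbound t) _).trans (le_of_eq ?_)
    ring
  refine ⟨fun t ht => ?_, ?_⟩
  · rw [hnorm t ht]
    exact ENNReal.rpow_lt_top_of_nonneg (by norm_num) (hfin t ht).ne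
  · refine (isLittleO_toReal_sqrt hlim).congr' ?_ EventuallyEq.rfl
    filter_upwards [eventually_gt_atTop 0] with t ht
    rw [hnorm t ht]
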